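/- Let $n\ge 0$, $\mu<0$ and $\kappa>0$ be given, let $P=\mathbb C^{n+1}\setminus\{0\}$, write $z\bar z=\sum_{i=1}^{n+1}|z^i|^2$, and let $E=\sum_i z^i\partial_{z^i}$, $\bar E=\sum_i\bar z^i\partial_{\bar z^i}$. Equip $P$ with the symplectic form $\omega=\frac{i}{\kappa}\sum_j dz^j\wedge d\bar z^j$, with Poisson bracket $\{f,g\}=\frac{\kappa}{i}\sum_j(\partial_{z^j}f\,\partial_{\bar z^j}g-\partial_{\bar z^j}f\,\partial_{z^j}g)$, and $C^\infty(P)[[\lambda]]$ with the corresponding Wick product $$f*g=\sum_{r\ge0}\lambda^rM_r(f,g),\qquad M_r(f,g)=\frac{\kappa^r}{r!}\sum_{i_1,\dots,i_r=1}^{n+1}\frac{\partial^rf}{\partial z^{i_1}\cdots\partial z^{i_r}}\frac{\partial^rg}{\partial\bar z^{i_1}\cdots\partial\bar z^{i_r}},$$ so that $M_1(f,g)-M_1(g,f)=i\{f,g\}$. Let $J(z)=-\frac12z\bar z-\mu$, $\mathcal C=J^{-1}(0)$, $\mathsf p(z)=\sqrt{-2\mu/z\bar z}\;z$ and $\mathrm{prol}(f)=f\circ\mathsf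 p$. For smooth $f$ let $\pi_J(f)=(f-\mathrm{prol} f)/J$ off $\mathcal C$ and $\pi_J(f)=\frac1{2\mu}(E+\bar E)f$ on $\mathcal C$. Put - $I=\{f: f|_{\mathcal C}=0\}$, $B=\{f:\{f,f'\}\in I\ \forall f'\in I\}$, $F=\{f:f=\mathrm{prol}(f)\}$, $I^*=\{g*J\}$, $B^*=\{f:f*g-g*f\in I^*\ \forall g\in I^*\}$ (all inside $C^\infty(P)[[\lambda]]$); - $T=\sum\lambda^mT_m$ with $T_0=\mathrm{Id}$, $T_m(f)=-\sum_{k=1}^mT_{m-k}(M_k(\pi_J(f),J))$, and $K=\frac\kappa2E\circ\pi_J$; - $S=\sum\lambda^mS_m$ on $B\cap F$: near every point of $P$ it is given, with some smooth local transversal section of the foliation of $\mathcal C$ by orbits of the Hamiltonian flow $\Phi_t$ of $J$, projection $\mathfrak p$ onto the section along the leaves and $p=\Phi_{t(p)}(\mathfrak p(p))$, by $S_0=\mathrm{Id}$ and, for $m\ge1$, $(S_mf)(p)=-i\int_0^{t(p)}F_{m+1}(f)(\Phi_t(\mathfrak p(p)))\,dt$ for $p\in\mathcal C$, prolonged radially,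 where $F_m(f)=\sum_{k=2}^mM_k^-(J,S_{m-k}f)+\sum_{i=1}^{m-1}\sum_{k=1}^{m-i}T_i(M_k^-(J,S_{m-k-i}f))$ and $M_k^-(f,g)=M_k(f,g)-M_k(g,f)$; - for $f,g\in B\cap F$, the reduced product $f\star g=S^{-1}(\mathrm{prol}(T(Sf*Sg)))\in B\cap F$. A series $h$ is called homogeneous if $h(cz)=h(z)$ for all $c\in\mathbb C\setminus\{0\}$, $z\in P$; homogeneous series are the series of smooth functions on $\mathbb{CP}^n$. Then: 1. For smooth $f$, $\pi_J(f)$ is the unique smooth $h$ on $P$ with $f=\mathrm{prol}(f)+hJ$, and the Hamiltonian flow of $J$ is $\Phi_t(z)=e^{i\kappa t/2}z$. 2. $T=\sum_r\lambda^rK^r=\frac1{1-\lambda K}$. 3. $B\cap F=B^*\cap F$ is the space of homogeneous series. An operator $S$ as described exists, and every such $S$ is the identity on $B\cap F$. 4. For homogeneous $f,g$ the reduced product exists, is unique, and is $$f\star g=\mathrm{prol}\Big(\tfrac1{1-\lambda K}(f*g)\Big)=\sum_{k,l\ge0}\Big(\frac{\lambda}{-2\mu}\Big)^{k+l}\kappa^{l}A^{(k)}_l\,(z\bar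 z)^kM_k(f,g),\qquad A^{(k)}_l=(-1)^l\sum_{i_1=1}^k\sum_{i_2=1}^{i_1}\cdots\sum_{i_l=1}^{i_{l-1}}i_1i_2\cdots i_l$$ (for $\kappa=1$ the factor $\kappa^l$ is absent and $K=\frac12E\circ\pi_J$). It is a star product on $\mathbb{CP}^n$: homogeneous series form an associative algebra with unit $1$ under $\star$, $(f\star g)_0=f_0g_0$, $(f\star g-g\star f)_1=i\,\mathrm{prol}\{f_0,g_0\}$, and $\star$ is local. 5. For $k\ge1$: $A^{(k)}_l=\frac1{(k-1)!}\sum_{j=1}^k\binom{k-1}{j-1}(-1)^{k+l-j}j^{k+l-1}$. 6. $\star$ coincides with the star product of Bordemann, Brischle, Emmrich and Waldmann: for homogeneous $f,g$, $$f\star g=fg+\sum_{r\ge1}\Big(\frac{\kappa\lambda}{-2\mu}\Big)^r\sum_{s=1}^r\sum_{k=1}^s\frac{(-1)^{r-k}k^{r-1}}{s!\,(s-k)!\,(k-1)!}(z\bar z)^s\sum_{i_1,\dots,i_s}\frac{\partial^sf}{\partial z^{i_1}\cdots\partial z^{i_s}}\frac{\partial^sg}{\partial\bar z^{i_1}\cdots\partial\bar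 z^{i_s}},$$ and $f\star g$ is the unique homogeneous series such that $f*g-f\star g=a*J$ for some $U(1)$-invariant $a\in C^\infty(P)[[\lambda]]$ (quantum Marsden–Weinstein reduction). -/

import Mathlib

open scoped ContDiff

noncomputable section

namespace WickCPn

/-! ### The phase space and formal power series of functions on it

The phase space is `ℂⁿ⁺¹ ∖ {0}`.  Functions on it are represented by functions on `ℂⁿ⁺¹` whose value
at the origin is irrelevant: smoothness, and equality of series, only refer to `phase n`.
A formal power series `∑ λᵐ fₘ` is the sequence of its coefficients. -/

/-- The coordinate space `ℂⁿ⁺¹`. -/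
abbrev Coord (n : ℕ) : Type := Fin (n + 1) → ℂ

/-- Complex valued functions. -/
abbrev Fn (n : ℕ) : Type := Coord n → ℂ

/-- Formal power series in `λ` with coefficients in functions. -/
abbrev Series (n : ℕ) : Type := ℕ → Fn n

/-- The phase space `ℂⁿ⁺¹ ∖ {0}`. -/
def phase (n : ℕ) : Set (Coord n) := {z | z ≠ 0}

/-- Smooth functions on the phase space (smooth in the real sense). -/
def SmoothFn {n : ℕ} (f : Fn n) : Prop := ContDiffOn ℝ ∞ f (phase n)

/-- Formal power series of smooth functions on the phase space. -/
def smoothSeries (n : ℕ) : Set (Series n) := {f | ∀ m, SmoothFn (f m)}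

/-- Equality of formal power series of functions on the phase space. -/
def SEq {n : ℕ} (f g : Series n) : Prop := ∀ m, Set.EqOn (f m) (g m) (phase n)

/-- A function, regarded as a series concentrated in order `0`. -/
def constS {n : ℕ} (f : Fn n) : Series n
  | 0 => f
  | _ + 1 => 0

/-- The `λ`-linear extension of a formal series `∑ λᵃ Dₐ` of operators on functions. -/
def ext {n : ℕ} (D : ℕ → Fn n → Fn n) (f : Series n) : Series n :=
  fun m z => ∑ p ∈ Finset.HasAntidiagonal.antidiagonal m, D p.1 (f p.2) z

/-- The `λ`-bilinear extension of a formal series `∑ λʳ Dᵣ` of bilinear operators on functions. -/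
def ext₂ {n : ℕ} (D : ℕ → Fn n → Fn n → Fn n) (f g : Series n) : Series n :=
  fun m z => ∑ p ∈ Finset.HasAntidiagonal.antidiagonal m, ∑ q ∈ Finset.HasAntidiagonal.antidiagonal p.2,
    D p.1 (f q.1) (g q.2) z

/-! ### Wirtinger derivatives, Euler operators, Poisson bracket, Wick product -/

/-- `∂f/∂zⁱ`. -/
def dz {n : ℕ} (i : Fin (n + 1)) (f : Fn n) : Fn n := fun z =>
  (1 / 2) * (fderiv ℝ f z (Pi.single i 1) - Complex.I * fderiv ℝ f z (Pi.single i Complex.I))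

/-- `∂f/∂z̄ⁱ`. -/
def dzbar {n : ℕ} (i : Fin (n + 1)) (f : Fn n) : Fn n := fun z =>
  (1 / 2) * (fderiv ℝ f z (Pi.single i 1) + Complex.I * fderiv ℝ f z (Pi.single i Complex.I))

/-- `∂ʳf / ∂z^{i₁} ⋯ ∂z^{iᵣ}`. -/
def dzIter {n : ℕ} : (r : ℕ) → (Fin r → Fin (n + 1)) → Fn n → Fn n
  | 0, _, f => f
  | r + 1, i, f => dz (i 0) (dzIter r (fun j => i j.succ) f)

/-- `∂ʳf / ∂z̄^{i₁} ⋯ ∂z̄^{iᵣ}`. -/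
def dzbarIter {n : ℕ} : (r : ℕ) → (Fin r → Fin (n + 1)) → Fn n → Fn n
  | 0, _, f => f
  | r + 1, i, f => dzbar (i 0) (dzbarIter r (fun j => i j.succ) f)

/-- The Euler operator `E = ∑ zᵏ ∂/∂zᵏ`. -/
def euler {n : ℕ} (f : Fn n) : Fn n := fun z => ∑ i, z i * dz i f z

/-- The conjugate Euler operator `Ē = ∑ z̄ᵏ ∂/∂z̄ᵏ`. -/
def eulerBar {n : ℕ} (f : Fn n) : Fn n :=
  fun z => ∑ i, (starRingEnd ℂ) (z i) * dzbar i f z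

/-- The Poisson bracket of the symplectic form `ω = (i/κ) ∑ dzʲ ∧ dz̄ʲ`, namely
`{f, g} = (κ/i) ∑ (∂f/∂zʲ ∂g/∂z̄ʲ - ∂f/∂z̄ʲ ∂g/∂zʲ)`.  For `κ = 2` this is the standard bracket of
`ω = (i/2) ∑ dzʲ ∧ dz̄ʲ = ∑ dxʲ ∧ dyʲ`. -/
def poisson {n : ℕ} (κ : ℝ) (f g : Fn n) : Fn n := fun z =>
  ((κ : ℂ) / Complex.I) * ∑ i, (dz i f z * dzbar i g z - dzbar i f z * dz i g z)

/-- The Poisson bracket of two series. -/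
def poissonS {n : ℕ} (κ : ℝ) (f g : Series n) : Series n := fun m z =>
  ∑ p ∈ Finset.HasAntidiagonal.antidiagonal m, poisson κ (f p.1) (g p.2) z

/-- The contraction `∑_{i₁, …, iᵣ} ∂ʳf/∂z^{i₁}⋯∂z^{iᵣ} · ∂ʳg/∂z̄^{i₁}⋯∂z̄^{iᵣ}`. -/
def contraction {n : ℕ} (r : ℕ) (f g : Fn n) : Fn n := fun z =>
  ∑ i : Fin r → Fin (n + 1), dzIter r i f z * dzbarIter r i g z

/-- The bidifferential operators of the Wick product attached to `ω = (i/κ) ∑ dzʲ ∧ dz̄ʲ`: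
`Mᵣ(f, g) = (κʳ / r!) ∑ ∂ʳf/∂z^{i₁}⋯∂z^{iᵣ} ∂ʳg/∂z̄^{i₁}⋯∂z̄^{iᵣ}`.
In particular `M₁(f, g) - M₁(g, f) = i {f, g}`. -/
def wickM {n : ℕ} (κ : ℝ) (r : ℕ) (f g : Fn n) : Fn n := fun z =>
  ((κ : ℂ) ^ r / (r.factorial : ℂ)) * contraction r f g z

/-- `Mᵣ(f, g) - Mᵣ(g, f)`. -/
def wickAnti {n : ℕ} (κ : ℝ) (r : ℕ) (f g : Fn n) : Fn n := fun z =>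
  wickM κ r f g z - wickM κ r g f z

/-- The Wick product `f ∗ g = ∑ λʳ Mᵣ(f, g)` of two series. -/
def wick {n : ℕ} (κ : ℝ) (f g : Series n) : Series n := ext₂ (wickM κ) f g

/-! ### Constraint function, radial prolongation, component along the constraint -/

/-- `z z̄ = ∑ |zⁱ|²`. -/
def zz {n : ℕ} (z : Coord n) : ℝ := ∑ i, Complex.normSq (z i)

/-- The constraint function `J(z) = -½ z z̄ - μ`. -/
def J {n : ℕ} (μ : ℝ) : Fn n := fun z => ((-(1 / 2) * zz z - μ : ℝ) : ℂ)

/-- The constraint surface `J⁻¹(0)`, a sphere. -/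
def surface (n : ℕ) (μ : ℝ) : Set (Coord n) := {z | J μ z = 0}

/-- The radial projection `p(z) = √(-2μ / z z̄) z` onto the constraint surface. -/
def proj {n : ℕ} (μ : ℝ) (z : Coord n) : Coord n := (Real.sqrt (-2 * μ / zz z) : ℂ) • z

/-- The radial prolongation `prol f = f ∘ p`. -/
def prol {n : ℕ} (μ : ℝ) (f : Fn n) : Fn n := fun z => f (proj μ z)

/-- The prolongation of series. -/
def prolS {n : ℕ} (μ : ℝ) (f : Series n) : Series n := fun m => prol μ (f m)

open Classical in
/-- The component of `f` along `J`: the quotient `(f - prol f) / J` off the constraint surface,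
continued to the constraint surface by `(1/2μ) (E + Ē) f`. -/
def compJ {n : ℕ} (μ : ℝ) (f : Fn n) : Fn n := fun z =>
  if J μ z = 0 then (1 / (2 * (μ : ℂ))) * (euler f z + eulerBar f z)
  else (f z - prol μ f z) / J μ z

/-! ### Classical and deformed algebras -/

/-- The classical vanishing ideal `I` (series vanishing on the constraint surface). -/
def idealI (n : ℕ) (μ : ℝ) : Set (Series n) :=
  {f | f ∈ smoothSeries n ∧ ∀ m, ∀ z ∈ surface n μ, f m z = 0}

/-- `B = {f | {f, f'} ∈ I for all f' ∈ I}`. -/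
def algB (n : ℕ) (κ μ : ℝ) : Set (Series n) :=
  {f | f ∈ smoothSeries n ∧ ∀ f' ∈ idealI n μ, poissonS κ f f' ∈ idealI n μ}

/-- Pure prolongations `F`. -/
def spaceF (n : ℕ) (μ : ℝ) : Set (Series n) :=
  {f | f ∈ smoothSeries n ∧ SEq f (prolS μ f)}

/-- The star-left-ideal `I* = {g ∗ J}`. -/
def starI (n : ℕ) (κ μ : ℝ) : Set (Series n) :=
  {f | f ∈ smoothSeries n ∧ ∃ g ∈ smoothSeries n, SEq f (wick κ g (constS (J μ)))}

/-- `B* = {f | f ∗ g - g ∗ f ∈ I* for all g ∈ I*}`. -/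
def starB (n : ℕ) (κ μ : ℝ) : Set (Series n) :=
  {f | f ∈ smoothSeries n ∧ ∀ g ∈ starI n κ μ, wick κ f g - wick κ g f ∈ starI n κ μ}

/-- Homogeneous series: `h(c z) = h(z)` for all `c ∈ ℂ ∖ {0}`, that is, series of smooth functions
on `ℂℙⁿ` pulled back to `ℂⁿ⁺¹ ∖ {0}`. -/
def homog (n : ℕ) : Set (Series n) :=
  {f | f ∈ smoothSeries n ∧ ∀ m, ∀ c : ℂ, c ≠ 0 → ∀ z ∈ phase n, f m (c • z) = f m z}

/-! ### The operator `T` -/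

/-- `T₀ = Id`, `Tₘ f = - ∑_{k=1}^{m} T_{m-k}(Mₖ(π_J f, J))` for `m ≥ 1`
(in the sum below, `k` is replaced by `k + 1`). -/
def opT {n : ℕ} (κ μ : ℝ) : ℕ → Fn n → Fn n
  | 0, f => f
  | m + 1, f => fun z =>
      -∑ k : Fin (m + 1), opT κ μ (m - k) (wickM κ (k + 1) (compJ μ f) (J μ)) z
termination_by m => m
decreasing_by omega

/-- `K = (κ/2) E ∘ π_J`. -/
def opK {n : ℕ} (κ μ : ℝ) (f : Fn n) : Fn n := fun z => ((κ : ℂ) / 2) * euler (compJ μ f) z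

/-- The operator `1 - λ K` on series. -/
def oneSubLambdaK {n : ℕ} (κ μ : ℝ) (f : Series n) : Series n
  | 0 => f 0
  | m + 1 => f (m + 1) - opK κ μ (f m)

/-! ### The operator `S` -/

/-- The Hamiltonian flow of `J` for `ω = (i/κ) ∑ dzʲ ∧ dz̄ʲ`. -/
def flow {n : ℕ} (κ t : ℝ) (z : Coord n) : Coord n :=
  Complex.exp (Complex.I * ((κ / 2 * t : ℝ) : ℂ)) • z

/-- A (local) transversal section of the foliation of the constraint surface by the orbits of the
Hamiltonian flow of `J`, on a radially saturated open subset `dom` of the phase space, given by the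
projection `base` on the section along the leaves and the flow parameter `time`:
`p = Φ_{time p} (base p)` for `p ∈ dom` on the constraint surface. -/
structure FlowSection (n : ℕ) (κ μ : ℝ) where
  dom : Set (Coord n)
  base : Coord n → Coord n
  time : Coord n → ℝ
  isOpen_dom : IsOpen dom
  dom_subset : dom ⊆ phase n
  radial : ∀ z ∈ phase n, proj μ z ∈ dom ↔ z ∈ dom
  smooth_base : ContDiffOn ℝ ∞ base dom
  smooth_time : ContDiffOn ℝ ∞ time dom
  base_mem : ∀ z ∈ dom ∩ surface n μ, base z ∈ dom ∩ surface n μ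
  time_base : ∀ z ∈ dom ∩ surface n μ, time (base z) = 0
  flow_time : ∀ z ∈ dom ∩ surface n μ, flow κ (time z) (base z) = z
  path_mem : ∀ z ∈ dom ∩ surface n μ, ∀ s ∈ Set.uIcc 0 (time z), flow κ s (base z) ∈ dom
  base_flow : ∀ z ∈ dom ∩ surface n μ, ∀ s : ℝ, (∀ r ∈ Set.uIcc 0 s, flow κ r z ∈ dom) →
    base (flow κ s z) = base z

/-- The expression `Fₘ[S₀, …, S_{m-2}; T₀, …, T_{m-1}](f) = ∑_{k=2}^{m} Mₖ⁻(J, S_{m-k} f)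
+ ∑_{i=1}^{m-1} ∑_{k=1}^{m-i} Tᵢ(Mₖ⁻(J, S_{m-k-i} f))`, where `s j` stands for `S_j f`
and `Mₖ⁻(f, g) = Mₖ(f, g) - Mₖ(g, f)`. -/
def exprF {n : ℕ} (κ μ : ℝ) (m : ℕ) (s : ℕ → Fn n) : Fn n := fun z =>
  (∑ k ∈ Finset.Icc 2 m, wickAnti κ k (J μ) (s (m - k)) z) +
    ∑ i ∈ Finset.Icc 1 (m - 1), ∑ k ∈ Finset.Icc 1 (m - i),
      opT κ μ i (wickAnti κ k (J μ) (s (m - k - i))) z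

/-- `s 0, s 1, …` are the functions `S₀ f, S₁ f, …` constructed with the help of the section `σ`, on
its domain: `S₀ f = f`, and for `m ≥ 1`, `Sₘ f` is the prolongation of
`(Sₘ f)(p) = -i ∫₀^{t(p)} F_{m+1}(f)(Φ_t(base p)) dt` (`p` on the constraint surface). -/
def IsLocalS {n : ℕ} {κ μ : ℝ} (σ : FlowSection n κ μ) (f : Fn n) (s : ℕ → Fn n) : Prop :=
  (∀ z ∈ σ.dom, s 0 z = f z) ∧
  ∀ m, 1 ≤ m → ∀ z ∈ σ.dom, s m z =
    -Complex.I * ∫ t in (0 : ℝ)..(σ.time (proj μ z)),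
      exprF κ μ (m + 1) s (flow κ t (σ.base (proj μ z)))

/-- A formal series of operators `S = ∑ λᵐ Sₘ` on `B ∩ F` that near every point comes from the
construction with some local transversal section. -/
def IsOpS {n : ℕ} (κ μ : ℝ) (S : ℕ → Fn n → Fn n) : Prop :=
  ∀ f : Fn n, constS f ∈ algB n κ μ ∩ spaceF n μ → ∀ z ∈ phase n,
    ∃ σ : FlowSection n κ μ, z ∈ σ.dom ∧ IsLocalS σ f (fun m => S m f)

/-! ### Reduced products -/

/-- `h` is the reduced product `S⁻¹(prol(T(S f ∗ S g)))`, an element of `B ∩ F`. -/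
def IsReducedProduct {n : ℕ} (κ μ : ℝ) (S : ℕ → Fn n → Fn n) (f g h : Series n) : Prop :=
  h ∈ algB n κ μ ∩ spaceF n μ ∧
    SEq (ext S h) (prolS μ (ext (opT κ μ) (wick κ (ext S f) (ext S g))))

/-- `∑_{i₁=1}^{k} ∑_{i₂=1}^{i₁} ⋯ ∑_{i_l=1}^{i_{l-1}} i₁ i₂ ⋯ i_l` (arguments `l`, `k`). -/
def nestedSum : ℕ → ℕ → ℤ
  | 0, _ => 1
  | l + 1, k => ∑ i ∈ Finset.Icc 1 k, (i : ℤ) * nestedSum l i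

/-- The coefficients `A^{(k)}_l`. -/
def coeffA (k l : ℕ) : ℤ := (-1) ^ l * nestedSum l k

/-- The explicit product `∑_{k,l} (λ / (-2μ))^{k+l} κ^l A^{(k)}_l (z z̄)^k Mₖ(f, g)`. -/
def starCP {n : ℕ} (κ μ : ℝ) (f g : Series n) : Series n :=
  ext₂ (fun r f g z => ∑ p ∈ Finset.HasAntidiagonal.antidiagonal r,
    (1 / (-2 * (μ : ℂ))) ^ r * (κ : ℂ) ^ p.2 * (coeffA p.1 p.2 : ℂ) * (zz z : ℂ) ^ p.1 *
      wickM κ p.1 f g z) f g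

/-- The closed formula of Bordemann, Brischle, Emmrich and Waldmann for a star product on `ℂℙⁿ`:
`f g + ∑_{r ≥ 1} (κ λ / (-2μ))^r ∑_{s=1}^{r} ∑_{k=1}^{s}
  (-1)^{r-k} k^{r-1} / (s! (s-k)! (k-1)!) (z z̄)^s ∑ ∂ˢf/∂z^{i₁}⋯∂z^{iₛ} ∂ˢg/∂z̄^{i₁}⋯∂z̄^{iₛ}`. -/
def starBBEW {n : ℕ} (κ μ : ℝ) (f g : Series n) : Series n :=
  ext₂ (fun r f g z => if r = 0 then f z * g z else
    ((κ : ℂ) / (-2 * (μ : ℂ))) ^ r * ∑ s ∈ Finset.Icc 1 r, ∑ k ∈ Finset.Icc 1 s,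
      ((-1 : ℂ) ^ (r - k) * (k : ℂ) ^ (r - 1) /
          ((s.factorial : ℂ) * ((s - k).factorial : ℂ) * ((k - 1).factorial : ℂ))) *
        (zz z : ℂ) ^ s * contraction s f g z) f g

/-- The `U(1)`-invariant series. -/
def invU1 (n : ℕ) : Set (Series n) :=
  {f | f ∈ smoothSeries n ∧ ∀ m, ∀ φ : ℝ, ∀ z ∈ phase n,
    f m (Complex.exp (Complex.I * (φ : ℂ)) • z) = f m z}

/-- `h` is the product of the homogeneous series `f` and `g` that results from the quantum
Marsden-Weinstein reduction with the momentum map `J` of the `U(1)`-action: it is the homogeneous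
representative of the class of `f ∗ g` in the algebra of `U(1)`-invariant series modulo
its star ideal generated by `J`. -/
def IsMarsdenWeinsteinProduct {n : ℕ} (κ μ : ℝ) (f g h : Series n) : Prop :=
  h ∈ homog n ∧ ∃ a ∈ invU1 n, SEq (wick κ f g - h) (wick κ a (constS (J μ)))

/-- `star` is a star product on the homogeneous series, that is, on series of functions on `ℂℙⁿ`:
it is associative with unit `1`, deforms the pointwise product in the direction of `i` times
the reduced Poisson bracket (the prolongation of the Poisson bracket), and is local. -/
structure IsStarProductCP {n : ℕ} (κ μ : ℝ) (star : Series n → Series n → Series n) : Prop where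
  mem : ∀ f ∈ homog n, ∀ g ∈ homog n, star f g ∈ homog n
  assoc : ∀ f ∈ homog n, ∀ g ∈ homog n, ∀ h ∈ homog n,
    SEq (star (star f g) h) (star f (star g h))
  mul_one : ∀ f ∈ homog n, SEq (star f (constS 1)) f
  one_mul : ∀ f ∈ homog n, SEq (star (constS 1) f) f
  order_zero : ∀ f ∈ homog n, ∀ g ∈ homog n, ∀ z ∈ phase n, star f g 0 z = f 0 z * g 0 z
  order_one : ∀ f ∈ homog n, ∀ g ∈ homog n, ∀ z ∈ phase n,
    star f g 1 z - star g f 1 z = Complex.I * prol μ (poisson κ (f 0) (g 0)) z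
  localL : ∀ f ∈ homog n, ∀ g ∈ homog n, ∀ U : Set (Coord n), IsOpen U → U ⊆ phase n →
    (∀ m, ∀ z ∈ U, f m z = 0) → ∀ m, ∀ z ∈ U, star f g m z = 0
  localR : ∀ f ∈ homog n, ∀ g ∈ homog n, ∀ U : Set (Coord n), IsOpen U → U ⊆ phase n →
    (∀ m, ∀ z ∈ U, g m z = 0) → ∀ m, ∀ z ∈ U, star f g m z = 0

end WickCPn

end

open WickCPn

/-!
Since `J` is affine in `z z̄`, the cochains `M_r(·, J)` vanish for `r ≥ 2`, so that
`f ∗ J = f J - λ (κ/2) E f`. Pointwise division with remainder by `J`, which reads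
`f = prol f + π_J(f) J`, therefore lifts to the Wick algebra, every order being corrected by the
same operator `K = (κ/2) E π_J`: with `T = ∑ λʳ Kʳ` one has `f = prol (T f) + π_J(T f) ∗ J`, and
the summands are unique.

A function constant along rays lies in `B`, or in `B*`, exactly when it is also constant along
the flow of `J`, that is, when it is homogeneous. A homogeneous function and `J` commute under
`∗`, so all the corrections `F_m` vanish and `S = 1`; moreover the remainder of division by `J`
is then compatible with products, and `f ⋆ g = prol (T (f ∗ g))` inherits associativity.

As `M_k(f, g)` has weight `-2k` under radial scaling, `(z z̄)ᵏ M_k(f, g)` is homogeneous, and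
`K` acts on the multiples `(z z̄)⁻ᵏ h` of a homogeneous `h` as a triangular matrix. The iterates
of that matrix give the nested sums in `A^{(k)}_l`. Up to the factor `k!` these are the `k`-th
finite differences of `xᵏ⁺ˡ` at `0`, both being solutions of the same recursion in `k` and `l`.
-/

noncomputable section

namespace WickCPn

/-! ### Smoothness of parametric integrals -/

section ParametricIntegral

universe u

open MeasureTheory intervalIntegral Set

variable {X G : Type u} [NormedAddCommGroup X] [NormedSpace ℝ X]
  [NormedAddCommGroup G] [NormedSpace ℝ G] {U : Set X} {W : Set (X × ℝ)} {a b : ℝ}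

theorem hasFDerivAt_parametric_integral [ProperSpace X] (hU : IsOpen U) (hW : IsOpen W)
    (hUW : U ×ˢ uIcc a b ⊆ W) {F : X × ℝ → G} (hF : ContDiffOn ℝ 1 F W) {x₀ : X} (hx₀ : x₀ ∈ U) :
    HasFDerivAt (fun x => ∫ t in a..b, F (x, t))
      (∫ t in a..b, (fderiv ℝ F (x₀, t)).comp (ContinuousLinearMap.inl ℝ X ℝ)) x₀ := by
  obtain ⟨ε, hε, hball⟩ := Metric.nhds_basis_closedBall.mem_iff.1 (hU.mem_nhds hx₀)
  have hF' : ContinuousOn (fun p => (fderiv ℝ F p).comp (ContinuousLinearMap.inl ℝ X ℝ)) W :=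
    (hF.continuousOn_fderiv_of_isOpen hW le_rfl).clm_comp continuousOn_const
  have hsub : Metric.closedBall x₀ ε ×ˢ uIcc a b ⊆ W := (prod_mono hball subset_rfl).trans hUW
  obtain ⟨C, hC⟩ := ((isCompact_closedBall x₀ ε).prod isCompact_uIcc).exists_bound_of_continuousOn
    (hF'.mono hsub)
  have hslice : ∀ x ∈ U, MapsTo (fun t : ℝ => (x, t)) (uIcc a b) W :=
    fun x hx t ht => hUW ⟨hx, ht⟩
  have hcont : ∀ x ∈ U, ContinuousOn (fun t => F (x, t)) (uIcc a b) := fun x hx =>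
    hF.continuousOn.comp (by fun_prop) (hslice x hx)
  refine hasFDerivAt_integral_of_dominated_of_fderiv_le
    (s := Metric.ball x₀ ε) (bound := fun _ => C)
    (F' := fun x t => (fderiv ℝ F (x, t)).comp (ContinuousLinearMap.inl ℝ X ℝ))
    (Metric.ball_mem_nhds _ hε) ?_ (hcont x₀ hx₀).intervalIntegrable ?_ ?_
    intervalIntegrable_const ?_
  · filter_upwards [hU.mem_nhds hx₀] with x hx
    exact ((hcont x hx).mono uIoc_subset_uIcc).aestronglyMeasurable measurableSet_uIoc
  · exact ((hF'.comp (by fun_prop) (hslice x₀ hx₀)).mono uIoc_subset_uIcc).aestronglyMeasurable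
      measurableSet_uIoc
  · exact .of_forall fun t ht x hx =>
      hC (x, t) ⟨Metric.ball_subset_closedBall hx, uIoc_subset_uIcc ht⟩
  · refine .of_forall fun t ht x hx => ?_
    have hmem : (x, t) ∈ W := hsub ⟨Metric.ball_subset_closedBall hx, uIoc_subset_uIcc ht⟩
    exact ((hF.contDiffAt (hW.mem_nhds hmem)).differentiableAt one_ne_zero).hasFDerivAt.comp x
      (hasFDerivAt_prodMk_left x t)

theorem contDiffOn_parametric_integral [ProperSpace X] (hU : IsOpen U) (hW : IsOpen W)
    (hUW : U ×ˢ uIcc a b ⊆ W) {F : X × ℝ → G} (hF : ContDiffOn ℝ ∞ F W) :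
    ContDiffOn ℝ ∞ (fun x => ∫ t in a..b, F (x, t)) U := by
  refine contDiffOn_infty.2 fun m => ?_
  induction m generalizing G with
  | zero =>
    exact contDiffOn_zero.2 fun x hx => (hasFDerivAt_parametric_integral hU hW hUW
      (hF.of_le (by simp)) hx).continuousAt.continuousWithinAt
  | succ m ih =>
    have hderiv : ∀ x ∈ U, HasFDerivAt (fun x => ∫ t in a..b, F (x, t))
        (∫ t in a..b, (fderiv ℝ F (x, t)).comp (ContinuousLinearMap.inl ℝ X ℝ)) x :=
      fun x hx => hasFDerivAt_parametric_integral hU hW hUW (hF.of_le (by simp)) hx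
    have hF' : ContDiffOn ℝ ∞ (fun p => (fderiv ℝ F p).comp (ContinuousLinearMap.inl ℝ X ℝ)) W :=
      (hF.fderiv_of_isOpen hW (by simp)).clm_comp contDiffOn_const
    rw [Nat.cast_succ]
    exact (contDiffOn_succ_iff_fderiv_of_isOpen hU).2
      ⟨fun x hx => (hderiv x hx).differentiableAt.differentiableWithinAt, by simp,
        (ih hF').congr fun x hx => (hderiv x hx).fderiv⟩

theorem integral_fderiv_lineMap [CompleteSpace G] (hU : IsOpen U) {f : X → G}
    (hf : ContDiffOn ℝ 1 f U) {x y : X} (hxy : ∀ t ∈ uIcc (0 : ℝ) 1, AffineMap.lineMap x y t ∈ U) :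
    (∫ t in (0 : ℝ)..1, fderiv ℝ f (AffineMap.lineMap x y t)) (y - x) = f y - f x := by
  have hcont : ContinuousOn (fun t : ℝ => fderiv ℝ f (AffineMap.lineMap x y t)) (uIcc 0 1) :=
    (hf.continuousOn_fderiv_of_isOpen hU le_rfl).comp
      AffineMap.lineMap_continuous.continuousOn hxy
  have hderiv (t : ℝ) (ht : t ∈ uIcc (0 : ℝ) 1) :
      HasDerivAt (fun t => f (AffineMap.lineMap x y t))
        (fderiv ℝ f (AffineMap.lineMap x y t) (y - x)) t :=
    ((hf.contDiffAt (hU.mem_nhds (hxy t ht))).differentiableAt one_ne_zero).hasFDerivAt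
      |>.comp_hasDerivAt t AffineMap.hasDerivAt_lineMap
  rw [ContinuousLinearMap.intervalIntegral_apply hcont.intervalIntegrable,
    integral_eq_sub_of_hasDerivAt hderiv (hcont.clm_apply continuousOn_const).intervalIntegrable,
    AffineMap.lineMap_apply_one, AffineMap.lineMap_apply_zero]

theorem exists_contDiffOn_sub_eq_clm_apply [ProperSpace X] [CompleteSpace G] (hU : IsOpen U)
    {f : X → G} (hf : ContDiffOn ℝ ∞ f U) {p : X → X} (hp : ContDiffOn ℝ ∞ p U)
    (hseg : ∀ x ∈ U, ∀ t ∈ uIcc (0 : ℝ) 1, AffineMap.lineMap (p x) x t ∈ U) :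
    ∃ L : X → X →L[ℝ] G, ContDiffOn ℝ ∞ L U ∧ ∀ x ∈ U, L x (x - p x) = f x - f (p x) := by
  have hφ : ContDiffOn ℝ ∞ (fun q : X × ℝ => AffineMap.lineMap (p q.1) q.1 q.2)
      (U ×ˢ univ) := by
    have hpf : ContDiffOn ℝ ∞ (fun q : X × ℝ => p q.1) (U ×ˢ univ) :=
      hp.comp contDiff_fst.contDiffOn fun q hq => hq.1
    simp only [AffineMap.lineMap_apply_module']
    exact (contDiff_snd.contDiffOn.smul (contDiff_fst.contDiffOn.sub hpf)).add hpf
  have hf' : ContDiffOn ℝ ∞ (fderiv ℝ f) U := hf.fderiv_of_isOpen hU (by simp)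
  have hF := hf'.comp (hφ.mono inter_subset_left) fun q hq => hq.2
  refine ⟨fun x => ∫ t in (0 : ℝ)..1, fderiv ℝ f (AffineMap.lineMap (p x) x t), ?_, fun x hx =>
    integral_fderiv_lineMap hU (hf.of_le (by simp)) (hseg x hx)⟩
  exact contDiffOn_parametric_integral hU
    (hφ.continuousOn.isOpen_inter_preimage (hU.prod isOpen_univ) hU)
    (fun q hq => ⟨⟨hq.1, mem_univ _⟩, hseg q.1 hq.1 q.2 hq.2⟩) hF

end ParametricIntegral

/-! ### Star products on a commutative algebra -/

section StarProduct

open Finset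

variable {𝕜 A : Type*} [CommRing 𝕜] [CommRing A] [Algebra 𝕜 A]

variable (𝕜 A) in
/-- A formal star product `a ∗ b = ∑ λʳ op r a b` on the commutative algebra `A`, with the unit
of `A` as unit. -/
structure StarProduct where
  op : ℕ → A →ₗ[𝕜] A →ₗ[𝕜] A
  op_zero : ∀ a b, op 0 a b = a * b
  op_one : ∀ r ≠ 0, ∀ a, op r a 1 = 0
  one_op : ∀ r ≠ 0, ∀ a, op r 1 a = 0
  op_assoc : ∀ m a b c, ∑ p ∈ antidiagonal m, op p.1 (op p.2 a b) c =
    ∑ p ∈ antidiagonal m, op p.1 a (op p.2 b c)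

theorem sum_antidiagonal_reindex_left {M : Type*} [AddCommMonoid M]
    (F : ℕ → ℕ → ℕ → ℕ → ℕ → M) (m : ℕ) :
    ∑ p ∈ antidiagonal m, ∑ q ∈ antidiagonal p.2, ∑ r ∈ antidiagonal q.1,
      ∑ s ∈ antidiagonal r.2, F p.1 r.1 s.1 s.2 q.2 =
    ∑ p ∈ antidiagonal m, ∑ q ∈ antidiagonal p.2, ∑ r ∈ antidiagonal q.2,
      ∑ s ∈ antidiagonal p.1, F s.1 s.2 q.1 r.1 r.2 := by
  simp only [sum_sigma']
  refine sum_nbij'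
    (fun ⟨(a, _), (_, k), (b, _), (i, j)⟩ => ⟨(a + b, i + j + k), (i, j + k), (j, k), (a, b)⟩)
    (fun ⟨_, (i, _), (j, k), (a, b)⟩ => ⟨(a, b + i + j + k), (b + i + j, k), (b, i + j), (i, j)⟩)
    ?_ ?_ ?_ ?_ ?_
  all_goals
    rintro ⟨⟨a, b⟩, ⟨c, d⟩, ⟨e, f⟩, ⟨g, h⟩⟩ hx
    simp only [mem_sigma, HasAntidiagonal.mem_antidiagonal, and_true, true_and] at hx ⊢ <;> grind

theorem sum_antidiagonal_reindex_right {M : Type*} [AddCommMonoid M]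
    (F : ℕ → ℕ → ℕ → ℕ → ℕ → M) (m : ℕ) :
    ∑ p ∈ antidiagonal m, ∑ q ∈ antidiagonal p.2, ∑ r ∈ antidiagonal q.2,
      ∑ s ∈ antidiagonal r.2, F p.1 r.1 q.1 s.1 s.2 =
    ∑ p ∈ antidiagonal m, ∑ q ∈ antidiagonal p.2, ∑ r ∈ antidiagonal q.2,
      ∑ s ∈ antidiagonal p.1, F s.1 s.2 q.1 r.1 r.2 := by
  simp only [sum_sigma']
  refine sum_nbij'
    (fun ⟨(a, _), (i, _), (b, _), (j, k)⟩ => ⟨(a + b, i + j + k), (i, j + k), (j, k), (a, b)⟩)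
    (fun ⟨_, (i, _), (j, k), (a, b)⟩ => ⟨(a, b + i + j + k), (i, b + j + k), (b, j + k), (j, k)⟩)
    ?_ ?_ ?_ ?_ ?_
  all_goals
    rintro ⟨⟨a, b⟩, ⟨c, d⟩, ⟨e, f⟩, ⟨g, h⟩⟩ hx
    simp only [mem_sigma, HasAntidiagonal.mem_antidiagonal, and_true] at hx ⊢ <;> grind

namespace StarProduct

/-- Formal power series `∑ λᵐ x m` with coefficients in `A`, a ring under the star product `P`. -/
def Series (_P : StarProduct 𝕜 A) : Type _ := ℕ → A

variable (P : StarProduct 𝕜 A)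

instance : AddCommGroup P.Series := inferInstanceAs (AddCommGroup (ℕ → A))

instance : Mul P.Series :=
  ⟨fun x y m => ∑ p ∈ antidiagonal m, ∑ q ∈ antidiagonal p.2, P.op p.1 (x q.1) (y q.2)⟩

/-- An element of `A`, regarded as a series concentrated in order `0`. -/
def const (a : A) : P.Series := Pi.single 0 a

instance : One P.Series := ⟨P.const 1⟩

variable {P}

@[ext]
theorem Series.ext {x y : P.Series} (h : ∀ m, x m = y m) : x = y := funext h

theorem Series.add_apply (x y : P.Series) (m : ℕ) : (x + y) m = x m + y m := rfl

theorem Series.sub_apply (x y : P.Series) (m : ℕ) : (x - y) m = x m - y m := rfl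

theorem Series.zero_apply (m : ℕ) : (0 : P.Series) m = 0 := rfl

theorem Series.mul_apply (x y : P.Series) (m : ℕ) : (x * y) m =
    ∑ p ∈ antidiagonal m, ∑ q ∈ antidiagonal p.2, P.op p.1 (x q.1) (y q.2) := rfl

theorem Series.one_def : (1 : P.Series) = P.const 1 := rfl

theorem const_zero_apply (a : A) : P.const a 0 = a := Pi.single_eq_same ..

theorem const_apply_of_ne {m : ℕ} (hm : m ≠ 0) (a : A) : P.const a m = 0 :=
  Pi.single_eq_of_ne (M := fun _ => A) hm a

theorem Series.mul_const_apply (x : P.Series) (a : A) (m : ℕ) :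
    (x * P.const a) m = ∑ p ∈ antidiagonal m, P.op p.1 (x p.2) a := by
  refine sum_congr rfl fun p _ => (sum_eq_single (p.2, 0) ?_ (by simp)).trans (by
    rw [const_zero_apply])
  rintro ⟨i, j⟩ hij hne
  rw [const_apply_of_ne (by rintro rfl; simp_all), map_zero]

theorem Series.const_mul_apply (a : A) (x : P.Series) (m : ℕ) :
    (P.const a * x) m = ∑ p ∈ antidiagonal m, P.op p.1 a (x p.2) := by
  refine sum_congr rfl fun p _ => (sum_eq_single (0, p.2) ?_ (by simp)).trans (by
    rw [const_zero_apply])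
  rintro ⟨i, j⟩ hij hne
  rw [const_apply_of_ne (by rintro rfl; simp_all), map_zero, LinearMap.zero_apply]

theorem Series.mul_const_apply_zero (x : P.Series) (a : A) :
    (x * P.const a) 0 = x 0 * a := by
  simp [mul_const_apply, op_zero]

theorem Series.mul_const_apply_succ (x : P.Series) {a : A} (h : ∀ r ≥ 2, ∀ b, P.op r b a = 0)
    (m : ℕ) : (x * P.const a) (m + 1) = x (m + 1) * a + P.op 1 (x m) a := by
  rw [mul_const_apply, Nat.sum_antidiagonal_succ, op_zero]
  congr 1
  refine (sum_eq_single (0, m) ?_ (by simp)).trans rfl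
  rintro ⟨i, j⟩ hij hne
  exact h _ (by simp only [HasAntidiagonal.mem_antidiagonal] at hij; grind) _

theorem Series.const_mul_apply_zero (a : A) (x : P.Series) :
    (P.const a * x) 0 = a * x 0 := by
  simp [const_mul_apply, op_zero]

theorem Series.const_mul_apply_succ (x : P.Series) {a : A} (h : ∀ r ≥ 2, ∀ b, P.op r a b = 0)
    (m : ℕ) : (P.const a * x) (m + 1) = a * x (m + 1) + P.op 1 a (x m) := by
  rw [const_mul_apply, Nat.sum_antidiagonal_succ, op_zero]
  congr 1
  refine (sum_eq_single (0, m) ?_ (by simp)).trans rfl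
  rintro ⟨i, j⟩ hij hne
  exact h _ (by simp only [HasAntidiagonal.mem_antidiagonal] at hij; grind) _

protected theorem Series.mul_assoc (x y z : P.Series) : x * y * z = x * (y * z) := by
  ext m
  simp only [Series.mul_apply, map_sum, LinearMap.sum_apply]
  rw [sum_antidiagonal_reindex_left fun a b i j k => P.op a (P.op b (x i) (y j)) (z k),
    sum_antidiagonal_reindex_right fun a b i j k => P.op a (x i) (P.op b (y j) (z k))]
  simp only [P.op_assoc]

instance : Ring P.Series where
  __ : AddCommGroup P.Series := inferInstance
  left_distrib x y z := by
    ext m; simp [Series.mul_apply, Series.add_apply, sum_add_distrib]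
  right_distrib x y z := by
    ext m; simp [Series.mul_apply, Series.add_apply, sum_add_distrib]
  zero_mul x := by ext m; simp [Series.mul_apply, Series.zero_apply]
  mul_zero x := by ext m; simp [Series.mul_apply, Series.zero_apply]
  mul_assoc := Series.mul_assoc
  one_mul x := by
    ext (_ | m)
    · rw [Series.one_def, Series.const_mul_apply_zero, one_mul]
    · rw [Series.one_def, Series.const_mul_apply_succ _ fun r hr b => P.one_op r (by omega) b,
        P.one_op 1 one_ne_zero, one_mul, add_zero]
  mul_one x := by
    ext (_ | m)
    · rw [Series.one_def, Series.mul_const_apply_zero, mul_one]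
    · rw [Series.one_def, Series.mul_const_apply_succ _ fun r hr b => P.op_one r (by omega) b,
        P.op_one 1 one_ne_zero, mul_one, add_zero]

instance : Module 𝕜 P.Series := inferInstanceAs (Module 𝕜 (ℕ → A))

end StarProduct

/-! ### The exponential of a contraction of commuting derivations -/

section Contraction

variable {ι : Type*}

/-- The iterated derivative `d_{i₀} ⋯ d_{iᵣ₋₁} a`. -/
def iterDer (d : ι → Derivation 𝕜 A A) : (r : ℕ) → (Fin r → ι) → A → A
  | 0, _, a => a
  | r + 1, i, a => d (i 0) (iterDer d r (fun j => i j.succ) a)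

theorem iterDer_comm {d : ι → Derivation 𝕜 A A} (hdd : ∀ i j a, d i (d j a) = d j (d i a))
    (j : ι) (r : ℕ) (i : Fin r → ι) (a : A) : iterDer d r i (d j a) = d j (iterDer d r i a) := by
  induction r with
  | zero => rfl
  | succ r ih => rw [iterDer, ih, hdd, iterDer]

variable [Fintype ι]

/-- The iterated contraction `∑ d_{i₁} ⋯ d_{iᵣ} a · e_{i₁} ⋯ e_{iᵣ} b` of two families of
derivations. -/
def iterContr (d e : ι → Derivation 𝕜 A A) : ℕ → A →ₗ[𝕜] A →ₗ[𝕜] A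
  | 0 => LinearMap.mul 𝕜 A
  | r + 1 => ∑ i, (iterContr d e r).compl₁₂ (d i : A →ₗ[𝕜] A) (e i : A →ₗ[𝕜] A)

variable (d e : ι → Derivation 𝕜 A A)

theorem iterContr_zero (a b : A) : iterContr d e 0 a b = a * b := rfl

theorem iterContr_succ (r : ℕ) (a b : A) :
    iterContr d e (r + 1) a b = ∑ i, iterContr d e r (d i a) (e i b) := by
  simp [iterContr, LinearMap.sum_apply]

theorem iterContr_swap (r : ℕ) (a b : A) : iterContr d e r a b = iterContr e d r b a := by
  induction r generalizing a b with
  | zero => exact mul_comm a b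
  | succ r ih => simp only [iterContr_succ, ih]

theorem iterContr_one_right {r : ℕ} (hr : r ≠ 0) (a : A) : iterContr d e r a 1 = 0 := by
  obtain ⟨r, rfl⟩ := Nat.exists_eq_succ_of_ne_zero hr
  simp [iterContr_succ]

theorem iterContr_one_left {r : ℕ} (hr : r ≠ 0) (a : A) : iterContr d e r 1 a = 0 := by
  rw [iterContr_swap, iterContr_one_right e d hr]

theorem iterContr_weighted_leibniz (δ : Derivation 𝕜 A A) {c c' : 𝕜}
    (hd : ∀ i a, δ (d i a) = d i (δ a) + c • d i a)
    (he : ∀ i a, δ (e i a) = e i (δ a) + c' • e i a) (r : ℕ) (a b : A) :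
    δ (iterContr d e r a b) = iterContr d e r (δ a) b + iterContr d e r a (δ b) +
      (r * (c + c')) • iterContr d e r a b := by
  induction r generalizing a b with
  | zero => simp only [iterContr_zero, Derivation.leibniz, smul_eq_mul, Nat.cast_zero, zero_mul,
      zero_smul]; ring
  | succ r ih =>
    simp only [iterContr_succ, map_sum, ih, hd, he, map_add, map_smul, LinearMap.add_apply,
      LinearMap.smul_apply, smul_sum, ← sum_add_distrib]
    refine sum_congr rfl fun i _ => ?_
    push_cast
    module

theorem iterContr_leibniz (δ : Derivation 𝕜 A A) (hd : ∀ i a, δ (d i a) = d i (δ a))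
    (he : ∀ i a, δ (e i a) = e i (δ a)) (r : ℕ) (a b : A) :
    δ (iterContr d e r a b) = iterContr d e r (δ a) b + iterContr d e r a (δ b) := by
  simpa using iterContr_weighted_leibniz d e δ (c := 0) (c' := 0) (by simpa using hd)
    (by simpa using he) r a b

variable {d e}

theorem iterContr_eq_sum_iterDer (hdd : ∀ i j a, d i (d j a) = d j (d i a))
    (hee : ∀ i j a, e i (e j a) = e j (e i a)) (r : ℕ) (a b : A) :
    iterContr d e r a b = ∑ i : Fin r → ι, iterDer d r i a * iterDer e r i b := by
  induction r generalizing a b with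
  | zero => simp [iterContr_zero, iterDer]
  | succ r ih =>
    rw [← (Fin.consEquiv fun _ => ι).sum_comp, Fintype.sum_prod_type, iterContr_succ]
    refine sum_congr rfl fun j _ => (ih _ _).trans <| sum_congr rfl fun i _ => ?_
    rw [iterDer_comm hdd, iterDer_comm hee]
    rfl

theorem sum_choose_smul_iterContr_succ (hdd : ∀ i j a, d i (d j a) = d j (d i a))
    (hde : ∀ i j a, d i (e j a) = e j (d i a)) (m : ℕ) (a b c : A) :
    ∑ p ∈ antidiagonal (m + 1),
        (m + 1).choose p.1 • iterContr d e p.1 (iterContr d e p.2 a b) c =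
      ∑ i, (∑ p ∈ antidiagonal m,
          m.choose p.1 • iterContr d e p.1 (iterContr d e p.2 (d i a) (e i b)) c +
        ∑ p ∈ antidiagonal m,
          m.choose p.1 • iterContr d e p.1 (iterContr d e p.2 (d i a) b) (e i c) +
        ∑ p ∈ antidiagonal m,
          m.choose p.1 • iterContr d e p.1 (iterContr d e p.2 a (d i b)) (e i c)) := by
  rw [sum_antidiagonal_choose_succ_nsmul fun k l => iterContr d e k (iterContr d e l a b) c]
  simp only [iterContr_succ, iterContr_leibniz d e (d _) (hdd _) (hde _), map_sum, map_add,
    LinearMap.sum_apply, LinearMap.add_apply, sum_add_distrib, smul_sum, smul_add]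
  rw [add_assoc]
  congr 1
  · exact sum_comm
  · simp only [← sum_add_distrib]
    rw [sum_comm]
    refine sum_congr rfl fun i _ => sum_congr rfl fun p hp => ?_
    rw [Nat.choose_symm_of_eq_add (HasAntidiagonal.mem_antidiagonal.1 hp).symm]

theorem sum_choose_smul_iterContr_assoc (hdd : ∀ i j a, d i (d j a) = d j (d i a))
    (hee : ∀ i j a, e i (e j a) = e j (e i a)) (hde : ∀ i j a, d i (e j a) = e j (d i a))
    (m : ℕ) (a b c : A) :
    ∑ p ∈ antidiagonal m, m.choose p.1 • iterContr d e p.1 (iterContr d e p.2 a b) c =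
      ∑ p ∈ antidiagonal m, m.choose p.1 • iterContr d e p.1 a (iterContr d e p.2 b c) := by
  induction m generalizing a b c with
  | zero => simp [iterContr_zero, mul_assoc]
  | succ m ih =>
    have hright := sum_choose_smul_iterContr_succ hee (fun i j a => (hde j i a).symm) m c b a
    simp only [iterContr_swap e d] at hright
    rw [sum_choose_smul_iterContr_succ hdd hde, hright]
    exact sum_congr rfl fun i _ => by rw [ih, ih, ih]; abel

end Contraction

theorem pow_div_factorial_mul {𝕜 : Type*} [Field 𝕜] [CharZero 𝕜] (κ : 𝕜) (k l : ℕ) :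
    κ ^ k / k.factorial * (κ ^ l / l.factorial) =
      κ ^ (k + l) / (k + l).factorial * (k + l).choose k := by
  rw [Nat.cast_add_choose]
  have := Nat.cast_ne_zero (R := 𝕜) |>.2 (k + l).factorial_ne_zero
  field

section WickProduct

variable {𝕜 A ι : Type*} [Field 𝕜] [CharZero 𝕜] [CommRing A] [Algebra 𝕜 A] [Fintype ι]

/-- The star product `exp(λ κ ∑ dᵢ ⊗ eᵢ)` of Wick type defined by commuting derivations. -/
def StarProduct.wick (κ : 𝕜) (d e : ι → Derivation 𝕜 A A)
    (hdd : ∀ i j a, d i (d j a) = d j (d i a)) (hee : ∀ i j a, e i (e j a) = e j (e i a))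
    (hde : ∀ i j a, d i (e j a) = e j (d i a)) : StarProduct 𝕜 A where
  op r := (κ ^ r / (r.factorial : 𝕜)) • iterContr d e r
  op_zero a b := by simp [iterContr_zero]
  op_one r hr a := by simp [iterContr_one_right d e hr]
  one_op r hr a := by simp [iterContr_one_left d e hr]
  op_assoc m a b c := by
    have key := congrArg (fun x => (κ ^ m / (m.factorial : 𝕜)) • x)
      (sum_choose_smul_iterContr_assoc hdd hee hde m a b c)
    simp only [smul_sum] at key
    refine Eq.trans (sum_congr rfl ?_) (key.trans (sum_congr rfl ?_)) <;> rintro ⟨k, l⟩ hkl <;>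
      obtain rfl := HasAntidiagonal.mem_antidiagonal.1 hkl <;>
      simp only [LinearMap.smul_apply, map_smul, smul_smul]
    · rw [mul_comm, pow_div_factorial_mul, mul_smul, Nat.cast_smul_eq_nsmul]
    · rw [mul_comm (κ ^ l / _), pow_div_factorial_mul, mul_smul, Nat.cast_smul_eq_nsmul]

end WickProduct

end StarProduct

/-! ### Division with remainder and its deformation -/

section Division

open Finset

/-- A linear division with remainder by right multiples of `j`. -/
structure DivisionBy (𝕜 : Type*) {R : Type*} [Semiring 𝕜] [Ring R] [Module 𝕜 R] (j : R) where
  rem : R →ₗ[𝕜] R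
  quot : R →ₗ[𝕜] R
  rem_add_quot_mul : ∀ a, rem a + quot a * j = a
  rem_mul : ∀ b, rem (b * j) = 0
  quot_mul : ∀ b, quot (b * j) = b

namespace DivisionBy

section Ring

variable {𝕜 R : Type*} [Semiring 𝕜] [Ring R] [Module 𝕜 R] {j : R} (Q : DivisionBy 𝕜 j)

theorem rem_add_mul (a b : R) : Q.rem (a + b * j) = Q.rem a := by
  rw [map_add, Q.rem_mul, add_zero]

theorem quot_rem (a : R) : Q.quot (Q.rem a) = 0 := by
  rw [← add_eq_right (a := Q.quot (Q.rem a)) (b := Q.quot a), ← Q.quot_mul (Q.quot a), ← map_add,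
    Q.quot_mul, Q.rem_add_quot_mul]

theorem rem_mul_rem (a b : R) : Q.rem (a * Q.rem b) = Q.rem (a * b) := by
  conv_rhs => rw [← Q.rem_add_quot_mul b, mul_add, ← mul_assoc, Q.rem_add_mul]

theorem rem_rem_mul_of_commute (a : R) {b : R} (hb : Commute j b) :
    Q.rem (Q.rem a * b) = Q.rem (a * b) := by
  conv_rhs => rw [← Q.rem_add_quot_mul a, add_mul, mul_assoc, hb.eq, ← mul_assoc, Q.rem_add_mul]

theorem rem_rem_mul_assoc (a b : R) {c : R} (hc : Commute j c) :
    Q.rem (Q.rem (a * b) * c) = Q.rem (a * Q.rem (b * c)) := by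
  rw [Q.rem_rem_mul_of_commute _ hc, Q.rem_mul_rem, mul_assoc]

end Ring

section Deformation

variable {𝕜 A : Type*} [CommRing 𝕜] [CommRing A] [Algebra 𝕜 A]

/-- The geometric series `∑ λʳ Kʳ = 1 / (1 - λ K)`, acting on formal power series. -/
def geometricSeries (K : Module.End 𝕜 A) : (ℕ → A) →ₗ[𝕜] (ℕ → A) where
  toFun x m := ∑ p ∈ antidiagonal m, (K ^ p.1) (x p.2)
  map_add' x y := by ext m; simp [sum_add_distrib]
  map_smul' c x := by ext m; simp [smul_sum]

theorem geometricSeries_apply_zero (K : Module.End 𝕜 A) (x : ℕ → A) :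
    geometricSeries K x 0 = x 0 := by simp [geometricSeries]

theorem geometricSeries_apply_succ (K : Module.End 𝕜 A) (x : ℕ → A) (m : ℕ) :
    geometricSeries K x (m + 1) = x (m + 1) + K (geometricSeries K x m) := by
  simp [geometricSeries, Nat.sum_antidiagonal_succ, pow_succ', map_sum]

theorem geometricSeries_eq_of_succ {K : Module.End 𝕜 A} {x y : ℕ → A} (h0 : y 0 = x 0)
    (h : ∀ m, y (m + 1) = x (m + 1) - K (x m)) : geometricSeries K y = x := by
  ext m
  induction m with
  | zero => rw [geometricSeries_apply_zero, h0]
  | succ m ih => rw [geometricSeries_apply_succ, h, ih, sub_add_cancel]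

variable {P : StarProduct 𝕜 A} {j : A}

/-- The operator which carries the part of `a * j` that the star product moves from order `m` to
order `m + 1` over to the dividend of order `m + 1`. -/
def carry (Q : DivisionBy 𝕜 j) (P : StarProduct 𝕜 A) : Module.End 𝕜 A :=
  -((P.op 1).flip j ∘ₗ Q.quot)

theorem carry_apply (Q : DivisionBy 𝕜 j) (a : A) : Q.carry P a = -P.op 1 (Q.quot a) j := rfl

theorem geometricSeries_carry_mul_const (Q : DivisionBy 𝕜 j) (hj : ∀ r ≥ 2, ∀ b, P.op r b j = 0)
    (x : P.Series) : geometricSeries (Q.carry P) (x * P.const j) = fun m => x m * j := by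
  refine geometricSeries_eq_of_succ (x.mul_const_apply_zero j) fun m => ?_
  rw [x.mul_const_apply_succ hj, carry_apply, Q.quot_mul, sub_neg_eq_add]

/-- The extension of the division by `j` to formal series with a star product in which `j`, as a
right factor, contributes in the orders `0` and `1` only. -/
def deform (Q : DivisionBy 𝕜 j) (hj : ∀ r ≥ 2, ∀ b, P.op r b j = 0) :
    DivisionBy 𝕜 (P.const j) where
  rem := Q.rem.compLeft ℕ ∘ₗ geometricSeries (Q.carry P)
  quot := Q.quot.compLeft ℕ ∘ₗ geometricSeries (Q.carry P)
  rem_add_quot_mul x := by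
    ext (_ | m)
    · rw [StarProduct.Series.add_apply, StarProduct.Series.mul_const_apply_zero]
      exact (Q.rem_add_quot_mul _).trans (geometricSeries_apply_zero _ x)
    · rw [StarProduct.Series.add_apply, StarProduct.Series.mul_const_apply_succ _ hj, ← add_assoc]
      calc Q.rem (geometricSeries (Q.carry P) x (m + 1)) +
              Q.quot (geometricSeries (Q.carry P) x (m + 1)) * j +
              P.op 1 (Q.quot (geometricSeries (Q.carry P) x m)) j
          = geometricSeries (Q.carry P) x (m + 1) -
              Q.carry P (geometricSeries (Q.carry P) x m) := by
            rw [Q.rem_add_quot_mul, carry_apply, sub_neg_eq_add]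
        _ = x (m + 1) := sub_eq_of_eq_add (geometricSeries_apply_succ _ x m)
  rem_mul x := by
    ext m
    exact (congrArg (fun y : ℕ → A => Q.rem (y m)) (Q.geometricSeries_carry_mul_const hj x)).trans
      (Q.rem_mul (x m))
  quot_mul x := by
    ext m
    exact (congrArg (fun y : ℕ → A => Q.quot (y m)) (Q.geometricSeries_carry_mul_const hj x)).trans
      (Q.quot_mul (x m))

theorem deform_rem_apply (Q : DivisionBy 𝕜 j) (hj : ∀ r ≥ 2, ∀ b, P.op r b j = 0) (x : P.Series)
    (m : ℕ) : (Q.deform hj).rem x m = Q.rem (geometricSeries (Q.carry P) x m) := rfl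

theorem deform_rem_eq_self (Q : DivisionBy 𝕜 j) (hj : ∀ r ≥ 2, ∀ b, P.op r b j = 0)
    {x : P.Series} (hx : ∀ m, Q.rem (x m) = x m) : (Q.deform hj).rem x = x := by
  have hT : geometricSeries (Q.carry P) x = x := geometricSeries_eq_of_succ rfl fun m => by
    rw [carry_apply, ← hx m, Q.quot_rem, map_zero, LinearMap.zero_apply, neg_zero, sub_zero]
  ext m
  rw [deform_rem_apply, hT, hx]

end Deformation

end DivisionBy

end Division

/-! ### Wirtinger derivatives of smooth functions -/

section Wirtinger

open Set Complex

variable {n : ℕ}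

theorem isOpen_phase (n : ℕ) : IsOpen (phase n) := isOpen_ne

theorem SmoothFn.contDiffAt {f : Fn n} (hf : SmoothFn f) {z : Coord n} (hz : z ∈ phase n) :
    ContDiffAt ℝ ∞ f z := ContDiffOn.contDiffAt hf ((isOpen_phase n).mem_nhds hz)

theorem SmoothFn.differentiableAt {f : Fn n} (hf : SmoothFn f) {z : Coord n}
    (hz : z ∈ phase n) : DifferentiableAt ℝ f z :=
  (hf.contDiffAt hz).differentiableAt (by simp)

theorem SmoothFn.fderiv_apply {f : Fn n} (hf : SmoothFn f) (v : Coord n) :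
    SmoothFn (fun z => fderiv ℝ f z v) :=
  (ContDiffOn.fderiv_of_isOpen hf (isOpen_phase n) (by simp)).clm_apply contDiffOn_const

theorem fderiv_apply_comm {f : Fn n} (hf : SmoothFn f) {z : Coord n} (hz : z ∈ phase n)
    (v w : Coord n) :
    fderiv ℝ (fun x => fderiv ℝ f x v) z w = fderiv ℝ (fun x => fderiv ℝ f x w) z v := by
  have hsymm := (hf.contDiffAt hz).isSymmSndFDerivAt
    (by simpa using WithTop.coe_le_coe.2 (le_top : (2 : ℕ∞) ≤ ⊤))
  have hd : DifferentiableAt ℝ (fderiv ℝ f) z :=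
    ((hf.contDiffAt hz).fderiv_right (m := ∞) (by simp)).differentiableAt (by simp)
  have key : ∀ u u' : Coord n, fderiv ℝ (fun x => fderiv ℝ f x u) z u' =
      fderiv ℝ (fderiv ℝ f) z u' u := fun u u' => by
    rw [fderiv_clm_apply hd (differentiableAt_const u)]
    simp
  rw [key, key]
  exact hsymm w v

/-- The common form of the two Wirtinger derivatives: `ε = -i` gives `∂/∂zⁱ`, and `ε = i` gives
`∂/∂z̄ⁱ`. -/
def wirtinger (ε : ℂ) (i : Fin (n + 1)) (f : Fn n) : Fn n := fun z =>
  1 / 2 * (fderiv ℝ f z (Pi.single i 1) + ε * fderiv ℝ f z (Pi.single i I))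

theorem dz_eq_wirtinger (i : Fin (n + 1)) : (dz i : Fn n → Fn n) = wirtinger (-I) i := by
  ext f z
  rw [dz, wirtinger, neg_mul, sub_eq_add_neg]

theorem wirtinger_eqOn {U : Set (Coord n)} (hU : IsOpen U) {f g : Fn n} (h : EqOn f g U)
    (ε : ℂ) (i : Fin (n + 1)) : EqOn (wirtinger ε i f) (wirtinger ε i g) U := fun z hz => by
  simp only [wirtinger, (h.eventuallyEq_of_mem (hU.mem_nhds hz)).fderiv_eq]

theorem SmoothFn.wirtinger {f : Fn n} (hf : SmoothFn f) (ε : ℂ) (i : Fin (n + 1)) :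
    SmoothFn (wirtinger ε i f) :=
  contDiffOn_const.mul ((hf.fderiv_apply _).add (contDiffOn_const.mul (hf.fderiv_apply _)))

theorem wirtinger_of_hasFDerivAt {f : Fn n} {L : Coord n →L[ℝ] ℂ} {z : Coord n}
    (h : HasFDerivAt f L z) (ε : ℂ) (i : Fin (n + 1)) :
    wirtinger ε i f z = 1 / 2 * (L (Pi.single i 1) + ε * L (Pi.single i I)) := by
  rw [wirtinger, h.fderiv]

theorem wirtinger_add {f g : Fn n} {z : Coord n} (hf : DifferentiableAt ℝ f z)
    (hg : DifferentiableAt ℝ g z) (ε : ℂ) (i : Fin (n + 1)) :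
    wirtinger ε i (f + g) z = wirtinger ε i f z + wirtinger ε i g z := by
  rw [wirtinger_of_hasFDerivAt (hf.hasFDerivAt.add hg.hasFDerivAt)]
  simp only [add_apply, wirtinger]
  ring

theorem wirtinger_const_smul {f : Fn n} {z : Coord n} (hf : DifferentiableAt ℝ f z) (c ε : ℂ)
    (i : Fin (n + 1)) : wirtinger ε i (c • f) z = c * wirtinger ε i f z := by
  rw [wirtinger_of_hasFDerivAt (hf.hasFDerivAt.const_smul c)]
  simp only [smul_apply, smul_eq_mul, wirtinger]
  ring

theorem wirtinger_mul {f g : Fn n} {z : Coord n} (hf : DifferentiableAt ℝ f z)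
    (hg : DifferentiableAt ℝ g z) (ε : ℂ) (i : Fin (n + 1)) :
    wirtinger ε i (f * g) z = f z * wirtinger ε i g z + g z * wirtinger ε i f z := by
  rw [wirtinger_of_hasFDerivAt (hf.hasFDerivAt.mul hg.hasFDerivAt)]
  simp only [add_apply, smul_apply, smul_eq_mul, wirtinger]
  ring

theorem fderiv_wirtinger {f : Fn n} (hf : SmoothFn f) {z : Coord n} (hz : z ∈ phase n) (ε : ℂ)
    (i : Fin (n + 1)) (v : Coord n) :
    fderiv ℝ (wirtinger ε i f) z v =
      1 / 2 * (fderiv ℝ (fun x => fderiv ℝ f x (Pi.single i 1)) z v +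
        ε * fderiv ℝ (fun x => fderiv ℝ f x (Pi.single i I)) z v) := by
  have h₁ := ((hf.fderiv_apply (Pi.single i 1)).differentiableAt hz).hasFDerivAt
  have h₂ := ((hf.fderiv_apply (Pi.single i I)).differentiableAt hz).hasFDerivAt
  have h := ((h₁.add (h₂.const_mul ε)).const_mul (1 / 2 : ℂ)).fderiv
  exact (DFunLike.congr_fun h v).trans (by simp [mul_add])

theorem wirtinger_comm {f : Fn n} (hf : SmoothFn f) {z : Coord n} (hz : z ∈ phase n) (ε ε' : ℂ)
    (i j : Fin (n + 1)) :
    wirtinger ε i (wirtinger ε' j f) z = wirtinger ε' j (wirtinger ε i f) z := by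
  rw [wirtinger, wirtinger]
  simp only [fderiv_wirtinger hf hz, fderiv_apply_comm hf hz _ (Pi.single i _)]
  ring

theorem fderiv_apply_eq (f : Fn n) (z v : Coord n) :
    fderiv ℝ f z v = ∑ i, (v i * dz i f z + (starRingEnd ℂ) (v i) * dzbar i f z) := by
  have hv : v = ∑ i, ((v i).re • (Pi.single i 1 : Coord n) +
      (v i).im • (Pi.single i I : Coord n)) := by
    ext j
    simp [Finset.sum_apply, Pi.single_apply, Finset.sum_add_distrib, re_add_im]
  conv_lhs => rw [hv]
  simp only [map_sum, map_add, map_smul]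
  refine Finset.sum_congr rfl fun i _ => ?_
  set a := fderiv ℝ f z (Pi.single i 1)
  set b := fderiv ℝ f z (Pi.single i I)
  rw [dz, dzbar, real_smul, real_smul, re_eq_add_conj, im_eq_sub_conj]
  field_simp
  linear_combination (v i - (starRingEnd ℂ) (v i)) * b * I_sq

theorem fderiv_apply_smul (f : Fn n) (z : Coord n) (c : ℂ) :
    fderiv ℝ f z (c • z) = c * euler f z + (starRingEnd ℂ) c * eulerBar f z := by
  simp only [fderiv_apply_eq, euler, eulerBar, Pi.smul_apply, smul_eq_mul, map_mul,
    Finset.sum_add_distrib, Finset.mul_sum, mul_assoc]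

end Wirtinger

/-! ### The algebra of smooth functions on the phase space -/

section SmoothAlg

open Set Complex Function

variable {n : ℕ}

theorem SmoothFn.congr {f g : Fn n} (hf : SmoothFn f) (h : EqOn g f (phase n)) : SmoothFn g :=
  ContDiffOn.congr hf h

/-- The continuation of a function on the phase space by `0` to the origin. -/
def extendZero (n : ℕ) : (phase n → ℂ) →ₗ[ℂ] Fn n := ExtendByZero.linearMap ℂ Subtype.val

theorem extendZero_apply (u : phase n → ℂ) (z : phase n) : extendZero n u z = u z :=
  Subtype.val_injective.extend_apply u 0 z

theorem extendZero_mul (u v : phase n → ℂ) :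
    extendZero n (u * v) = extendZero n u * extendZero n v :=
  (congrArg (extend Subtype.val (u * v)) (mul_zero 0).symm).trans (extend_mul _ u v 0 0)

theorem extendZero_eqOn (f : Fn n) : EqOn (extendZero n fun z => f z) f (phase n) :=
  fun z hz => extendZero_apply _ ⟨z, hz⟩

/-- The subalgebra of smooth functions on the phase space. -/
def smoothSubalgebra (n : ℕ) : Subalgebra ℂ (phase n → ℂ) where
  carrier := {u | SmoothFn (extendZero n u)}
  mul_mem' {u v} hu hv := by
    rw [mem_ofPred_eq, extendZero_mul]
    exact ContDiffOn.mul hu hv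
  add_mem' {u v} hu hv := by
    rw [mem_ofPred_eq, map_add]
    exact ContDiffOn.add hu hv
  algebraMap_mem' c := SmoothFn.congr contDiffOn_const (extendZero_eqOn fun _ => c)

/-- The algebra of smooth functions on the phase space. -/
def SmoothAlg (n : ℕ) : Type := smoothSubalgebra n

instance : CommRing (SmoothAlg n) := inferInstanceAs (CommRing (smoothSubalgebra n))

instance : Algebra ℂ (SmoothAlg n) := inferInstanceAs (Algebra ℂ (smoothSubalgebra n))

/-- The function `f` on `ℂⁿ⁺¹` restricts to the element `a` of the algebra of smooth functions on
the phase space. -/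
def Represents (f : Fn n) (a : SmoothAlg n) : Prop := ∀ z : phase n, f z = a.1 z

/-- The element of the algebra of smooth functions given by a smooth function. -/
def SmoothFn.toAlg {f : Fn n} (hf : SmoothFn f) : SmoothAlg n :=
  ⟨fun z => f z, hf.congr (extendZero_eqOn f)⟩

theorem SmoothFn.represents {f : Fn n} (hf : SmoothFn f) : Represents f hf.toAlg := fun _ => rfl

/-- A function on `ℂⁿ⁺¹` which represents a given element of the algebra of smooth functions. -/
def SmoothAlg.toFn (a : SmoothAlg n) : Fn n := extendZero n a.1

theorem SmoothAlg.represents (a : SmoothAlg n) : Represents a.toFn a :=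
  fun z => extendZero_apply a.1 z

theorem SmoothAlg.smoothFn (a : SmoothAlg n) : SmoothFn a.toFn := a.2

namespace Represents

variable {f g : Fn n} {a b : SmoothAlg n}

theorem eqOn_iff (hf : Represents f a) (hg : Represents g b) : EqOn f g (phase n) ↔ a = b := by
  refine ⟨fun h => Subtype.ext (funext fun z => ?_), ?_⟩
  · rw [← hf z, ← hg z, h z.2]
  · rintro rfl z hz
    exact (hf ⟨z, hz⟩).trans (hg ⟨z, hz⟩).symm

theorem unique (hf : Represents f a) (hf' : Represents f b) : a = b :=
  (hf.eqOn_iff hf').1 fun _ _ => rfl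

theorem congr (hf : Represents f a) (h : EqOn g f (phase n)) : Represents g a :=
  fun z => (h z.2).trans (hf z)

theorem smoothFn (hf : Represents f a) : SmoothFn f :=
  a.smoothFn.congr ((hf.eqOn_iff a.represents).2 rfl)

theorem add (hf : Represents f a) (hg : Represents g b) :
    Represents (fun z => f z + g z) (a + b) := fun z => congrArg₂ (· + ·) (hf z) (hg z)

theorem sub (hf : Represents f a) (hg : Represents g b) :
    Represents (fun z => f z - g z) (a - b) := fun z => congrArg₂ (· - ·) (hf z) (hg z)

theorem neg (hf : Represents f a) : Represents (fun z => -f z) (-a) :=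
  fun z => congrArg (-·) (hf z)

theorem mul (hf : Represents f a) (hg : Represents g b) :
    Represents (fun z => f z * g z) (a * b) := fun z => congrArg₂ (· * ·) (hf z) (hg z)

theorem const_mul (c : ℂ) (hf : Represents f a) : Represents (fun z => c * f z) (c • a) :=
  fun z => congrArg (c * ·) (hf z)

theorem algebraMap (c : ℂ) : Represents (fun _ : Coord n => c) (algebraMap ℂ _ c) := fun _ => rfl

theorem zero : Represents (0 : Fn n) 0 := fun _ => rfl

theorem one : Represents (1 : Fn n) 1 := fun _ => rfl

theorem pow (hf : Represents f a) (k : ℕ) : Represents (fun z => f z ^ k) (a ^ k) :=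
  fun z => congrArg (· ^ k) (hf z)

theorem sum {ι : Type*} {s : Finset ι} {f : ι → Fn n} {a : ι → SmoothAlg n}
    (h : ∀ i ∈ s, Represents (f i) (a i)) :
    Represents (fun z => ∑ i ∈ s, f i z) (∑ i ∈ s, a i) := by
  classical
  induction s using Finset.induction_on with
  | empty => exact fun _ => rfl
  | insert i s his ih =>
    simp only [Finset.sum_insert his]
    exact (h i (s.mem_insert_self i)).add (ih fun j hj => h j (Finset.mem_insert_of_mem hj))

end Represents

/-- The Wirtinger derivative as a derivation of the algebra of smooth functions. -/
def wirtingerDer (ε : ℂ) (i : Fin (n + 1)) : Derivation ℂ (SmoothAlg n) (SmoothAlg n) :=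
  Derivation.mk'
    { toFun a := (a.smoothFn.wirtinger ε i).toAlg
      map_add' a b := Subtype.ext <| funext fun z =>
        (congrArg (wirtinger ε i · z) (map_add (extendZero n) a.1 b.1)).trans <|
          wirtinger_add (a.smoothFn.differentiableAt z.2) (b.smoothFn.differentiableAt z.2) ε i
      map_smul' c a := Subtype.ext <| funext fun z =>
        (congrArg (wirtinger ε i · z) (map_smul (extendZero n) c a.1)).trans <|
          wirtinger_const_smul (a.smoothFn.differentiableAt z.2) c ε i }
    fun a b => Subtype.ext <| funext fun z =>
      (congrArg (wirtinger ε i · z) (extendZero_mul a.1 b.1)).trans <|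
        (wirtinger_mul (a.smoothFn.differentiableAt z.2)
          (b.smoothFn.differentiableAt z.2) ε i).trans <|
        congrArg₂ (· * wirtinger ε i b.toFn z + · * wirtinger ε i a.toFn z)
          (a.represents z) (b.represents z)

protected theorem Represents.wirtinger {f : Fn n} {a : SmoothAlg n} (hf : Represents f a) (ε : ℂ)
    (i : Fin (n + 1)) : Represents (wirtinger ε i f) (wirtingerDer ε i a) :=
  (a.smoothFn.wirtinger ε i).represents.congr
    (wirtinger_eqOn (isOpen_phase n) ((hf.eqOn_iff a.represents).2 rfl) ε i)

theorem wirtingerDer_comm (ε ε' : ℂ) (i j : Fin (n + 1)) (a : SmoothAlg n) :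
    wirtingerDer ε i (wirtingerDer ε' j a) = wirtingerDer ε' j (wirtingerDer ε i a) :=
  (((a.represents.wirtinger ε' j).wirtinger ε i).eqOn_iff
    ((a.represents.wirtinger ε i).wirtinger ε' j)).1
    fun _ hz => wirtinger_comm a.smoothFn hz ε ε' i j

/-- `∂/∂zⁱ` as a derivation of the algebra of smooth functions. -/
def dzDer (i : Fin (n + 1)) : Derivation ℂ (SmoothAlg n) (SmoothAlg n) := wirtingerDer (-I) i

/-- `∂/∂z̄ⁱ` as a derivation of the algebra of smooth functions. -/
def dzbarDer (i : Fin (n + 1)) : Derivation ℂ (SmoothAlg n) (SmoothAlg n) := wirtingerDer I i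

protected theorem Represents.dz {f : Fn n} {a : SmoothAlg n} (hf : Represents f a)
    (i : Fin (n + 1)) : Represents (dz i f) (dzDer i a) :=
  dz_eq_wirtinger (n := n) i ▸ hf.wirtinger (-I) i

protected theorem Represents.dzbar {f : Fn n} {a : SmoothAlg n} (hf : Represents f a)
    (i : Fin (n + 1)) : Represents (dzbar i f) (dzbarDer i a) := hf.wirtinger I i

/-! ### Coordinates, Euler operators and the constraint function -/

/-- A real linear form as an element of the algebra of smooth functions. -/
def linearForm (L : Coord n →L[ℝ] ℂ) : SmoothAlg n :=
  SmoothFn.toAlg (f := L) L.contDiff.contDiffOn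

theorem wirtingerDer_linearForm (ε : ℂ) (i : Fin (n + 1)) (L : Coord n →L[ℝ] ℂ) :
    wirtingerDer ε i (linearForm L) =
      algebraMap ℂ _ (1 / 2 * (L (Pi.single i 1) + ε * L (Pi.single i I))) :=
  ((((SmoothFn.represents _).wirtinger ε i).eqOn_iff (Represents.algebraMap _)).1
    fun _ _ => wirtinger_of_hasFDerivAt L.hasFDerivAt ε i)

/-- The coordinate function `zⁱ`. -/
def coord (i : Fin (n + 1)) : SmoothAlg n := linearForm (.proj i)

/-- The conjugate coordinate function `z̄ⁱ`. -/
def conjCoord (i : Fin (n + 1)) : SmoothAlg n :=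
  linearForm ((conjCLE : ℂ →L[ℝ] ℂ).comp (.proj i))

theorem represents_coord (i : Fin (n + 1)) : Represents (fun z => z i) (coord i) := fun _ => rfl

theorem represents_conjCoord (i : Fin (n + 1)) :
    Represents (fun z => (starRingEnd ℂ) (z i)) (conjCoord i) := fun _ => rfl

theorem dzDer_coord (i j : Fin (n + 1)) :
    dzDer i (coord j : SmoothAlg n) = if i = j then 1 else 0 := by
  rw [dzDer, coord, wirtingerDer_linearForm]
  rcases eq_or_ne i j with rfl | h
  · norm_num
  · simp [h, h.symm]

theorem dzDer_conjCoord (i j : Fin (n + 1)) : dzDer i (conjCoord j : SmoothAlg n) = 0 := by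
  rw [dzDer, conjCoord, wirtingerDer_linearForm]
  rcases eq_or_ne i j with rfl | h
  · simp
  · simp [h.symm]

theorem dzbarDer_coord (i j : Fin (n + 1)) : dzbarDer i (coord j : SmoothAlg n) = 0 := by
  rw [dzbarDer, coord, wirtingerDer_linearForm]
  rcases eq_or_ne i j with rfl | h
  · simp
  · simp [h.symm]

theorem dzbarDer_conjCoord (i j : Fin (n + 1)) :
    dzbarDer i (conjCoord j : SmoothAlg n) = if i = j then 1 else 0 := by
  rw [dzbarDer, conjCoord, wirtingerDer_linearForm]
  rcases eq_or_ne i j with rfl | h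
  · norm_num
  · simp [h, h.symm]

variable (n) in
/-- The Euler operator `E` as a derivation of the algebra of smooth functions. -/
def eulerDer : Derivation ℂ (SmoothAlg n) (SmoothAlg n) := ∑ i, coord i • dzDer i

variable (n) in
/-- The conjugate Euler operator `Ē` as a derivation of the algebra of smooth functions. -/
def eulerBarDer : Derivation ℂ (SmoothAlg n) (SmoothAlg n) := ∑ i, conjCoord i • dzbarDer i

theorem eulerDer_apply (a : SmoothAlg n) : eulerDer n a = ∑ i, coord i * dzDer i a := by
  rw [eulerDer, ← Derivation.coeFnAddMonoidHom_apply, map_sum, Finset.sum_apply]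
  rfl

theorem eulerBarDer_apply (a : SmoothAlg n) :
    eulerBarDer n a = ∑ i, conjCoord i * dzbarDer i a := by
  rw [eulerBarDer, ← Derivation.coeFnAddMonoidHom_apply, map_sum, Finset.sum_apply]
  rfl

protected theorem Represents.euler {f : Fn n} {a : SmoothAlg n} (hf : Represents f a) :
    Represents (euler f) (eulerDer n a) :=
  eulerDer_apply a ▸ .sum fun i _ => (represents_coord i).mul (hf.dz i)

protected theorem Represents.eulerBar {f : Fn n} {a : SmoothAlg n} (hf : Represents f a) :
    Represents (eulerBar f) (eulerBarDer n a) :=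
  eulerBarDer_apply a ▸ .sum fun i _ => (represents_conjCoord i).mul (hf.dzbar i)

variable (n) in
/-- `z z̄` as an element of the algebra of smooth functions. -/
def zzA : SmoothAlg n := ∑ i, coord i * conjCoord i

variable (n) in
/-- The constraint function `J` as an element of the algebra of smooth functions. -/
def JA (μ : ℝ) : SmoothAlg n := (-(1 / 2) : ℂ) • zzA n - algebraMap ℂ _ (μ : ℂ)

theorem zz_eq (z : Coord n) : (zz z : ℂ) = ∑ i, z i * (starRingEnd ℂ) (z i) := by
  simp [zz, mul_conj]

theorem represents_zz : Represents (fun z => (zz z : ℂ)) (zzA n) := by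
  simp only [zz_eq]
  exact .sum fun i _ => (represents_coord i).mul (represents_conjCoord i)

theorem represents_J (μ : ℝ) : Represents (J μ) (JA n μ) :=
  ((represents_zz.const_mul (-(1 / 2))).sub (.algebraMap (μ : ℂ))).congr fun z _ => by simp [J]

theorem dzDer_zzA (i : Fin (n + 1)) : dzDer i (zzA n) = conjCoord i := by
  simp [zzA, dzDer_coord, dzDer_conjCoord]

theorem dzbarDer_zzA (i : Fin (n + 1)) : dzbarDer i (zzA n) = coord i := by
  simp [zzA, dzbarDer_coord, dzbarDer_conjCoord]

theorem dzDer_JA (μ : ℝ) (i : Fin (n + 1)) :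
    dzDer i (JA n μ) = (-(1 / 2) : ℂ) • conjCoord i := by
  rw [JA, map_sub, Derivation.map_smul, dzDer_zzA, Derivation.map_algebraMap, sub_zero]

theorem dzbarDer_JA (μ : ℝ) (i : Fin (n + 1)) :
    dzbarDer i (JA n μ) = (-(1 / 2) : ℂ) • coord i := by
  rw [JA, map_sub, Derivation.map_smul, dzbarDer_zzA, Derivation.map_algebraMap, sub_zero]

/-! ### The Wick product -/

variable (n) in
/-- The Wick star product on the algebra of smooth functions on the phase space. -/
def wickStar (κ : ℝ) : StarProduct ℂ (SmoothAlg n) :=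
  .wick (κ : ℂ) dzDer dzbarDer (wirtingerDer_comm _ _) (wirtingerDer_comm _ _)
    (wirtingerDer_comm _ _)

theorem wickStar_op_apply (κ : ℝ) (r : ℕ) (a b : SmoothAlg n) :
    (wickStar n κ).op r a b =
      ((κ : ℂ) ^ r / (r.factorial : ℂ)) • iterContr dzDer dzbarDer r a b := rfl

theorem wickStar_op_one_apply (κ : ℝ) (a b : SmoothAlg n) :
    (wickStar n κ).op 1 a b = (κ : ℂ) • ∑ i, dzDer i a * dzbarDer i b := by
  simp [wickStar_op_apply, iterContr_succ, iterContr_zero]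

theorem iterContr_JA_right (μ : ℝ) {r : ℕ} (hr : 2 ≤ r) (a : SmoothAlg n) :
    iterContr dzDer dzbarDer r a (JA n μ) = 0 := by
  obtain ⟨r, rfl⟩ := Nat.exists_eq_add_of_le' hr
  simp [iterContr_succ, dzbarDer_JA, dzbarDer_coord]

theorem iterContr_JA_left (μ : ℝ) {r : ℕ} (hr : 2 ≤ r) (a : SmoothAlg n) :
    iterContr dzDer dzbarDer r (JA n μ) a = 0 := by
  obtain ⟨r, rfl⟩ := Nat.exists_eq_add_of_le' hr
  simp [iterContr_succ, dzDer_JA, dzDer_conjCoord]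

theorem wickStar_op_JA_right (κ μ : ℝ) (r : ℕ) (hr : 2 ≤ r) (a : SmoothAlg n) :
    (wickStar n κ).op r a (JA n μ) = 0 := by
  rw [wickStar_op_apply, iterContr_JA_right μ hr, smul_zero]

theorem wickStar_op_JA_left (κ μ : ℝ) (r : ℕ) (hr : 2 ≤ r) (a : SmoothAlg n) :
    (wickStar n κ).op r (JA n μ) a = 0 := by
  rw [wickStar_op_apply, iterContr_JA_left μ hr, smul_zero]

theorem wickStar_op_one_JA_right (κ μ : ℝ) (a : SmoothAlg n) :
    (wickStar n κ).op 1 a (JA n μ) = -((κ / 2 : ℂ) • eulerDer n a) := by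
  have h (i : Fin (n + 1)) : dzDer i a * dzbarDer i (JA n μ) =
      (-(1 / 2) : ℂ) • (coord i * dzDer i a) := by rw [dzbarDer_JA, mul_smul_comm, mul_comm]
  rw [wickStar_op_one_apply, Finset.sum_congr rfl fun i _ => h i, ← Finset.smul_sum, smul_smul,
    eulerDer_apply, ← neg_smul]
  congr 1
  ring

theorem wickStar_op_one_JA_left (κ μ : ℝ) (a : SmoothAlg n) :
    (wickStar n κ).op 1 (JA n μ) a = -((κ / 2 : ℂ) • eulerBarDer n a) := by
  simp only [wickStar_op_one_apply, dzDer_JA, smul_mul_assoc, ← Finset.smul_sum, smul_smul,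
    eulerBarDer_apply, ← neg_smul]
  congr 1
  ring

protected theorem Represents.dzIter {f : Fn n} {a : SmoothAlg n} (hf : Represents f a) (r : ℕ)
    (i : Fin r → Fin (n + 1)) : Represents (dzIter r i f) (iterDer dzDer r i a) := by
  induction r with
  | zero => exact hf
  | succ r ih => exact (ih _).dz _

protected theorem Represents.dzbarIter {f : Fn n} {a : SmoothAlg n} (hf : Represents f a) (r : ℕ)
    (i : Fin r → Fin (n + 1)) : Represents (dzbarIter r i f) (iterDer dzbarDer r i a) := by
  induction r with
  | zero => exact hf
  | succ r ih => exact (ih _).dzbar _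

protected theorem Represents.contraction {f g : Fn n} {a b : SmoothAlg n} (hf : Represents f a)
    (hg : Represents g b) (r : ℕ) :
    Represents (contraction r f g) (iterContr dzDer dzbarDer r a b) := by
  rw [iterContr_eq_sum_iterDer (d := dzDer) (e := dzbarDer) (wirtingerDer_comm _ _)
    (wirtingerDer_comm _ _)]
  exact .sum fun i _ => (hf.dzIter r i).mul (hg.dzbarIter r i)

protected theorem Represents.wickM {f g : Fn n} {a b : SmoothAlg n} (hf : Represents f a)
    (hg : Represents g b) (κ : ℝ) (r : ℕ) :
    Represents (wickM κ r f g) ((wickStar n κ).op r a b) := (hf.contraction hg r).const_mul _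

protected theorem Represents.wickAnti {f g : Fn n} {a b : SmoothAlg n} (hf : Represents f a)
    (hg : Represents g b) (κ : ℝ) (r : ℕ) :
    Represents (wickAnti κ r f g) ((wickStar n κ).op r a b - (wickStar n κ).op r b a) :=
  (hf.wickM hg κ r).sub (hg.wickM hf κ r)

theorem dzIter_eqOn {U : Set (Coord n)} (hU : IsOpen U) {f g : Fn n} (h : EqOn f g U) (r : ℕ)
    (i : Fin r → Fin (n + 1)) : EqOn (dzIter r i f) (dzIter r i g) U := by
  induction r with
  | zero => exact h
  | succ r ih =>
    simp only [dzIter, dz_eq_wirtinger]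
    exact wirtinger_eqOn hU (ih _) _ _

theorem dzbarIter_eqOn {U : Set (Coord n)} (hU : IsOpen U) {f g : Fn n} (h : EqOn f g U) (r : ℕ)
    (i : Fin r → Fin (n + 1)) : EqOn (dzbarIter r i f) (dzbarIter r i g) U := by
  induction r with
  | zero => exact h
  | succ r ih => exact wirtinger_eqOn hU (ih _) _ _

theorem wickM_eqOn (κ : ℝ) {U : Set (Coord n)} (hU : IsOpen U) {f f' g g' : Fn n}
    (hf : EqOn f f' U) (hg : EqOn g g' U) (r : ℕ) :
    EqOn (wickM κ r f g) (wickM κ r f' g') U := fun z hz =>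
  congrArg (_ * ·) <| Finset.sum_congr rfl fun i _ => by
    rw [dzIter_eqOn hU hf r i hz, dzbarIter_eqOn hU hg r i hz]

/-- The Poisson bracket on the algebra of smooth functions. -/
def poissonA (κ : ℝ) (a b : SmoothAlg n) : SmoothAlg n :=
  (κ / I : ℂ) • ∑ i, (dzDer i a * dzbarDer i b - dzbarDer i a * dzDer i b)

protected theorem Represents.poisson {f g : Fn n} {a b : SmoothAlg n} (hf : Represents f a)
    (hg : Represents g b) (κ : ℝ) : Represents (poisson κ f g) (poissonA κ a b) :=
  (Represents.sum fun i _ =>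
    ((hf.dz i).mul (hg.dzbar i)).sub ((hf.dzbar i).mul (hg.dz i))).const_mul _

theorem wickStar_op_one_sub_swap (κ : ℝ) (a b : SmoothAlg n) :
    (wickStar n κ).op 1 a b - (wickStar n κ).op 1 b a = I • poissonA κ a b := by
  rw [poissonA, smul_smul, mul_div_cancel₀ _ I_ne_zero, wickStar_op_one_apply,
    wickStar_op_one_apply, ← smul_sub, ← Finset.sum_sub_distrib]
  simp only [mul_comm (dzDer _ b)]

theorem poissonA_JA (κ μ : ℝ) (a : SmoothAlg n) :
    poissonA κ a (JA n μ) = (κ / 2 * I : ℂ) • (eulerDer n a - eulerBarDer n a) := by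
  have h := wickStar_op_one_sub_swap κ a (JA n μ)
  rw [wickStar_op_one_JA_right, wickStar_op_one_JA_left, ← neg_sub', ← smul_sub] at h
  rw [← inv_smul_smul₀ I_ne_zero (poissonA κ a (JA n μ)), ← h, ← neg_smul, smul_smul, inv_I]
  congr 1
  ring

end SmoothAlg

/-! ### Invariance under scalings -/

section Scaling

open Set Complex ComplexConjugate

variable {n : ℕ}

theorem smul_mem_phase {c : ℂ} (hc : c ≠ 0) {z : Coord n} (hz : z ∈ phase n) :
    c • z ∈ phase n := smul_ne_zero hc hz

theorem hasDerivAt_comp_exp_smul {f : Fn n} (hf : SmoothFn f) (c : ℂ) {z : Coord n}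
    (hz : z ∈ phase n) (t : ℝ) :
    HasDerivAt (fun s : ℝ => f (exp (s * c) • z))
      (c * euler f (exp (t * c) • z) + conj c * eulerBar f (exp (t * c) • z)) t := by
  have hexp : HasDerivAt (fun s : ℝ => exp (s * c)) (c * exp (t * c)) t := by
    simpa [mul_comm] using ((hasDerivAt_id t).ofReal_comp.mul_const c).cexp
  rw [← fderiv_apply_smul, ← mul_smul]
  exact (hf.differentiableAt (smul_mem_phase (exp_ne_zero _) hz)).hasFDerivAt.comp_hasDerivAt t
    (hexp.smul_const z)

namespace Represents

variable {f : Fn n} {a : SmoothAlg n}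

theorem comp_exp_smul_iff (hf : Represents f a) (c : ℂ) :
    (∀ s : ℝ, ∀ z ∈ phase n, f (exp (s * c) • z) = f z) ↔
      c • eulerDer n a + conj c • eulerBarDer n a = 0 := by
  have hrep := (hf.euler.const_mul c).add (hf.eulerBar.const_mul (conj c))
  rw [← hrep.eqOn_iff Represents.zero]
  constructor <;> intro h
  · intro z hz
    have hderiv := hasDerivAt_comp_exp_smul hf.smoothFn c hz 0
    simp only [h _ z hz, ofReal_zero, zero_mul, exp_zero, one_smul] at hderiv
    exact hderiv.unique (hasDerivAt_const _ _)
  · intro s z hz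
    have hderiv (t : ℝ) : HasDerivAt (fun s : ℝ => f (exp (s * c) • z)) 0 t :=
      (hasDerivAt_comp_exp_smul hf.smoothFn c hz t).congr_deriv
        (h (smul_mem_phase (exp_ne_zero (t * c)) hz))
    simpa using is_const_of_deriv_eq_zero (fun t => (hderiv t).differentiableAt)
      (fun t => (hderiv t).deriv) s 0

theorem comp_exp_I_smul_iff (hf : Represents f a) :
    (∀ φ : ℝ, ∀ z ∈ phase n, f (exp (I * φ) • z) = f z) ↔ eulerDer n a = eulerBarDer n a := by
  simp only [mul_comm I, hf.comp_exp_smul_iff, conj_I, neg_smul, ← sub_eq_add_neg, ← smul_sub,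
    smul_eq_zero_iff_right I_ne_zero, sub_eq_zero]

theorem comp_pos_smul_iff (hf : Represents f a) :
    (∀ r : ℝ, 0 < r → ∀ z ∈ phase n, f ((r : ℂ) • z) = f z) ↔
      eulerDer n a + eulerBarDer n a = 0 := by
  have h := hf.comp_exp_smul_iff 1
  simp only [mul_one, map_one, one_smul, ← ofReal_exp] at h
  rw [← h]
  exact ⟨fun h s => h _ (Real.exp_pos s), fun h r hr => Real.exp_log hr ▸ h (Real.log r)⟩

end Represents

/-- The elements of degree `0` with respect to both Euler operators, represented by the functions
on the complex projective space. -/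
def IsHomogeneous (a : SmoothAlg n) : Prop := eulerDer n a = 0 ∧ eulerBarDer n a = 0

theorem isHomogeneous_iff_eq_and_add_eq_zero {a : SmoothAlg n} : IsHomogeneous a ↔
    eulerDer n a = eulerBarDer n a ∧ eulerDer n a + eulerBarDer n a = 0 := by
  refine ⟨fun ⟨h, h'⟩ => by simp [h, h'], fun ⟨h, h'⟩ => ?_⟩
  rw [← h, ← two_smul ℂ, smul_eq_zero_iff_right two_ne_zero] at h'
  exact ⟨h', h ▸ h'⟩

theorem Represents.comp_smul_iff {f : Fn n} {a : SmoothAlg n} (hf : Represents f a) :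
    (∀ c : ℂ, c ≠ 0 → ∀ z ∈ phase n, f (c • z) = f z) ↔ IsHomogeneous a := by
  constructor
  · intro h
    rw [isHomogeneous_iff_eq_and_add_eq_zero, ← hf.comp_exp_I_smul_iff, ← hf.comp_pos_smul_iff]
    exact ⟨fun φ => h _ (exp_ne_zero _), fun r hr => h r (ofReal_ne_zero.2 hr.ne')⟩
  · rintro ⟨h, h'⟩ c hc
    have := (hf.comp_exp_smul_iff (log c)).2 (by rw [h, h', smul_zero, smul_zero, add_zero]) 1
    rwa [ofReal_one, one_mul, exp_log hc] at this

end Scaling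

/-! ### Radial prolongation and division by the constraint function -/

section Radial

open Set

variable {n : ℕ}

theorem zz_pos {z : Coord n} (hz : z ∈ phase n) : 0 < zz z := by
  obtain ⟨i, hi⟩ := Function.ne_iff.1 hz
  exact Finset.sum_pos' (fun i _ => Complex.normSq_nonneg _)
    ⟨i, Finset.mem_univ i, Complex.normSq_pos.2 hi⟩

theorem zz_smul (c : ℂ) (z : Coord n) : zz (c • z) = Complex.normSq c * zz z := by
  simp [zz, Finset.mul_sum]

theorem contDiff_zz : ContDiff ℝ ∞ (zz : Coord n → ℝ) :=
  ContDiff.sum fun i _ => by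
    simp only [Complex.normSq_apply]
    exact ((Complex.reCLM.contDiff.comp (contDiff_apply ℝ ℂ i)).mul
      (Complex.reCLM.contDiff.comp (contDiff_apply ℝ ℂ i))).add
      ((Complex.imCLM.contDiff.comp (contDiff_apply ℝ ℂ i)).mul
      (Complex.imCLM.contDiff.comp (contDiff_apply ℝ ℂ i)))

theorem J_eq_zero_iff (μ : ℝ) (z : Coord n) : J μ z = 0 ↔ zz z = -2 * μ := by
  rw [J, Complex.ofReal_eq_zero]
  constructor <;> intro h <;> linarith

variable {μ : ℝ} (hμ : μ < 0) {z : Coord n}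

include hμ

theorem ratio_pos (hz : z ∈ phase n) : 0 < -2 * μ / zz z := div_pos (by linarith) (zz_pos hz)

theorem proj_mem_phase (hz : z ∈ phase n) : proj μ z ∈ phase n :=
  smul_mem_phase (Complex.ofReal_ne_zero.2 (Real.sqrt_pos.2 (ratio_pos hμ hz)).ne') hz

theorem proj_mem_surface (hz : z ∈ phase n) : proj μ z ∈ surface n μ := by
  refine (J_eq_zero_iff _ _).2 ?_
  rw [proj, zz_smul, Complex.normSq_ofReal, Real.mul_self_sqrt (ratio_pos hμ hz).le,
    div_mul_cancel₀ _ (zz_pos hz).ne']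

theorem surface_subset_phase : surface n μ ⊆ phase n := by
  rintro z hz rfl
  have := (J_eq_zero_iff _ _).1 hz
  simp only [zz, Pi.zero_apply, map_zero, Finset.sum_const_zero] at this
  linarith

theorem proj_eq_self (hz : z ∈ surface n μ) : proj μ z = z := by
  rw [proj, (J_eq_zero_iff _ _).1 hz, div_self (by linarith)]
  simp

omit hμ in
theorem proj_pos_smul (μ : ℝ) {r : ℝ} (hr : 0 < r) (z : Coord n) :
    proj μ ((r : ℂ) • z) = proj μ z := by
  rw [proj, proj, zz_smul, Complex.normSq_ofReal, ← sq, mul_comm (r ^ 2), ← div_div,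
    Real.sqrt_div' _ (by positivity), Real.sqrt_sq hr.le, smul_smul, ← Complex.ofReal_mul,
    div_mul_cancel₀ _ hr.ne']

theorem contDiffOn_sqrt_ratio :
    ContDiffOn ℝ ∞ (fun z : Coord n => Real.sqrt (-2 * μ / zz z)) (phase n) :=
  (contDiffOn_const.div contDiff_zz.contDiffOn fun _ hz => (zz_pos hz).ne').sqrt
    fun _ hz => (ratio_pos hμ hz).ne'

theorem contDiffOn_proj : ContDiffOn ℝ ∞ (proj μ : Coord n → Coord n) (phase n) :=
  (Complex.ofRealCLM.contDiff.comp_contDiffOn (contDiffOn_sqrt_ratio hμ)).smul contDiffOn_id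

omit hμ in
/-- The pullback along a smooth self-map of the phase space. -/
def SmoothAlg.pullback {φ : Coord n → Coord n} (hφ : ContDiffOn ℝ ∞ φ (phase n))
    (hmaps : MapsTo φ (phase n) (phase n)) : SmoothAlg n →ₐ[ℂ] SmoothAlg n where
  toFun a := SmoothFn.toAlg (f := a.toFn ∘ φ) (ContDiffOn.comp a.smoothFn hφ hmaps)
  map_one' := ((SmoothFn.represents _).eqOn_iff .one).1 fun z hz =>
    SmoothAlg.represents 1 ⟨φ z, hmaps hz⟩
  map_mul' a b := ((SmoothFn.represents _).eqOn_iff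
    ((SmoothFn.represents _).mul (SmoothFn.represents _))).1 fun z _ =>
      congrFun (extendZero_mul a.1 b.1) (φ z)
  map_zero' := ((SmoothFn.represents _).eqOn_iff .zero).1 fun z hz =>
    SmoothAlg.represents 0 ⟨φ z, hmaps hz⟩
  map_add' a b := ((SmoothFn.represents _).eqOn_iff
    ((SmoothFn.represents _).add (SmoothFn.represents _))).1 fun z _ =>
      congrFun (map_add (extendZero n) a.1 b.1) (φ z)
  commutes' c := ((SmoothFn.represents _).eqOn_iff (.algebraMap c)).1 fun z hz =>
    SmoothAlg.represents (algebraMap ℂ _ c) ⟨φ z, hmaps hz⟩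

/-- The radial prolongation on the algebra of smooth functions. -/
def prolA : SmoothAlg n →ₐ[ℂ] SmoothAlg n :=
  SmoothAlg.pullback (contDiffOn_proj hμ) fun _ => proj_mem_phase hμ

variable {f : Fn n} {a b : SmoothAlg n}

protected theorem Represents.prol (hf : Represents f a) : Represents (prol μ f) (prolA hμ a) :=
  fun z => (hf ⟨_, proj_mem_phase hμ z.2⟩).trans (a.represents ⟨_, proj_mem_phase hμ z.2⟩).symm

theorem prolA_eq_self_iff : prolA hμ a = a ↔ eulerDer n a + eulerBarDer n a = 0 := by
  rw [← (a.represents.prol hμ).eqOn_iff a.represents, ← a.represents.comp_pos_smul_iff]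
  constructor <;> intro h
  · intro r hr z hz
    rw [← h hz, ← h (smul_mem_phase (Complex.ofReal_ne_zero.2 hr.ne') hz), prol, prol,
      proj_pos_smul μ hr]
  · exact fun z hz => h _ (Real.sqrt_pos.2 (ratio_pos hμ hz)) z hz

theorem prolA_prolA : prolA hμ (prolA hμ a) = prolA hμ a :=
  (((a.represents.prol hμ).prol hμ).eqOn_iff (a.represents.prol hμ)).1 fun _ hz =>
    congrArg a.toFn (proj_eq_self hμ (proj_mem_surface hμ hz))

theorem euler_add_eulerBar_prolA : eulerDer n (prolA hμ a) + eulerBarDer n (prolA hμ a) = 0 :=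
  (prolA_eq_self_iff hμ).1 (prolA_prolA hμ)

theorem prolA_eq_zero_iff (hf : Represents f a) : prolA hμ a = 0 ↔ ∀ z ∈ surface n μ, f z = 0 := by
  rw [← (hf.prol hμ).eqOn_iff .zero]
  exact ⟨fun h z hz => proj_eq_self hμ hz ▸ h (surface_subset_phase hμ hz),
    fun h z hz => h _ (proj_mem_surface hμ hz)⟩

theorem prolA_JA : prolA hμ (JA n μ) = 0 :=
  (prolA_eq_zero_iff hμ (represents_J μ)).2 fun _ => id

omit hμ in
theorem eulerDer_zzA : eulerDer n (zzA n) = zzA n := by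
  rw [eulerDer_apply, zzA]
  exact Finset.sum_congr rfl fun i _ => congrArg (_ * ·) (dzDer_zzA i)

omit hμ in
theorem eulerBarDer_zzA : eulerBarDer n (zzA n) = zzA n := by
  rw [eulerBarDer_apply, zzA]
  exact Finset.sum_congr rfl fun i _ => by rw [mul_comm, ← dzbarDer_zzA i, zzA]

omit hμ in
theorem eulerDer_JA (μ : ℝ) : eulerDer n (JA n μ) = -(1 / 2 : ℂ) • zzA n := by
  rw [JA, map_sub, Derivation.map_smul, eulerDer_zzA, Derivation.map_algebraMap, sub_zero]

omit hμ in
theorem eulerBarDer_JA (μ : ℝ) : eulerBarDer n (JA n μ) = -(1 / 2 : ℂ) • zzA n := by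
  rw [JA, map_sub, Derivation.map_smul, eulerBarDer_zzA, Derivation.map_algebraMap, sub_zero]

theorem Represents.eqOn_compJ {h : Fn n} (hf : Represents f a) (hh : Represents h b)
    (hab : a = prolA hμ a + b * JA n μ) : EqOn h (compJ μ f) (phase n) := by
  intro z hz
  by_cases hJ : J μ z = 0
  · have hsum : eulerDer n a + eulerBarDer n a =
        (eulerDer n b + eulerBarDer n b) * JA n μ - b * zzA n := by
      have hab' := congrArg₂ (· + ·) (congrArg (eulerDer n) hab) (congrArg (eulerBarDer n) hab)
      simp only [map_add, Derivation.leibniz, eulerDer_JA, eulerBarDer_JA] at hab'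
      rw [hab', add_add_add_comm, euler_add_eulerBar_prolA]
      simp only [smul_eq_mul, mul_smul_comm]
      linear_combination (by module : (-(1 / 2) : ℂ) • (b * zzA n) + (-(1 / 2) : ℂ) • (b * zzA n) =
        -(b * zzA n))
    have hpt := ((hf.euler.add hf.eulerBar).eqOn_iff
      (((hh.euler.add hh.eulerBar).mul (represents_J μ)).sub (hh.mul represents_zz))).2 hsum hz
    simp only [hJ, (J_eq_zero_iff μ z).1 hJ, mul_zero, zero_sub] at hpt
    rw [compJ, if_pos hJ, hpt]
    have hμ' : (μ : ℂ) ≠ 0 := Complex.ofReal_ne_zero.2 hμ.ne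
    push_cast
    field
  · have hpt := (hf.eqOn_iff ((hf.prol hμ).add (hh.mul (represents_J μ)))).2 hab hz
    rw [compJ, if_neg hJ, eq_div_iff hJ, hpt, add_sub_cancel_left]

theorem SmoothFn.exists_sub_prol_eq_mul_J (hf : SmoothFn f) :
    ∃ h : Fn n, SmoothFn h ∧ ∀ z ∈ phase n, f z - prol μ f z = h z * J μ z := by
  have hline (z : Coord n) (t : ℝ) : AffineMap.lineMap (proj μ z) z t =
      (((1 - t) * Real.sqrt (-2 * μ / zz z) + t : ℝ) : ℂ) • z := by
    rw [AffineMap.lineMap_apply_module, proj]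
    simp only [Complex.coe_smul]
    module
  have hseg : ∀ z ∈ phase n, ∀ t ∈ uIcc (0 : ℝ) 1, AffineMap.lineMap (proj μ z) z t ∈ phase n := by
    intro z hz t ht
    rw [uIcc_of_le zero_le_one] at ht
    have hs := Real.sqrt_pos.2 (ratio_pos hμ hz)
    rw [hline]
    refine smul_mem_phase (Complex.ofReal_ne_zero.2 (ne_of_gt ?_)) hz
    rcases ht.1.eq_or_lt with rfl | ht0
    · simpa using hs
    · exact add_pos_of_nonneg_of_pos (mul_nonneg (sub_nonneg.2 ht.2) hs.le) ht0
  obtain ⟨L, hL, hLf⟩ :=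
    exists_contDiffOn_sub_eq_clm_apply (isOpen_phase n) hf (contDiffOn_proj hμ) hseg
  refine ⟨fun z => (-2 / (zz z * (1 + Real.sqrt (-2 * μ / zz z))) : ℝ) • L z z, ?_, ?_⟩
  · exact (contDiffOn_const.div (contDiff_zz.contDiffOn.mul
      (contDiffOn_const.add (contDiffOn_sqrt_ratio hμ))) fun z hz => (mul_pos (zz_pos hz)
        (by positivity)).ne').smul (hL.clm_apply contDiffOn_id)
  · intro z hz
    have hs := Real.sq_sqrt (ratio_pos hμ hz).le
    have hzz := (zz_pos hz).ne'
    have hsub : z - proj μ z = (1 - Real.sqrt (-2 * μ / zz z)) • z := by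
      rw [sub_smul, one_smul, proj, Complex.coe_smul]
    have hcoeff : 1 - Real.sqrt (-2 * μ / zz z) =
        -2 / (zz z * (1 + Real.sqrt (-2 * μ / zz z))) * (-(1 / 2) * zz z - μ) := by
      have : 0 < 1 + Real.sqrt (-2 * μ / zz z) := by positivity
      generalize Real.sqrt (-2 * μ / zz z) = s at hs this ⊢
      rw [eq_div_iff hzz] at hs
      field_simp
      linear_combination -hs
    rw [prol, ← hLf z hz, hsub, map_smul, hcoeff, J]
    simp only [Complex.real_smul]
    push_cast
    ring

theorem exists_eq_prolA_add_mul_JA (a : SmoothAlg n) : ∃ b, a = prolA hμ a + b * JA n μ := by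
  obtain ⟨h, hh, heq⟩ := a.smoothFn.exists_sub_prol_eq_mul_J hμ
  exact ⟨hh.toAlg, (a.represents.eqOn_iff ((a.represents.prol hμ).add
    (hh.represents.mul (represents_J μ)))).1 fun z hz =>
      sub_eq_iff_eq_add'.1 (heq z hz)⟩

protected theorem SmoothFn.compJ (hf : SmoothFn f) : SmoothFn (compJ μ f) := by
  obtain ⟨b, hb⟩ := exists_eq_prolA_add_mul_JA hμ hf.toAlg
  exact b.smoothFn.congr (hf.represents.eqOn_compJ hμ b.represents hb).symm

theorem eq_compJ_toAlg (hab : a = prolA hμ a + b * JA n μ) : b = (a.smoothFn.compJ hμ).toAlg :=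
  (b.represents.eqOn_iff (SmoothFn.represents _)).1 (a.represents.eqOn_compJ hμ b.represents hab)

theorem eq_prolA_add_compJ_mul_JA (a : SmoothAlg n) :
    a = prolA hμ a + (a.smoothFn.compJ hμ).toAlg * JA n μ := by
  obtain ⟨b, hb⟩ := exists_eq_prolA_add_mul_JA hμ a
  rwa [← eq_compJ_toAlg hμ hb]

/-- The division of smooth functions by the constraint function, with the radial functions as
remainders. -/
def divisionByJ : DivisionBy ℂ (JA n μ) where
  rem := (prolA hμ).toLinearMap
  quot :=
    { toFun a := (a.smoothFn.compJ hμ).toAlg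
      map_add' a b := (eq_compJ_toAlg hμ <| by
        conv_lhs => rw [eq_prolA_add_compJ_mul_JA hμ a, eq_prolA_add_compJ_mul_JA hμ b]
        rw [map_add]
        ring).symm
      map_smul' c a := (eq_compJ_toAlg hμ <| by
        conv_lhs => rw [eq_prolA_add_compJ_mul_JA hμ a]
        rw [map_smul, RingHom.id_apply, smul_add, smul_mul_assoc]).symm }
  rem_add_quot_mul a := (eq_prolA_add_compJ_mul_JA hμ a).symm
  rem_mul b := by rw [AlgHom.toLinearMap_apply, map_mul, prolA_JA, mul_zero]
  quot_mul b := (eq_compJ_toAlg hμ (by rw [map_mul, prolA_JA, mul_zero, zero_add])).symm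

theorem divisionByJ_rem (a : SmoothAlg n) : (divisionByJ hμ).rem a = prolA hμ a := rfl

protected theorem Represents.compJ (hf : Represents f a) :
    Represents (compJ μ f) ((divisionByJ hμ).quot a) := by
  have h := (divisionByJ hμ).rem_add_quot_mul a
  exact (SmoothAlg.represents _).congr (hf.eqOn_compJ hμ (SmoothAlg.represents _) h.symm).symm

end Radial

/-! ### Weights of the Wick product -/

section Weights

variable {n : ℕ}

theorem eulerDer_conjCoord (i : Fin (n + 1)) : eulerDer n (conjCoord i) = 0 := by
  simp [eulerDer_apply, dzDer_conjCoord]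

theorem dzDer_dzDer (i j : Fin (n + 1)) (a : SmoothAlg n) :
    dzDer i (dzDer j a) = dzDer j (dzDer i a) := wirtingerDer_comm _ _ i j a

theorem dzbarDer_dzbarDer (i j : Fin (n + 1)) (a : SmoothAlg n) :
    dzbarDer i (dzbarDer j a) = dzbarDer j (dzbarDer i a) := wirtingerDer_comm _ _ i j a

theorem dzDer_dzbarDer (i j : Fin (n + 1)) (a : SmoothAlg n) :
    dzDer i (dzbarDer j a) = dzbarDer j (dzDer i a) := wirtingerDer_comm _ _ i j a

theorem eulerDer_dzDer (i : Fin (n + 1)) (a : SmoothAlg n) :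
    eulerDer n (dzDer i a) = dzDer i (eulerDer n a) + (-1 : ℂ) • dzDer i a := by
  simp only [eulerDer_apply, map_sum, Derivation.leibniz, dzDer_coord, smul_eq_mul,
    Finset.sum_add_distrib, mul_ite, mul_one, mul_zero, Finset.sum_ite_eq, Finset.mem_univ,
    if_true, neg_smul, one_smul, add_neg_cancel_right, dzDer_dzDer i]

theorem eulerDer_dzbarDer (i : Fin (n + 1)) (a : SmoothAlg n) :
    eulerDer n (dzbarDer i a) = dzbarDer i (eulerDer n a) := by
  simp only [eulerDer_apply, map_sum, Derivation.leibniz, dzbarDer_coord, smul_eq_mul, mul_zero,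
    add_zero, dzDer_dzbarDer]

theorem eulerBarDer_dzbarDer (i : Fin (n + 1)) (a : SmoothAlg n) :
    eulerBarDer n (dzbarDer i a) = dzbarDer i (eulerBarDer n a) + (-1 : ℂ) • dzbarDer i a := by
  simp only [eulerBarDer_apply, map_sum, Derivation.leibniz, dzbarDer_conjCoord, smul_eq_mul,
    Finset.sum_add_distrib, mul_ite, mul_one, mul_zero, Finset.sum_ite_eq, Finset.mem_univ,
    if_true, neg_smul, one_smul, add_neg_cancel_right, dzbarDer_dzbarDer i]

theorem eulerBarDer_dzDer (i : Fin (n + 1)) (a : SmoothAlg n) :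
    eulerBarDer n (dzDer i a) = dzDer i (eulerBarDer n a) := by
  simp only [eulerBarDer_apply, map_sum, Derivation.leibniz, dzDer_conjCoord, smul_eq_mul,
    mul_zero, add_zero, dzDer_dzbarDer]

theorem eulerDer_eulerBarDer (a : SmoothAlg n) :
    eulerDer n (eulerBarDer n a) = eulerBarDer n (eulerDer n a) := by
  rw [eulerBarDer_apply, eulerBarDer_apply, map_sum]
  exact Finset.sum_congr rfl fun i _ => by
    rw [Derivation.leibniz, eulerDer_conjCoord, smul_zero, add_zero, eulerDer_dzbarDer, smul_eq_mul]

theorem eulerDer_wickStar_op (κ : ℝ) (r : ℕ) (a b : SmoothAlg n) :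
    eulerDer n ((wickStar n κ).op r a b) = (wickStar n κ).op r (eulerDer n a) b +
      (wickStar n κ).op r a (eulerDer n b) - (r : ℂ) • (wickStar n κ).op r a b := by
  have h := iterContr_weighted_leibniz dzDer dzbarDer (eulerDer n) (c' := 0) eulerDer_dzDer
    (fun i a => by rw [eulerDer_dzbarDer, zero_smul, add_zero]) r a b
  simp only [wickStar_op_apply, Derivation.map_smul, h]
  module

theorem eulerBarDer_wickStar_op (κ : ℝ) (r : ℕ) (a b : SmoothAlg n) :
    eulerBarDer n ((wickStar n κ).op r a b) = (wickStar n κ).op r (eulerBarDer n a) b +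
      (wickStar n κ).op r a (eulerBarDer n b) - (r : ℂ) • (wickStar n κ).op r a b := by
  have h := iterContr_weighted_leibniz dzDer dzbarDer (eulerBarDer n) (c := 0)
    (fun i a => by rw [eulerBarDer_dzDer, zero_smul, add_zero]) eulerBarDer_dzbarDer r a b
  simp only [wickStar_op_apply, Derivation.map_smul, h]
  module

variable (n) in
/-- `E - Ē`, up to a factor the generator of the `U(1)`-action. -/
def rotationDer : Derivation ℂ (SmoothAlg n) (SmoothAlg n) := eulerDer n - eulerBarDer n

theorem rotationDer_apply (a : SmoothAlg n) :
    rotationDer n a = eulerDer n a - eulerBarDer n a := rfl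

theorem rotationDer_JA (μ : ℝ) : rotationDer n (JA n μ) = 0 := by
  rw [rotationDer_apply, eulerDer_JA, eulerBarDer_JA, sub_self]

theorem rotationDer_eulerDer (a : SmoothAlg n) :
    rotationDer n (eulerDer n a) = eulerDer n (rotationDer n a) := by
  rw [rotationDer_apply, rotationDer_apply, map_sub, eulerDer_eulerBarDer]

theorem rotationDer_eulerBarDer (a : SmoothAlg n) :
    rotationDer n (eulerBarDer n a) = eulerBarDer n (rotationDer n a) := by
  rw [rotationDer_apply, rotationDer_apply, map_sub, eulerDer_eulerBarDer]

theorem rotationDer_wickStar_op (κ : ℝ) (r : ℕ) (a b : SmoothAlg n) :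
    rotationDer n ((wickStar n κ).op r a b) =
      (wickStar n κ).op r (rotationDer n a) b + (wickStar n κ).op r a (rotationDer n b) := by
  simp only [rotationDer_apply, eulerDer_wickStar_op, eulerBarDer_wickStar_op, map_sub,
    LinearMap.sub_apply]
  abel

theorem IsHomogeneous.rotationDer {a : SmoothAlg n} (ha : IsHomogeneous a) :
    rotationDer n a = 0 := by rw [rotationDer_apply, ha.1, ha.2, sub_zero]

theorem isHomogeneous_zzA_pow_mul_wickStar_op (κ : ℝ) (r : ℕ) {a b : SmoothAlg n}
    (ha : IsHomogeneous a) (hb : IsHomogeneous b) :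
    IsHomogeneous (zzA n ^ r * (wickStar n κ).op r a b) := by
  have hpow {δ : Derivation ℂ (SmoothAlg n) (SmoothAlg n)} (hδ : δ (zzA n) = zzA n) :
      δ (zzA n ^ r) = (r : ℂ) • zzA n ^ r := by
    rcases r with _ | r
    · simp
    · rw [Derivation.leibniz_pow, hδ, Nat.add_sub_cancel, smul_eq_mul, ← pow_succ,
        Nat.cast_smul_eq_nsmul]
  constructor
  · rw [Derivation.leibniz, eulerDer_wickStar_op, ha.1, hb.1, hpow eulerDer_zzA]
    simp [mul_comm]
  · rw [Derivation.leibniz, eulerBarDer_wickStar_op, ha.2, hb.2, hpow eulerBarDer_zzA]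
    simp [mul_comm]

end Weights

/-! ### Division by the constraint function in the Wick algebra -/

section WickDivision

open StarProduct

variable {n : ℕ} (κ : ℝ) {μ : ℝ} (hμ : μ < 0)

include hμ

/-- The operator `K = (κ/2) E ∘ π_J` on the algebra of smooth functions. -/
def opKA : Module.End ℂ (SmoothAlg n) := (divisionByJ hμ).carry (wickStar n κ)

/-- The division by `J` in the Wick algebra: its remainder is `prol ∘ T` and its quotient
is `π_J ∘ T`. -/
def wickDivision : DivisionBy ℂ ((wickStar n κ).const (JA n μ)) :=
  (divisionByJ hμ).deform (wickStar_op_JA_right κ μ)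

theorem wickDivision_rem_apply (x : (wickStar n κ).Series) (m : ℕ) :
    (wickDivision κ hμ).rem x m = prolA hμ (DivisionBy.geometricSeries (opKA κ hμ) x m) := rfl

theorem opKA_apply (a : SmoothAlg n) :
    opKA κ hμ a = (κ / 2 : ℂ) • eulerDer n ((divisionByJ hμ).quot a) := by
  rw [opKA, DivisionBy.carry_apply, wickStar_op_one_JA_right, neg_neg]

variable {f : Fn n} {a : SmoothAlg n}

protected theorem Represents.opK (hf : Represents f a) : Represents (opK κ μ f) (opKA κ hμ a) :=
  opKA_apply κ hμ a ▸ (hf.compJ hμ).euler.const_mul _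

theorem Represents.opK_iterate (hf : Represents f a) (m : ℕ) :
    Represents ((opK κ μ)^[m] f) ((opKA κ hμ ^ m) a) := by
  induction m with
  | zero => exact hf
  | succ m ih =>
    rw [Function.iterate_succ_apply', pow_succ', Module.End.mul_apply]
    exact ih.opK κ hμ

protected theorem Represents.opT (hf : Represents f a) (m : ℕ) :
    Represents (opT κ μ m f) ((opKA κ hμ ^ m) a) := by
  induction m using Nat.strong_induction_on generalizing f a with
  | _ m ih =>
    rcases m with _ | m
    · rw [opT]
      exact hf
    have hsum : (opKA κ hμ ^ (m + 1)) a = -∑ k : Fin (m + 1), (opKA κ hμ ^ (m - k : ℕ))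
        ((wickStar n κ).op (k + 1) ((divisionByJ hμ).quot a) (JA n μ)) := by
      rw [Finset.sum_eq_single 0 (fun k _ hk => ?_) (by simp), pow_succ, Module.End.mul_apply, opKA,
        DivisionBy.carry_apply, map_neg]
      · simp
      · rw [wickStar_op_JA_right κ μ _ (by have := Fin.val_ne_zero_iff.2 hk; omega), map_zero]
    rw [hsum, opT]
    exact (Represents.sum fun k _ => ih _ (by omega) ((hf.compJ hμ).wickM (represents_J μ) κ _)).neg

theorem prolA_rotationDer_prolA (a : SmoothAlg n) :
    prolA hμ (rotationDer n (prolA hμ a)) = rotationDer n (prolA hμ a) := by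
  rw [prolA_eq_self_iff, ← rotationDer_eulerDer, ← rotationDer_eulerBarDer, ← map_add,
    euler_add_eulerBar_prolA, map_zero]

theorem prolA_rotationDer (a : SmoothAlg n) :
    prolA hμ (rotationDer n a) = rotationDer n (prolA hμ a) := by
  conv_lhs => rw [← (divisionByJ hμ).rem_add_quot_mul a]
  rw [map_add, Derivation.leibniz, rotationDer_JA, smul_zero, zero_add, map_add, divisionByJ_rem,
    prolA_rotationDer_prolA, smul_eq_mul, map_mul, prolA_JA, zero_mul, add_zero]

theorem divisionByJ_quot_rotationDer (a : SmoothAlg n) :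
    (divisionByJ hμ).quot (rotationDer n a) = rotationDer n ((divisionByJ hμ).quot a) := by
  conv_lhs => rw [← (divisionByJ hμ).rem_add_quot_mul a]
  rw [map_add, Derivation.leibniz, rotationDer_JA, smul_zero, zero_add, map_add, divisionByJ_rem,
    ← prolA_rotationDer_prolA, ← divisionByJ_rem, DivisionBy.quot_rem, smul_eq_mul, mul_comm,
    DivisionBy.quot_mul, zero_add]

theorem rotationDer_opKA (a : SmoothAlg n) :
    rotationDer n (opKA κ hμ a) = opKA κ hμ (rotationDer n a) := by
  rw [opKA_apply, opKA_apply, Derivation.map_smul, rotationDer_eulerDer,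
    divisionByJ_quot_rotationDer]

variable {κ}

theorem rotationDer_geometricSeries_opKA {x : ℕ → SmoothAlg n}
    (hx : ∀ m, rotationDer n (x m) = 0) (m : ℕ) :
    rotationDer n (DivisionBy.geometricSeries (opKA κ hμ) x m) = 0 := by
  induction m with
  | zero => rw [DivisionBy.geometricSeries_apply_zero, hx]
  | succ m ih =>
    rw [DivisionBy.geometricSeries_apply_succ, map_add, hx, zero_add, rotationDer_opKA, ih,
      map_zero]

variable {x y : (wickStar n κ).Series}

theorem isHomogeneous_wickDivision_rem (hx : ∀ m, rotationDer n (x m) = 0) (m : ℕ) :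
    IsHomogeneous ((wickDivision κ hμ).rem x m) := by
  rw [isHomogeneous_iff_eq_and_add_eq_zero, ← sub_eq_zero, ← rotationDer_apply,
    wickDivision_rem_apply, ← prolA_rotationDer, rotationDer_geometricSeries_opKA hμ hx, map_zero]
  exact ⟨rfl, euler_add_eulerBar_prolA hμ⟩

theorem rotationDer_wickDivision_quot (hx : ∀ m, rotationDer n (x m) = 0) (m : ℕ) :
    rotationDer n ((wickDivision κ hμ).quot x m) = 0 := by
  refine (divisionByJ_quot_rotationDer hμ _).symm.trans ?_
  exact (congrArg _ (rotationDer_geometricSeries_opKA hμ hx m)).trans (map_zero _)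

omit hμ in
theorem rotationDer_mul (hx : ∀ m, rotationDer n (x m) = 0) (hy : ∀ m, rotationDer n (y m) = 0)
    (m : ℕ) : rotationDer n ((x * y) m) = 0 := by
  simp [Series.mul_apply, rotationDer_wickStar_op, hx, hy]

theorem IsHomogeneous.prolA (ha : IsHomogeneous a) : prolA hμ a = a :=
  (prolA_eq_self_iff hμ).2 (isHomogeneous_iff_eq_and_add_eq_zero.1 ha).2

theorem wickDivision_rem_eq_self (hx : ∀ m, prolA hμ (x m) = x m) :
    (wickDivision κ hμ).rem x = x :=
  (divisionByJ hμ).deform_rem_eq_self _ hx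

end WickDivision

/-! ### Normalizers of the vanishing ideal and of the star ideal -/

section Normalizer

open StarProduct

variable {n : ℕ} {κ μ : ℝ}

theorem poissonA_mul_right (κ : ℝ) (a b c : SmoothAlg n) :
    poissonA κ a (b * c) = b * poissonA κ a c + poissonA κ a b * c := by
  simp only [poissonA, Derivation.leibniz, smul_eq_mul, mul_smul_comm, smul_mul_assoc, ← smul_add,
    Finset.mul_sum, Finset.sum_mul, ← Finset.sum_add_distrib]
  congr 1
  exact Finset.sum_congr rfl fun i _ => by ring

theorem poissonA_zero_right (κ : ℝ) (a : SmoothAlg n) : poissonA κ a 0 = 0 := by simp [poissonA]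

theorem poissonA_JA_eq_zero {a : SmoothAlg n} (ha : IsHomogeneous a) :
    poissonA κ a (JA n μ) = 0 := by
  rw [poissonA_JA, ← rotationDer_apply, ha.rotationDer, smul_zero]

theorem prolA_poissonA_eq_zero (hμ : μ < 0) {a b : SmoothAlg n} (ha : IsHomogeneous a)
    (hb : prolA hμ b = 0) : prolA hμ (poissonA κ a b) = 0 := by
  rw [← (divisionByJ hμ).rem_add_quot_mul b, divisionByJ_rem, hb, zero_add, poissonA_mul_right,
    poissonA_JA_eq_zero ha, mul_zero, zero_add, map_mul, prolA_JA, mul_zero]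

theorem isHomogeneous_of_prolA_poissonA_JA (hκ : κ ≠ 0) (hμ : μ < 0) {a : SmoothAlg n}
    (ha : prolA hμ a = a) (hJ : prolA hμ (poissonA κ a (JA n μ)) = 0) : IsHomogeneous a := by
  have hc : (κ / 2 * Complex.I : ℂ) ≠ 0 := by simp [hκ]
  rw [poissonA_JA, ← rotationDer_apply, map_smul, smul_eq_zero_iff_right hc, ← ha,
    prolA_rotationDer_prolA, ha, rotationDer_apply, sub_eq_zero] at hJ
  exact isHomogeneous_iff_eq_and_add_eq_zero.2 ⟨hJ, (prolA_eq_self_iff hμ).1 ha⟩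

variable {x : (wickStar n κ).Series}

theorem mul_const_JA_sub_apply_zero (x : (wickStar n κ).Series) :
    (x * (wickStar n κ).const (JA n μ) - (wickStar n κ).const (JA n μ) * x) 0 = 0 := by
  rw [Series.sub_apply, Series.mul_const_apply_zero, Series.const_mul_apply_zero, mul_comm,
    sub_self]

theorem mul_const_JA_sub_apply_succ (x : (wickStar n κ).Series) (m : ℕ) :
    (x * (wickStar n κ).const (JA n μ) - (wickStar n κ).const (JA n μ) * x) (m + 1) =
      -((κ / 2 : ℂ) • rotationDer n (x m)) := by
  rw [Series.sub_apply, Series.mul_const_apply_succ _ (wickStar_op_JA_right κ μ),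
    Series.const_mul_apply_succ _ (wickStar_op_JA_left κ μ), wickStar_op_one_JA_right,
    wickStar_op_one_JA_left, rotationDer_apply, smul_sub, mul_comm]
  abel

theorem commute_const_JA (hx : ∀ m, rotationDer n (x m) = 0) :
    Commute ((wickStar n κ).const (JA n μ)) x := by
  refine (sub_eq_zero.1 (Series.ext fun m => ?_)).symm
  rcases m with _ | m
  · exact mul_const_JA_sub_apply_zero x
  · rw [mul_const_JA_sub_apply_succ, hx, smul_zero, neg_zero, Series.zero_apply]

theorem rotationDer_eq_zero_of_commutator_mem (hκ : κ ≠ 0) (hμ : μ < 0)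
    (hx : ∀ m, prolA hμ (x m) = x m) {y : (wickStar n κ).Series}
    (hy : x * (wickStar n κ).const (JA n μ) - (wickStar n κ).const (JA n μ) * x =
      y * (wickStar n κ).const (JA n μ)) (m : ℕ) : rotationDer n (x m) = 0 := by
  have hself := wickDivision_rem_eq_self (κ := κ) hμ
    (x := x * (wickStar n κ).const (JA n μ) - (wickStar n κ).const (JA n μ) * x) fun m => by
      rcases m with _ | m
      · rw [mul_const_JA_sub_apply_zero, map_zero]
      · rw [mul_const_JA_sub_apply_succ, map_neg, map_smul, prolA_rotationDer, hx]
  rw [hy, DivisionBy.rem_mul, ← hy] at hself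
  have hm := mul_const_JA_sub_apply_succ (μ := μ) x m
  rw [← hself, Series.zero_apply, zero_eq_neg, smul_eq_zero_iff_right (by simp [hκ])] at hm
  exact hm

end Normalizer

/-! ### The coefficients `A^{(k)}_l` -/

section Coefficients

open Finset

theorem nestedSum_succ (l k : ℕ) :
    nestedSum (l + 1) k = ∑ i ∈ range k, ((i : ℤ) + 1) * nestedSum l (i + 1) := by
  rw [nestedSum, range_eq_Ico, ← Ico_add_one_right_eq_Icc, ← zero_add 1, ← sum_Ico_add']
  simp

theorem nestedSum_succ_succ (l k : ℕ) :
    nestedSum (l + 1) (k + 1) = nestedSum (l + 1) k + ((k : ℤ) + 1) * nestedSum l (k + 1) := by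
  rw [nestedSum_succ, nestedSum_succ, sum_range_succ]

theorem coeffA_succ_right (k l : ℕ) :
    coeffA k (l + 1) = -∑ i ∈ range k, ((i : ℤ) + 1) * coeffA (i + 1) l := by
  simp only [coeffA, nestedSum_succ, mul_sum, ← sum_neg_distrib]
  exact sum_congr rfl fun i _ => by ring

theorem coeffA_zero_right (k : ℕ) : coeffA k 0 = 1 := by simp [coeffA, nestedSum]

theorem coeffA_zero_left {l : ℕ} (hl : l ≠ 0) : coeffA 0 l = 0 := by
  obtain ⟨l, rfl⟩ := Nat.exists_eq_succ_of_ne_zero hl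
  simp [coeffA_succ_right]

/-- The alternating sum `∑ⱼ (-1)ᵏ⁻ʲ C(k, j) jᵏ⁺ˡ`, the `k`-th finite difference of `xᵏ⁺ˡ` at `0`. -/
def altSum (k l : ℕ) : ℚ :=
  ∑ j ∈ range (k + 1), (-1) ^ (k - j) * (k.choose j : ℚ) * (j : ℚ) ^ (k + l)

theorem altSum_zero_right (k : ℕ) : altSum k 0 = k.factorial := by
  have h := congrFun (fwdDiff_iter_eq_factorial (R := ℚ) (n := k)) 0
  rw [fwdDiff_iter_eq_sum_shift] at h
  simp only [altSum, add_zero]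
  refine Eq.trans (sum_congr rfl fun j _ => ?_) h
  simp

theorem altSum_succ_succ (k l : ℕ) :
    altSum (k + 1) (l + 1) = (k + 1) * altSum k (l + 1) + (k + 1) * altSum (k + 1) l := by
  rw [altSum, altSum, altSum, mul_sum, mul_sum, sum_range_succ, sum_range_succ _ (k + 1),
    ← add_assoc (Finset.sum _ _), ← sum_add_distrib]
  congr 1
  · refine sum_congr rfl fun j hj => ?_
    have hjk : j ≤ k := Nat.lt_succ_iff.1 (mem_range.1 hj)
    have hchoose : ((k + 1).choose j : ℚ) * ((k : ℚ) + 1 - j) = (k.choose j : ℚ) * (k + 1) := by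
      have := Nat.choose_mul_succ_eq k j
      rw [← Nat.cast_succ, ← Nat.cast_sub (by omega)]
      exact_mod_cast this.symm
    rw [Nat.sub_add_comm hjk, show k + 1 + (l + 1) = k + l + 1 + 1 by ring,
      show k + 1 + l = k + l + 1 by ring, show k + (l + 1) = k + l + 1 by ring]
    linear_combination ((-1 : ℚ) ^ (k - j) * (j : ℚ) ^ (k + l + 1)) * hchoose
  · simp only [tsub_self, pow_zero, Nat.choose_self, Nat.cast_one, mul_one, Nat.cast_add, one_mul]
    ring

theorem altSum_succ_left (k l : ℕ) : altSum (k + 1) l =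
    (k + 1) * ∑ j ∈ range (k + 1), (-1) ^ (k - j) * (k.choose j : ℚ) * ((j : ℚ) + 1) ^ (k + l) := by
  rw [altSum, sum_range_succ', Nat.cast_zero, zero_pow (by omega), mul_zero, add_zero, mul_sum]
  refine sum_congr rfl fun j _ => ?_
  have hchoose : ((k + 1).choose (j + 1) : ℚ) * ((j : ℚ) + 1) = ((k : ℚ) + 1) * k.choose j := by
    exact_mod_cast (Nat.add_one_mul_choose_eq k j).symm
  rw [show k + 1 - (j + 1) = k - j by omega, show k + 1 + l = k + l + 1 by ring]
  push_cast
  linear_combination (-1 : ℚ) ^ (k - j) * ((j : ℚ) + 1) ^ (k + l) * hchoose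

theorem factorial_mul_nestedSum (k l : ℕ) :
    (k.factorial : ℚ) * nestedSum l k = altSum k l := by
  induction k generalizing l with
  | zero => cases l <;> simp [altSum, nestedSum]
  | succ k ihk =>
    induction l with
    | zero => rw [altSum_zero_right]; simp [nestedSum]
    | succ l ihl =>
      rw [altSum_succ_succ, ← ihl, ← ihk, nestedSum_succ_succ, Nat.factorial_succ]
      push_cast
      ring

theorem coeffA_eq (k l : ℕ) (hk : 1 ≤ k) :
    (coeffA k l : ℚ) = 1 / ((k - 1).factorial : ℚ) * ∑ j ∈ Icc 1 k,
      ((k - 1).choose (j - 1) : ℚ) * (-1) ^ (k + l - j) * (j : ℚ) ^ (k + l - 1) := by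
  obtain ⟨k, rfl⟩ := Nat.exists_eq_add_of_le' hk
  have hsum : (k.factorial : ℚ) * nestedSum l (k + 1) =
      ∑ j ∈ range (k + 1), (-1) ^ (k - j) * (k.choose j : ℚ) * ((j : ℚ) + 1) ^ (k + l) := by
    have h := (factorial_mul_nestedSum (k + 1) l).trans (altSum_succ_left k l)
    rw [Nat.factorial_succ, Nat.cast_mul, mul_assoc, Nat.cast_succ] at h
    exact mul_left_cancel₀ (by positivity) h
  rw [eq_comm, one_div_mul_eq_div, div_eq_iff (by positivity), coeffA, Int.cast_mul, mul_assoc,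
    mul_comm (nestedSum l (k + 1) : ℚ), Nat.add_sub_cancel, hsum, mul_sum, range_eq_Ico,
    ← Ico_add_one_right_eq_Icc, ← zero_add 1, ← sum_Ico_add']
  refine sum_congr (by simp) fun j hj => ?_
  rw [mem_Ico] at hj
  rw [show k + (0 + 1) + l - (j + (0 + 1)) = l + (k - j) by omega,
    show k + (0 + 1) + l - (0 + 1) = k + l by omega, pow_add (-1 : ℚ)]
  push_cast
  ring

theorem coeffA_eq_sum_div_factorial {s l : ℕ} (hs : 1 ≤ s) :
    (coeffA s l : ℂ) = ∑ k ∈ Icc 1 s, (-1 : ℂ) ^ (s + l - k) * (k : ℂ) ^ (s + l - 1) /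
      (((s - k).factorial : ℂ) * ((k - 1).factorial : ℂ)) := by
  have h := congrArg (fun q : ℚ => (q : ℂ)) (coeffA_eq s l hs)
  push_cast at h
  rw [h, mul_sum]
  refine sum_congr rfl fun k hk => ?_
  rw [mem_Icc] at hk
  have hchoose : ((s - 1).choose (k - 1) : ℂ) =
      (s - 1).factorial / ((k - 1).factorial * (s - k).factorial) := by
    rw [Nat.cast_choose ℂ (by omega), show s - 1 - (k - 1) = s - k by omega]
  have hne (m : ℕ) : (m.factorial : ℂ) ≠ 0 := Nat.cast_ne_zero.2 m.factorial_ne_zero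
  rw [hchoose]
  field_simp [hne]

theorem starCP_eq_starBBEW {n : ℕ} (κ μ : ℝ) (f g : Series n) :
    starCP κ μ f g = starBBEW κ μ f g := by
  ext m z
  simp only [starCP, starBBEW, ext₂]
  refine sum_congr rfl fun p _ => sum_congr rfl fun q _ => ?_
  generalize f q.1 = f, g q.2 = g
  rcases Nat.eq_zero_or_pos p.1 with hr | hr
  · simp [hr, coeffA_zero_right, wickM, contraction, dzIter, dzbarIter]
  rw [if_neg hr.ne', Nat.sum_antidiagonal_eq_sum_range_succ_mk, range_eq_Ico,
    sum_eq_sum_Ico_succ_bot (by omega), coeffA_zero_left (by omega), Int.cast_zero, mul_zero,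
    zero_mul, zero_mul, zero_add, mul_sum, zero_add, Nat.succ_eq_add_one, Ico_add_one_right_eq_Icc]
  refine sum_congr rfl fun s hs => ?_
  rw [mem_Icc] at hs
  have hκ : (κ : ℂ) ^ p.1 = (κ : ℂ) ^ s * (κ : ℂ) ^ (p.1 - s) := by
    rw [← pow_add, Nat.add_sub_cancel' hs.2]
  rw [coeffA_eq_sum_div_factorial hs.1, Nat.add_sub_cancel' hs.2, wickM, mul_sum, sum_mul, sum_mul,
    mul_sum]
  refine sum_congr rfl fun k _ => ?_
  rw [div_pow, div_pow, one_pow, hκ]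
  ring

end Coefficients

/-! ### The explicit formula for the reduced product -/

section ExplicitFormula

open Finset StarProduct

variable {n : ℕ} {κ μ : ℝ} {a b : SmoothAlg n}

theorem smoothFn_zz_inv : SmoothFn fun z : Coord n => (zz z : ℂ)⁻¹ :=
  represents_zz.smoothFn.inv fun _ hz => Complex.ofReal_ne_zero.2 (zz_pos hz).ne'

variable (n) in
/-- The function `1 / z z̄`. -/
def zzInvA : SmoothAlg n := smoothFn_zz_inv.toAlg

theorem zzInvA_mul_zzA : zzInvA n * zzA n = 1 :=
  ((smoothFn_zz_inv.represents.mul represents_zz).eqOn_iff Represents.one).1 fun _ hz =>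
    inv_mul_cancel₀ (Complex.ofReal_ne_zero.2 (zz_pos hz).ne')

theorem eulerDer_zzInvA : eulerDer n (zzInvA n) = -zzInvA n := by
  have h := congrArg (eulerDer n) (zzInvA_mul_zzA (n := n))
  rw [Derivation.leibniz, Derivation.map_one_eq_zero, eulerDer_zzA, smul_eq_mul, smul_eq_mul] at h
  linear_combination zzInvA n * h - (eulerDer n (zzInvA n) + zzInvA n) * zzInvA_mul_zzA

theorem eulerDer_zzInvA_pow_mul (ha : IsHomogeneous a) (k : ℕ) :
    eulerDer n (zzInvA n ^ k * a) = (-(k : ℂ)) • (zzInvA n ^ k * a) := by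
  induction k with
  | zero => simp [ha.1]
  | succ k ih =>
    rw [pow_succ', mul_assoc, Derivation.leibniz, ih, eulerDer_zzInvA, smul_eq_mul, smul_eq_mul,
      mul_smul_comm, Nat.cast_succ, mul_neg, mul_comm (zzInvA n ^ k * a)]
    module

theorem prolA_zzInvA (hμ : μ < 0) :
    prolA hμ (zzInvA n) = algebraMap ℂ _ (1 / (-2 * μ) : ℂ) := by
  refine ((smoothFn_zz_inv.represents.prol hμ).eqOn_iff (Represents.algebraMap _)).1
    fun z hz => ?_
  have hJ := (J_eq_zero_iff _ _).1 (proj_mem_surface hμ hz)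
  simp [prol, hJ]

theorem prolA_zzInvA_pow_mul (hμ : μ < 0) (ha : IsHomogeneous a) (k : ℕ) :
    prolA hμ (zzInvA n ^ k * a) = (1 / (-2 * μ) : ℂ) ^ k • a := by
  rw [map_mul, map_pow, prolA_zzInvA, ← map_pow, ← Algebra.smul_def, ha.prolA]

theorem zzInvA_sub_eq_mul_JA (hμ : μ ≠ 0) :
    zzInvA n - algebraMap ℂ _ (1 / (-2 * μ) : ℂ) =
      (2 * (1 / (-2 * μ)) : ℂ) • zzInvA n * JA n μ := by
  have hμ' : (μ : ℂ) ≠ 0 := Complex.ofReal_ne_zero.2 hμ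
  rw [JA, mul_sub, smul_mul_smul_comm, zzInvA_mul_zzA, mul_comm _ (algebraMap ℂ _ _),
    ← Algebra.smul_def, smul_smul, Algebra.algebraMap_eq_smul_one]
  match_scalars <;> field_simp

theorem zzInvA_pow_mul_eq (hμ : μ ≠ 0) (a : SmoothAlg n) (k : ℕ) :
    zzInvA n ^ k * a = (1 / (-2 * μ) : ℂ) ^ k • a +
      (∑ i ∈ range k, (2 * (1 / (-2 * μ) : ℂ) ^ (k - i)) • (zzInvA n ^ (i + 1) * a)) * JA n μ := by
  have hgeom := geom_sum₂_mul (zzInvA n) (algebraMap ℂ _ (1 / (-2 * μ) : ℂ)) k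
  rw [zzInvA_sub_eq_mul_JA hμ] at hgeom
  rw [← sub_eq_iff_eq_add', Algebra.smul_def, ← sub_mul, map_pow, ← hgeom, sum_mul, sum_mul,
    sum_mul]
  refine sum_congr rfl fun i hi => ?_
  rw [show k - i = k - 1 - i + 1 by have := mem_range.1 hi; omega]
  simp only [Algebra.smul_def, map_mul, map_pow]
  ring

theorem opKA_zzInvA_pow_mul (hμ : μ < 0) (ha : IsHomogeneous a) (k : ℕ) :
    opKA κ hμ (zzInvA n ^ k * a) = ∑ i ∈ range k,
      (-(κ * (i + 1) * (1 / (-2 * μ)) ^ (k - i)) : ℂ) • (zzInvA n ^ (i + 1) * a) := by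
  have hquot : (divisionByJ hμ).quot a = 0 := by
    rw [← ha.prolA hμ, ← divisionByJ_rem, DivisionBy.quot_rem]
  rw [opKA_apply, zzInvA_pow_mul_eq hμ.ne, map_add, map_smul, hquot, smul_zero, zero_add,
    DivisionBy.quot_mul, map_sum, smul_sum]
  refine sum_congr rfl fun i _ => ?_
  rw [Derivation.map_smul, eulerDer_zzInvA_pow_mul ha, smul_smul, smul_smul]
  congr 1
  push_cast
  ring

theorem prolA_opKA_pow_zzInvA_pow_mul (hμ : μ < 0) (ha : IsHomogeneous a) (k l : ℕ) :
    prolA hμ ((opKA κ hμ ^ l) (zzInvA n ^ k * a)) =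
      ((1 / (-2 * μ)) ^ (k + l) * κ ^ l * coeffA k l : ℂ) • a := by
  induction l generalizing k with
  | zero => simp [prolA_zzInvA_pow_mul hμ ha, coeffA_zero_right]
  | succ l ih =>
    rw [pow_succ, Module.End.mul_apply, opKA_zzInvA_pow_mul hμ ha, map_sum, map_sum]
    simp only [map_smul, ih, smul_smul]
    rw [← sum_smul, coeffA_succ_right]
    congr 1
    push_cast
    rw [mul_neg, mul_sum, ← sum_neg_distrib]
    refine sum_congr rfl fun i hi => ?_
    have hik : k + (l + 1) = (k - i) + (i + 1 + l) := by have := mem_range.1 hi; omega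
    rw [hik, pow_add]
    ring

variable (κ μ) in
/-- The bidifferential operators of the explicit product `starCP`. -/
def reducedOp (r : ℕ) (a b : SmoothAlg n) : SmoothAlg n :=
  ∑ p ∈ antidiagonal r, ((1 / (-2 * μ)) ^ r * κ ^ p.2 * coeffA p.1 p.2 : ℂ) •
    (zzA n ^ p.1 * (wickStar n κ).op p.1 a b)

theorem prolA_opKA_pow_wickStar_op (hμ : μ < 0) (ha : IsHomogeneous a) (hb : IsHomogeneous b)
    (r l : ℕ) : prolA hμ ((opKA κ hμ ^ l) ((wickStar n κ).op r a b)) =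
      ((1 / (-2 * μ)) ^ (r + l) * κ ^ l * coeffA r l : ℂ) •
        (zzA n ^ r * (wickStar n κ).op r a b) := by
  rw [← prolA_opKA_pow_zzInvA_pow_mul hμ (isHomogeneous_zzA_pow_mul_wickStar_op κ r ha hb),
    ← mul_assoc, ← mul_pow, zzInvA_mul_zzA, one_pow, one_mul]

theorem sum_antidiagonal_antidiagonal_snd {M : Type*} [AddCommMonoid M] (F : ℕ → ℕ → ℕ → M)
    (m : ℕ) : ∑ p ∈ antidiagonal m, ∑ q ∈ antidiagonal p.2, F p.1 q.1 q.2 =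
      ∑ p ∈ antidiagonal m, ∑ q ∈ antidiagonal p.1, F q.2 q.1 p.2 := by
  simp only [sum_sigma']
  refine sum_nbij' (fun ⟨(l, _), (r, k)⟩ => ⟨(l + r, k), (r, l)⟩)
    (fun ⟨(_, k), (r, l)⟩ => ⟨(l, r + k), (r, k)⟩) ?_ ?_ ?_ ?_ ?_
  all_goals
    rintro ⟨⟨a, b⟩, ⟨c, d⟩⟩ hx
    simp only [mem_sigma, HasAntidiagonal.mem_antidiagonal, and_true] at hx ⊢ <;> grind

theorem wickDivision_rem_mul_apply (hμ : μ < 0) {x y : (wickStar n κ).Series}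
    (hx : ∀ m, IsHomogeneous (x m)) (hy : ∀ m, IsHomogeneous (y m)) (m : ℕ) :
    (wickDivision κ hμ).rem (x * y) m =
      ∑ p ∈ antidiagonal m, ∑ q ∈ antidiagonal p.2, reducedOp κ μ p.1 (x q.1) (y q.2) := by
  calc (wickDivision κ hμ).rem (x * y) m
      = ∑ p ∈ antidiagonal m, ∑ r ∈ antidiagonal p.2, ∑ q ∈ antidiagonal r.2,
          ((1 / (-2 * μ)) ^ (r.1 + p.1) * κ ^ p.1 * coeffA r.1 p.1 : ℂ) •
            (zzA n ^ r.1 * (wickStar n κ).op r.1 (x q.1) (y q.2)) := by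
        simp only [← prolA_opKA_pow_wickStar_op hμ (hx _) (hy _), ← map_sum]
        rfl
    _ = ∑ p ∈ antidiagonal m, ∑ r ∈ antidiagonal p.1, ∑ q ∈ antidiagonal p.2,
          ((1 / (-2 * μ)) ^ (r.1 + r.2) * κ ^ r.2 * coeffA r.1 r.2 : ℂ) •
            (zzA n ^ r.1 * (wickStar n κ).op r.1 (x q.1) (y q.2)) :=
        sum_antidiagonal_antidiagonal_snd (fun l r k => ∑ q ∈ antidiagonal k,
          ((1 / (-2 * μ)) ^ (r + l) * κ ^ l * coeffA r l : ℂ) •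
            (zzA n ^ r * (wickStar n κ).op r (x q.1) (y q.2))) m
    _ = _ := by
        refine sum_congr rfl fun p _ => sum_comm.trans (sum_congr rfl fun q _ => ?_)
        exact sum_congr rfl fun r hr => by rw [HasAntidiagonal.mem_antidiagonal.1 hr]

end ExplicitFormula

/-! ### Series of functions and series over the algebra of smooth functions -/

section RepresentsSeries

open Finset StarProduct

variable {n : ℕ} {κ μ : ℝ} {f g : Series n} {x y : ℕ → SmoothAlg n}

/-- The series `f` of functions restricts to the series `x` over the algebra of smooth functions on
the phase space. -/
def RepresentsSeries (f : Series n) (x : ℕ → SmoothAlg n) : Prop := ∀ m, Represents (f m) (x m)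

theorem exists_representsSeries (κ : ℝ) (hf : f ∈ smoothSeries n) :
    ∃ x : (wickStar n κ).Series, RepresentsSeries f x :=
  ⟨fun m => (hf m).toAlg, fun m => (hf m).represents⟩

theorem exists_series_representsSeries (x : (wickStar n κ).Series) :
    ∃ f : Series n, RepresentsSeries f x := ⟨fun m => (x m).toFn, fun m => (x m).represents⟩

protected theorem Represents.constS {f : Fn n} {a : SmoothAlg n} (hf : Represents f a) (κ : ℝ) :
    RepresentsSeries (constS f) ((wickStar n κ).const a)
  | 0 => by rwa [const_zero_apply]
  | m + 1 => by
    rw [const_apply_of_ne m.succ_ne_zero]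
    exact .zero

protected theorem Represents.reducedOp {f g : Fn n} {a b : SmoothAlg n} (hf : Represents f a)
    (hg : Represents g b) (κ μ : ℝ) (r : ℕ) :
    Represents (fun z => ∑ p ∈ antidiagonal r, (1 / (-2 * (μ : ℂ))) ^ r * (κ : ℂ) ^ p.2 *
      (coeffA p.1 p.2 : ℂ) * (zz z : ℂ) ^ p.1 * wickM κ p.1 f g z) (reducedOp κ μ r a b) :=
  .sum fun p _ => (((represents_zz.pow p.1).mul (hf.wickM hg κ p.1)).const_mul _).congr
    fun _ _ => mul_assoc _ _ _

namespace RepresentsSeries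

theorem mem_smoothSeries (hf : RepresentsSeries f x) : f ∈ smoothSeries n :=
  fun m => (hf m).smoothFn

theorem sEq_iff (hf : RepresentsSeries f x) (hg : RepresentsSeries g y) : SEq f g ↔ x = y := by
  rw [funext_iff]
  exact forall_congr' fun m => (hf m).eqOn_iff (hg m)

theorem sub {x y : (wickStar n κ).Series} (hf : RepresentsSeries f x)
    (hg : RepresentsSeries g y) : RepresentsSeries (f - g) (x - y) := fun m => (hf m).sub (hg m)

protected theorem wick {x y : (wickStar n κ).Series} (hf : RepresentsSeries f x)
    (hg : RepresentsSeries g y) : RepresentsSeries (wick κ f g) (x * y) :=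
  fun m => .sum (s := antidiagonal m) fun p _ => .sum (s := antidiagonal p.2) fun q _ =>
    (hf q.1).wickM (hg q.2) κ p.1

protected theorem poissonS (hf : RepresentsSeries f x) (hg : RepresentsSeries g y) :
    RepresentsSeries (poissonS κ f g) fun m => ∑ p ∈ antidiagonal m, poissonA κ (x p.1) (y p.2) :=
  fun _ => .sum fun p _ => (hf p.1).poisson (hg p.2) κ

theorem ext_geometricSeries {K : Module.End ℂ (SmoothAlg n)} {D : ℕ → Fn n → Fn n}
    (hD : ∀ r {f a}, Represents f a → Represents (D r f) ((K ^ r) a))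
    (hf : RepresentsSeries f x) :
    RepresentsSeries (ext D f) (DivisionBy.geometricSeries K x) :=
  fun _ => .sum fun p _ => hD p.1 (hf p.2)

theorem ext_opT (hμ : μ < 0) (hf : RepresentsSeries f x) :
    RepresentsSeries (ext (opT κ μ) f) (DivisionBy.geometricSeries (opKA κ hμ) x) :=
  hf.ext_geometricSeries fun r _ _ h => h.opT κ hμ r

theorem prolS_ext_opT (hμ : μ < 0) (hf : RepresentsSeries f x) :
    RepresentsSeries (prolS μ (ext (opT κ μ) f)) ((wickDivision κ hμ).rem x) :=
  fun m => (hf.ext_opT hμ m).prol hμ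

theorem prolS_ext_opK_iterate (hμ : μ < 0) (hf : RepresentsSeries f x) :
    RepresentsSeries (prolS μ (ext (fun r => (opK κ μ)^[r]) f)) ((wickDivision κ hμ).rem x) :=
  fun m => (hf.ext_geometricSeries (fun r _ _ h => h.opK_iterate κ hμ r) m).prol hμ

protected theorem starCP {x y : (wickStar n κ).Series} (hμ : μ < 0)
    (hf : RepresentsSeries f x) (hg : RepresentsSeries g y)
    (hx : ∀ m, IsHomogeneous (x m)) (hy : ∀ m, IsHomogeneous (y m)) :
    RepresentsSeries (starCP κ μ f g) ((wickDivision κ hμ).rem (x * y)) := by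
  intro m
  rw [wickDivision_rem_mul_apply hμ hx hy]
  exact .sum (s := antidiagonal m) fun p _ => .sum (s := antidiagonal p.2) fun q _ =>
    (hf q.1).reducedOp (hg q.2) κ μ p.1

theorem mem_idealI_iff (hμ : μ < 0) (hf : RepresentsSeries f x) :
    f ∈ idealI n μ ↔ ∀ m, prolA hμ (x m) = 0 :=
  (and_iff_right hf.mem_smoothSeries).trans <|
    forall_congr' fun m => (prolA_eq_zero_iff hμ (hf m)).symm

theorem mem_spaceF_iff (hμ : μ < 0) (hf : RepresentsSeries f x) :
    f ∈ spaceF n μ ↔ ∀ m, prolA hμ (x m) = x m :=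
  (and_iff_right hf.mem_smoothSeries).trans <|
    forall_congr' fun m => ((hf m).eqOn_iff ((hf m).prol hμ)).trans eq_comm

theorem mem_homog_iff (hf : RepresentsSeries f x) : f ∈ homog n ↔ ∀ m, IsHomogeneous (x m) :=
  (and_iff_right hf.mem_smoothSeries).trans <| forall_congr' fun m => (hf m).comp_smul_iff

theorem mem_invU1_iff (hf : RepresentsSeries f x) :
    f ∈ invU1 n ↔ ∀ m, rotationDer n (x m) = 0 :=
  (and_iff_right hf.mem_smoothSeries).trans <| forall_congr' fun m =>
    (hf m).comp_exp_I_smul_iff.trans sub_eq_zero.symm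

theorem mem_starI_iff {x : (wickStar n κ).Series} (hf : RepresentsSeries f x) :
    f ∈ starI n κ μ ↔ ∃ y : (wickStar n κ).Series, x = y * (wickStar n κ).const (JA n μ) := by
  refine (and_iff_right hf.mem_smoothSeries).trans ⟨?_, ?_⟩
  · rintro ⟨g, hg, hfg⟩
    obtain ⟨y, hy⟩ := exists_representsSeries κ hg
    exact ⟨y, (hf.sEq_iff (hy.wick ((represents_J μ).constS κ))).1 hfg⟩
  · rintro ⟨y, hxy⟩
    obtain ⟨g, hg⟩ := exists_series_representsSeries y
    exact ⟨g, hg.mem_smoothSeries, (hf.sEq_iff (hg.wick ((represents_J μ).constS κ))).2 hxy⟩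

end RepresentsSeries

theorem exists_representsSeries_of_mem_homog (κ : ℝ) (hf : f ∈ homog n) :
    ∃ x : (wickStar n κ).Series, RepresentsSeries f x ∧ ∀ m, IsHomogeneous (x m) := by
  obtain ⟨x, hx⟩ := exists_representsSeries κ hf.1
  exact ⟨x, hx, hx.mem_homog_iff.1 hf⟩

theorem constS_J_mem_idealI (μ : ℝ) : constS (J (n := n) μ) ∈ idealI n μ :=
  ⟨((represents_J μ).constS 0).mem_smoothSeries, fun
    | 0, _, hz => hz
    | _ + 1, _, _ => rfl⟩

theorem constS_J_mem_starI (κ μ : ℝ) : constS (J (n := n) μ) ∈ starI n κ μ :=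
  ((represents_J μ).constS κ).mem_starI_iff.2 ⟨1, (one_mul _).symm⟩

theorem sum_poissonA_const_JA (x : ℕ → SmoothAlg n) (m : ℕ) :
    ∑ p ∈ antidiagonal m, poissonA κ (x p.1) ((wickStar n κ).const (JA n μ) p.2) =
      poissonA κ (x m) (JA n μ) := by
  rw [sum_eq_single (m, 0) ?_ (by simp), const_zero_apply]
  rintro ⟨i, j⟩ hij hne
  have hj : j ≠ 0 := by rintro rfl; simp_all
  rw [const_apply_of_ne hj, poissonA_zero_right]

theorem algB_inter_spaceF (hκ : κ ≠ 0) (hμ : μ < 0) : algB n κ μ ∩ spaceF n μ = homog n := by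
  ext f
  constructor
  · rintro ⟨⟨hf, hB⟩, hF⟩
    obtain ⟨x, hx⟩ := exists_representsSeries κ hf
    have hJ := ((hx.poissonS ((represents_J μ).constS κ)).mem_idealI_iff hμ).1
      (hB _ (constS_J_mem_idealI μ))
    exact hx.mem_homog_iff.2 fun m =>
      isHomogeneous_of_prolA_poissonA_JA hκ hμ ((hx.mem_spaceF_iff hμ).1 hF m)
        ((congrArg _ (sum_poissonA_const_JA x m)).symm.trans (hJ m))
  · intro hf
    obtain ⟨x, hx, hhom⟩ := exists_representsSeries_of_mem_homog κ hf
    refine ⟨⟨hf.1, fun g hg => ?_⟩, (hx.mem_spaceF_iff hμ).2 fun m => (hhom m).prolA hμ⟩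
    obtain ⟨y, hy⟩ := exists_representsSeries κ hg.1
    refine ((hx.poissonS hy).mem_idealI_iff hμ).2 fun m => ?_
    rw [map_sum]
    exact sum_eq_zero fun p _ =>
      prolA_poissonA_eq_zero hμ (hhom _) ((hy.mem_idealI_iff hμ).1 hg _)

theorem starB_inter_spaceF (hκ : κ ≠ 0) (hμ : μ < 0) : starB n κ μ ∩ spaceF n μ = homog n := by
  ext f
  constructor
  · rintro ⟨⟨hf, hB⟩, hF⟩
    obtain ⟨x, hx⟩ := exists_representsSeries κ hf
    have hprol := (hx.mem_spaceF_iff hμ).1 hF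
    have hJ := (represents_J (n := n) μ).constS κ
    obtain ⟨y, hy⟩ := ((hx.wick hJ).sub (hJ.wick hx)).mem_starI_iff.1
      (hB _ (constS_J_mem_starI κ μ))
    refine hx.mem_homog_iff.2 fun m => isHomogeneous_iff_eq_and_add_eq_zero.2
      ⟨sub_eq_zero.1 ?_, (prolA_eq_self_iff hμ).1 (hprol m)⟩
    exact rotationDer_eq_zero_of_commutator_mem hκ hμ hprol hy m
  · intro hf
    obtain ⟨x, hx, hhom⟩ := exists_representsSeries_of_mem_homog κ hf
    refine ⟨⟨hf.1, fun g hg => ?_⟩, (hx.mem_spaceF_iff hμ).2 fun m => (hhom m).prolA hμ⟩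
    obtain ⟨y, hy⟩ := exists_representsSeries κ hg.1
    obtain ⟨y', rfl⟩ := hy.mem_starI_iff.1 hg
    have hcomm := commute_const_JA (μ := μ) fun m => (hhom m).rotationDer
    refine ((hx.wick hy).sub (hy.wick hx)).mem_starI_iff.2 ⟨x * y' - y' * x, ?_⟩
    rw [sub_mul, mul_assoc, mul_assoc, mul_assoc, hcomm.eq]

end RepresentsSeries

/-! ### Local sections of the flow and the operator `S` -/

section OperatorS

open Complex Set StarProduct

variable {n : ℕ} {κ μ : ℝ}

theorem ofReal_mul_mem_slitPlane_iff {r : ℝ} (hr : 0 < r) {w : ℂ} :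
    (r : ℂ) * w ∈ slitPlane ↔ w ∈ slitPlane := by
  simp only [mem_slitPlane_iff, re_ofReal_mul, im_ofReal_mul, mul_pos_iff_of_pos_left hr, ne_eq,
    mul_eq_zero, hr.ne', false_or]

theorem norm_mul_exp_mem_slitPlane {w : ℂ} (hw : w ∈ slitPlane) {θ : ℝ} (hθ : θ ∈ uIcc 0 (arg w)) :
    ‖w‖ * exp (I * θ) ∈ slitPlane := by
  have harg : arg w ∈ Ioo (-Real.pi) Real.pi :=
    ⟨neg_pi_lt_arg w, (arg_le_pi w).lt_of_ne (mem_slitPlane_iff_arg.1 hw).1⟩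
  have hmem : θ ∈ Ioo (-Real.pi) Real.pi :=
    ordConnected_Ioo.uIcc_subset ⟨neg_lt_zero.2 Real.pi_pos, Real.pi_pos⟩ harg hθ
  rw [ofReal_mul_mem_slitPlane_iff (norm_pos_iff.2 (slitPlane_ne_zero hw)), mem_slitPlane_iff_arg,
    mul_comm, exp_mul_I, arg_cos_add_sin_mul_I (Ioo_subset_Ioc_self hmem), ← exp_mul_I]
  exact ⟨hmem.2.ne, exp_ne_zero _⟩

theorem contDiffOn_arg : ContDiffOn ℝ ∞ arg slitPlane := by
  rw [show arg = fun w => (log w).im from funext fun w => (log_im w).symm]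
  exact fun _ hw => (imCLM.contDiff.contDiffAt.comp _
    ((contDiffAt_log hw).restrict_scalars ℝ)).contDiffWithinAt

theorem contDiffOn_norm_div : ContDiffOn ℝ ∞ (fun w : ℂ => ‖w‖ / w) slitPlane := by
  have hne (w : ℂ) (hw : w ∈ slitPlane) : w ≠ 0 := slitPlane_ne_zero hw
  simp only [div_eq_mul_inv]
  exact (ofRealCLM.contDiff.comp_contDiffOn (contDiffOn_id.norm ℝ hne)).mul (contDiffOn_id.inv hne)

theorem map_norm_div_smul (ℓ : Coord n →L[ℂ] ℂ) (z : Coord n) :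
    ℓ ((‖ℓ z‖ / ℓ z : ℂ) • z) = ‖ℓ z‖ := by
  rw [map_smul, smul_eq_mul, div_mul_cancel_of_imp fun h => by simp [h]]

theorem norm_exp_I_mul_mul (θ : ℝ) (w : ℂ) : ‖exp (I * θ) * w‖ = ‖w‖ := by
  rw [norm_mul, norm_exp_I_mul_ofReal, one_mul]

/-- The part of the constraint surface on which a given linear functional is positive, as a section
of the flow of `J`. It is transversal because the flow rotates the values of the functional. -/
def FlowSection.ofLinear (hκ : κ ≠ 0) (hμ : μ < 0) (ℓ : Coord n →L[ℂ] ℂ) : FlowSection n κ μ where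
  dom := ℓ ⁻¹' slitPlane
  base z := (‖ℓ z‖ / ℓ z : ℂ) • z
  time z := 2 / κ * arg (ℓ z)
  isOpen_dom := isOpen_slitPlane.preimage ℓ.continuous
  dom_subset z hz h0 := slitPlane_ne_zero hz (by rw [h0, map_zero])
  radial z hz := by
    rw [mem_preimage, proj, map_smul, smul_eq_mul,
      ofReal_mul_mem_slitPlane_iff (Real.sqrt_pos.2 (ratio_pos hμ hz)), mem_preimage]
  smooth_base := (contDiffOn_norm_div.comp (ℓ.restrictScalars ℝ).contDiff.contDiffOn
    (mapsTo_preimage _ _)).smul contDiffOn_id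
  smooth_time := contDiffOn_const.mul (contDiffOn_arg.comp
    (ℓ.restrictScalars ℝ).contDiff.contDiffOn (mapsTo_preimage _ _))
  base_mem z hz := by
    have hne := norm_ne_zero_iff.2 (slitPlane_ne_zero hz.1)
    refine ⟨?_, (J_eq_zero_iff _ _).2 ?_⟩
    · rw [mem_preimage, map_norm_div_smul]
      exact ofReal_mem_slitPlane.2 (norm_pos_iff.2 (slitPlane_ne_zero hz.1))
    · rw [zz_smul, (J_eq_zero_iff _ _).1 hz.2, normSq_eq_norm_sq, norm_div, norm_real, norm_norm,
        div_self hne, one_pow, one_mul]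
  time_base z _ := by
    rw [map_norm_div_smul, arg_ofReal_of_nonneg (norm_nonneg _), mul_zero]
  flow_time z hz := by
    have hne := slitPlane_ne_zero hz.1
    rw [flow, ← mul_assoc, div_mul_div_cancel₀ two_ne_zero, div_self hκ, one_mul, smul_smul,
      ← mul_div_assoc, mul_comm (exp _), mul_comm I, norm_mul_exp_arg_mul_I, div_self hne, one_smul]
  path_mem z hz s hs := by
    rw [mem_preimage, flow, map_smul, map_norm_div_smul, smul_eq_mul, mul_comm]
    refine norm_mul_exp_mem_slitPlane hz.1 ?_
    have hmem := mem_image_of_mem (κ / 2 * ·) hs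
    rwa [image_const_mul_uIcc, mul_zero, ← mul_assoc, div_mul_div_cancel₀ two_ne_zero,
      div_self hκ, one_mul] at hmem
  base_flow z _ s _ := by
    rw [flow, map_smul, smul_eq_mul, norm_exp_I_mul_mul, smul_smul, div_mul_eq_mul_div,
      mul_comm _ (exp _), mul_div_mul_left _ _ (exp_ne_zero _)]

theorem FlowSection.exists_mem_dom (hκ : κ ≠ 0) (hμ : μ < 0) {z : Coord n} (hz : z ∈ phase n) :
    ∃ σ : FlowSection n κ μ, z ∈ σ.dom := by
  obtain ⟨j, hj⟩ := Function.ne_iff.1 hz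
  refine ⟨.ofLinear hκ hμ (starRingEnd ℂ (z j) • ContinuousLinearMap.proj j), ?_⟩
  change starRingEnd ℂ (z j) * z j ∈ slitPlane
  rw [← normSq_eq_conj_mul_self]
  exact ofReal_mem_slitPlane.2 (normSq_pos.2 hj)

theorem FlowSection.flow_base_mem_phase (σ : FlowSection n κ μ) (hμ : μ < 0) {z : Coord n}
    (hz : z ∈ σ.dom) {t : ℝ} (ht : t ∈ uIcc 0 (σ.time (proj μ z))) :
    flow κ t (σ.base (proj μ z)) ∈ phase n := by
  have hz' := σ.dom_subset hz
  exact σ.dom_subset (σ.path_mem _ ⟨(σ.radial z hz').2 hz, proj_mem_surface hμ hz'⟩ t ht)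

theorem wickStar_op_JA_comm {a : SmoothAlg n} (ha : rotationDer n a = 0) {k : ℕ} (hk : 1 ≤ k) :
    (wickStar n κ).op k (JA n μ) a = (wickStar n κ).op k a (JA n μ) := by
  rcases hk.eq_or_lt with rfl | hk
  · rw [rotationDer_apply, sub_eq_zero] at ha
    rw [wickStar_op_one_JA_left, wickStar_op_one_JA_right, ha]
  · rw [wickStar_op_JA_left κ μ k hk, wickStar_op_JA_right κ μ k hk]

theorem exprF_eqOn_zero (hμ : μ < 0) (m : ℕ) {s : ℕ → Fn n} {x : ℕ → SmoothAlg n}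
    (hs : ∀ j, j + 2 ≤ m → Represents (s j) (x j)) (hx : ∀ j, rotationDer n (x j) = 0) :
    EqOn (exprF κ μ m s) 0 (phase n) := by
  have hanti (k j : ℕ) (hk : 1 ≤ k) (hj : j + 2 ≤ m) :
      Represents (wickAnti κ k (J μ) (s j)) (0 : SmoothAlg n) := by
    have h := (represents_J μ).wickAnti (hs j hj) κ k
    rwa [wickStar_op_JA_comm (hx j) hk, sub_self] at h
  intro z hz
  rw [exprF, Finset.sum_eq_zero, Finset.sum_eq_zero, add_zero, Pi.zero_apply]
  · refine fun i hi => Finset.sum_eq_zero fun k hk => ?_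
    rw [Finset.mem_Icc] at hi hk
    have h := (hanti k (m - k - i) hk.1 (by omega)).opT κ hμ i
    rw [map_zero] at h
    exact h ⟨z, hz⟩
  · intro k hk
    rw [Finset.mem_Icc] at hk
    exact hanti k (m - k) (by omega) (by omega) ⟨z, hz⟩

theorem integral_exprF_eq_zero (hμ : μ < 0) (σ : FlowSection n κ μ) (m : ℕ) {s : ℕ → Fn n}
    {x : ℕ → SmoothAlg n} (hs : ∀ j, j + 2 ≤ m → Represents (s j) (x j))
    (hx : ∀ j, rotationDer n (x j) = 0) {z : Coord n} (hz : z ∈ σ.dom) :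
    ∫ t in (0 : ℝ)..(σ.time (proj μ z)), exprF κ μ m s (flow κ t (σ.base (proj μ z))) = 0 := by
  rw [intervalIntegral.integral_congr fun t ht =>
    exprF_eqOn_zero hμ m hs hx (σ.flow_base_mem_phase hμ hz ht)]
  exact intervalIntegral.integral_zero

theorem rotationDer_const {a : SmoothAlg n} (ha : rotationDer n a = 0) (m : ℕ) :
    rotationDer n ((wickStar n κ).const a m) = 0 := by
  rcases eq_or_ne m 0 with rfl | hm
  · rwa [const_zero_apply]
  · rw [const_apply_of_ne hm, map_zero]

theorem exists_represents_of_constS_mem (hκ : κ ≠ 0) (hμ : μ < 0) {f : Fn n}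
    (hf : constS f ∈ algB n κ μ ∩ spaceF n μ) :
    ∃ a : SmoothAlg n, Represents f a ∧ rotationDer n a = 0 := by
  rw [algB_inter_spaceF hκ hμ] at hf
  obtain ⟨x, hx, hhom⟩ := exists_representsSeries_of_mem_homog κ hf
  exact ⟨x 0, hx 0, (hhom 0).rotationDer⟩

theorem isOpS_constS (hκ : κ ≠ 0) (hμ : μ < 0) :
    IsOpS (n := n) κ μ fun m f => constS f m := by
  intro f hf z hz
  obtain ⟨a, ha, hrot⟩ := exists_represents_of_constS_mem hκ hμ hf
  obtain ⟨σ, hσ⟩ := FlowSection.exists_mem_dom hκ hμ hz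
  refine ⟨σ, hσ, fun _ _ => rfl, fun m hm w hw => ?_⟩
  rw [integral_exprF_eq_zero hμ σ (m + 1) (fun j _ => ha.constS κ j) (rotationDer_const hrot) hw,
    mul_zero]
  cases m with
  | zero => exact absurd hm (by decide)
  | succ m => rfl

theorem IsOpS.represents {S : ℕ → Fn n → Fn n} (hS : IsOpS κ μ S) (hκ : κ ≠ 0) (hμ : μ < 0)
    {f : Fn n} (hf : constS f ∈ algB n κ μ ∩ spaceF n μ) {a : SmoothAlg n} (ha : Represents f a) :
    RepresentsSeries (fun m => S m f) ((wickStar n κ).const a) := by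
  have hrot : rotationDer n a = 0 := by
    obtain ⟨b, hb, hrot⟩ := exists_represents_of_constS_mem hκ hμ hf
    rwa [ha.unique hb]
  intro m
  induction m using Nat.strong_induction_on with
  | _ m ih =>
    intro z
    obtain ⟨σ, hσ, h0, hS⟩ := hS f hf z z.2
    rcases Nat.eq_zero_or_pos m with rfl | hm
    · rw [const_zero_apply, ← ha z]
      exact h0 z hσ
    · rw [const_apply_of_ne hm.ne', hS m hm z hσ, integral_exprF_eq_zero hμ σ (m + 1)
        (fun j hj => ih j (by omega)) (rotationDer_const hrot) hσ, mul_zero]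
      rfl

theorem constS_mem_homog {f : Series n} (hf : f ∈ homog n) (m : ℕ) : constS (f m) ∈ homog n :=
  ⟨fun
    | 0 => hf.1 m
    | _ + 1 => contDiffOn_const, fun
    | 0 => hf.2 m
    | _ + 1 => fun _ _ _ _ => rfl⟩

theorem IsOpS.representsSeries_ext {S : ℕ → Fn n → Fn n} (hS : IsOpS κ μ S) (hκ : κ ≠ 0)
    (hμ : μ < 0) {f : Series n} (hf : f ∈ homog n) {x : (wickStar n κ).Series}
    (hx : RepresentsSeries f x) : RepresentsSeries (ext S f) x := by
  intro m
  have hsum : ∑ p ∈ Finset.HasAntidiagonal.antidiagonal m,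
      (wickStar n κ).const (x p.2) p.1 = x m := by
    refine (Finset.sum_eq_single (0, m) ?_ (by simp)).trans (const_zero_apply _)
    rintro ⟨i, j⟩ hij hne
    exact const_apply_of_ne (by rintro rfl; simp_all) _
  rw [← hsum]
  exact .sum (s := Finset.HasAntidiagonal.antidiagonal m) fun p _ => hS.represents hκ hμ
    (algB_inter_spaceF hκ hμ ▸ constS_mem_homog hf p.2) (hx p.2) p.1

end OperatorS

/-! ### The Hamiltonian flow of `J` and the operator `T` -/

section FlowAndT

open Complex Set StarProduct

variable {n : ℕ} {κ μ : ℝ} {f : Fn n}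

theorem flow_zero (κ : ℝ) (z : Coord n) : flow κ 0 z = z := by simp [flow]

theorem hasDerivAt_comp_flow (κ μ : ℝ) (hf : SmoothFn f) {z : Coord n} (hz : z ∈ phase n) (t : ℝ) :
    HasDerivAt (fun s => f (flow κ s z)) (poisson κ f (J μ) (flow κ t z)) t := by
  have hflow (s : ℝ) : flow κ s z = exp (s * (κ / 2 * I)) • z := by
    rw [flow]
    push_cast
    ring_nf
  have hmem : exp (t * (κ / 2 * I)) • z ∈ phase n := smul_mem_phase (exp_ne_zero _) hz
  have hpoisson := hf.represents.poisson (represents_J μ) κ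
  rw [poissonA_JA] at hpoisson
  have hEuler := (hf.represents.euler.sub hf.represents.eulerBar).const_mul (κ / 2 * I)
  simp only [hflow, (hpoisson.eqOn_iff hEuler).2 rfl hmem]
  convert hasDerivAt_comp_exp_smul hf (κ / 2 * I) hz t using 1
  simp only [map_mul, map_div₀, conj_ofReal, conj_I, map_ofNat]
  ring

theorem SmoothFn.eq_prol_add_compJ_mul_J (hμ : μ < 0) (hf : SmoothFn f) {z : Coord n}
    (hz : z ∈ phase n) : f z = prol μ f z + compJ μ f z * J μ z :=
  ((hf.represents.eqOn_iff ((hf.represents.prol hμ).add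
    ((hf.represents.compJ hμ).mul (represents_J μ)))).2
      ((divisionByJ hμ).rem_add_quot_mul _).symm) hz

theorem SmoothFn.eqOn_compJ (hμ : μ < 0) (hf : SmoothFn f) {h : Fn n} (hh : SmoothFn h)
    (heq : ∀ z ∈ phase n, f z = prol μ f z + h z * J μ z) : EqOn h (compJ μ f) (phase n) :=
  hf.represents.eqOn_compJ hμ hh.represents <| (hf.represents.eqOn_iff
    ((hf.represents.prol hμ).add (hh.represents.mul (represents_J μ)))).1 heq

theorem opT_eqOn_opK_iterate (κ : ℝ) (hμ : μ < 0) (hf : SmoothFn f) (r : ℕ) :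
    EqOn (opT κ μ r f) ((opK κ μ)^[r] f) (phase n) :=
  ((hf.represents.opT κ hμ r).eqOn_iff (hf.represents.opK_iterate κ hμ r)).2 rfl

theorem RepresentsSeries.oneSubLambdaK (hμ : μ < 0) {f : Series n} {x y : ℕ → SmoothAlg n}
    (hf : RepresentsSeries f x) (h0 : y 0 = x 0)
    (h : ∀ m, y (m + 1) = x (m + 1) - opKA κ hμ (x m)) :
    RepresentsSeries (oneSubLambdaK κ μ f) y
  | 0 => h0 ▸ hf 0
  | m + 1 => h m ▸ (hf (m + 1)).sub ((hf m).opK κ hμ)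

theorem oneSubLambdaK_ext_opT (κ : ℝ) (hμ : μ < 0) {f : Series n} (hf : f ∈ smoothSeries n) :
    SEq (oneSubLambdaK κ μ (ext (opT κ μ) f)) f := by
  obtain ⟨x, hx⟩ := exists_representsSeries κ hf
  exact (((hx.ext_opT hμ).oneSubLambdaK hμ (DivisionBy.geometricSeries_apply_zero _ _).symm
    fun m => eq_sub_of_add_eq (DivisionBy.geometricSeries_apply_succ _ _ m).symm).sEq_iff hx).2 rfl

theorem ext_opT_oneSubLambdaK (κ : ℝ) (hμ : μ < 0) {f : Series n} (hf : f ∈ smoothSeries n) :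
    SEq (ext (opT κ μ) (oneSubLambdaK κ μ f)) f := by
  obtain ⟨x, hx⟩ := exists_representsSeries κ hf
  let y : ℕ → SmoothAlg n
    | 0 => x 0
    | m + 1 => x (m + 1) - opKA κ hμ (x m)
  have hy : RepresentsSeries (oneSubLambdaK κ μ f) y :=
    hx.oneSubLambdaK hμ rfl fun _ => rfl
  exact ((hy.ext_opT hμ).sEq_iff hx).2 (DivisionBy.geometricSeries_eq_of_succ rfl fun _ => rfl)

end FlowAndT

/-! ### The reduced product -/

section ReducedProduct

open Finset StarProduct

variable {n : ℕ} {κ μ : ℝ} {f g h : Series n}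

theorem isHomogeneous_wickDivision_rem_mul (hμ : μ < 0) {x y : (wickStar n κ).Series}
    (hx : ∀ m, IsHomogeneous (x m)) (hy : ∀ m, IsHomogeneous (y m)) (m : ℕ) :
    IsHomogeneous ((wickDivision κ hμ).rem (x * y) m) :=
  isHomogeneous_wickDivision_rem hμ
    (rotationDer_mul (fun m => (hx m).rotationDer) fun m => (hy m).rotationDer) m

theorem starCP_mem_homog (κ : ℝ) (hμ : μ < 0) (hf : f ∈ homog n) (hg : g ∈ homog n) :
    starCP κ μ f g ∈ homog n := by
  obtain ⟨x, hx, hx'⟩ := exists_representsSeries_of_mem_homog κ hf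
  obtain ⟨y, hy, hy'⟩ := exists_representsSeries_of_mem_homog κ hg
  exact (hx.starCP hμ hy hx' hy').mem_homog_iff.2 (isHomogeneous_wickDivision_rem_mul hμ hx' hy')

theorem starCP_sEq_prolS (κ : ℝ) (hμ : μ < 0) (hf : f ∈ homog n) (hg : g ∈ homog n) :
    SEq (starCP κ μ f g) (prolS μ (ext (fun r => (opK κ μ)^[r]) (wick κ f g))) := by
  obtain ⟨x, hx, hx'⟩ := exists_representsSeries_of_mem_homog κ hf
  obtain ⟨y, hy, hy'⟩ := exists_representsSeries_of_mem_homog κ hg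
  exact ((hx.starCP hμ hy hx' hy').sEq_iff ((hx.wick hy).prolS_ext_opK_iterate hμ)).2 rfl

theorem IsOpS.ext_sEq {S : ℕ → Fn n → Fn n} (hS : IsOpS κ μ S) (hκ : κ ≠ 0) (hμ : μ < 0)
    (hf : f ∈ homog n) : SEq (ext S f) f := by
  obtain ⟨x, hx⟩ := exists_representsSeries κ hf.1
  exact ((hS.representsSeries_ext hκ hμ hf hx).sEq_iff hx).2 rfl

theorem isReducedProduct_iff (hκ : κ ≠ 0) (hμ : μ < 0) {S : ℕ → Fn n → Fn n}
    (hS : IsOpS κ μ S) (hf : f ∈ homog n) (hg : g ∈ homog n) :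
    IsReducedProduct κ μ S f g h ↔ h ∈ homog n ∧ SEq h (starCP κ μ f g) := by
  rw [IsReducedProduct, algB_inter_spaceF hκ hμ]
  refine and_congr_right fun hh => ?_
  obtain ⟨x, hx, hx'⟩ := exists_representsSeries_of_mem_homog κ hf
  obtain ⟨y, hy, hy'⟩ := exists_representsSeries_of_mem_homog κ hg
  obtain ⟨w, hw⟩ := exists_representsSeries κ hh.1
  have hSx := hS.representsSeries_ext hκ hμ hf hx
  have hSy := hS.representsSeries_ext hκ hμ hg hy
  rw [(hS.representsSeries_ext hκ hμ hh hw).sEq_iff ((hSx.wick hSy).prolS_ext_opT hμ),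
    hw.sEq_iff (hx.starCP hμ hy hx' hy')]

theorem isMarsdenWeinsteinProduct_iff (hμ : μ < 0) (hf : f ∈ homog n) (hg : g ∈ homog n) :
    IsMarsdenWeinsteinProduct κ μ f g h ↔ h ∈ homog n ∧ SEq h (starCP κ μ f g) := by
  refine and_congr_right fun hh => ?_
  obtain ⟨x, hx, hx'⟩ := exists_representsSeries_of_mem_homog κ hf
  obtain ⟨y, hy, hy'⟩ := exists_representsSeries_of_mem_homog κ hg
  obtain ⟨w, hw, hw'⟩ := exists_representsSeries_of_mem_homog κ hh
  have hJ := (represents_J (n := n) μ).constS κ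
  have hdiff := (hx.wick hy).sub hw
  rw [hw.sEq_iff (hx.starCP hμ hy hx' hy')]
  constructor
  · rintro ⟨a, ha, heq⟩
    obtain ⟨u, hu⟩ := exists_representsSeries κ ha.1
    have hxy : x * y = w + u * (wickStar n κ).const (JA n μ) :=
      eq_add_of_sub_eq' ((hdiff.sEq_iff (hu.wick hJ)).1 heq)
    rw [hxy, (wickDivision κ hμ).rem_add_mul,
      wickDivision_rem_eq_self hμ fun m => (hw' m).prolA hμ]
  · rintro rfl
    obtain ⟨a, ha⟩ := exists_series_representsSeries ((wickDivision κ hμ).quot (x * y))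
    refine ⟨a, ha.mem_invU1_iff.2 (rotationDer_wickDivision_quot hμ
      (rotationDer_mul (fun m => (hx' m).rotationDer) fun m => (hy' m).rotationDer)), ?_⟩
    exact (hdiff.sEq_iff (ha.wick hJ)).2
      (sub_eq_of_eq_add' ((wickDivision κ hμ).rem_add_quot_mul _).symm)

end ReducedProduct

/-! ### The star product on complex projective space -/

section StarProductCP

open Finset StarProduct

variable {n : ℕ} {κ μ : ℝ} {f g h : Series n}

theorem representsSeries_constS_one (n : ℕ) (κ : ℝ) :
    RepresentsSeries (constS 1) (1 : (wickStar n κ).Series) := Represents.one.constS κ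

theorem constS_one_mem_homog (n : ℕ) : constS 1 ∈ homog n :=
  ⟨(representsSeries_constS_one n 0).mem_smoothSeries, fun
    | 0, _, _, _, _ => rfl
    | _ + 1, _, _, _, _ => rfl⟩

theorem starCP_assoc (κ : ℝ) (hμ : μ < 0) (hf : f ∈ homog n) (hg : g ∈ homog n)
    (hh : h ∈ homog n) : SEq (starCP κ μ (starCP κ μ f g) h) (starCP κ μ f (starCP κ μ g h)) := by
  obtain ⟨x, hx, hx'⟩ := exists_representsSeries_of_mem_homog κ hf
  obtain ⟨y, hy, hy'⟩ := exists_representsSeries_of_mem_homog κ hg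
  obtain ⟨w, hw, hw'⟩ := exists_representsSeries_of_mem_homog κ hh
  have hl := (hx.starCP hμ hy hx' hy').starCP hμ hw
    (isHomogeneous_wickDivision_rem_mul hμ hx' hy') hw'
  have hr := hx.starCP hμ (hy.starCP hμ hw hy' hw') hx'
    (isHomogeneous_wickDivision_rem_mul hμ hy' hw')
  exact (hl.sEq_iff hr).2 ((wickDivision κ hμ).rem_rem_mul_assoc x y
    (commute_const_JA fun m => (hw' m).rotationDer))

theorem starCP_mul_one (κ : ℝ) (hμ : μ < 0) (hf : f ∈ homog n) :
    SEq (starCP κ μ f (constS 1)) f := by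
  obtain ⟨x, hx, hx'⟩ := exists_representsSeries_of_mem_homog κ hf
  have h1 := representsSeries_constS_one n κ
  refine ((hx.starCP hμ h1 hx' (h1.mem_homog_iff.1 (constS_one_mem_homog n))).sEq_iff hx).2 ?_
  rw [mul_one, wickDivision_rem_eq_self hμ fun m => (hx' m).prolA hμ]

theorem starCP_one_mul (κ : ℝ) (hμ : μ < 0) (hf : f ∈ homog n) :
    SEq (starCP κ μ (constS 1) f) f := by
  obtain ⟨x, hx, hx'⟩ := exists_representsSeries_of_mem_homog κ hf
  have h1 := representsSeries_constS_one n κ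
  refine ((h1.starCP hμ hx (h1.mem_homog_iff.1 (constS_one_mem_homog n)) hx').sEq_iff hx).2 ?_
  rw [one_mul, wickDivision_rem_eq_self hμ fun m => (hx' m).prolA hμ]

theorem starCP_apply_zero (κ μ : ℝ) (f g : Series n) (z : Coord n) :
    starCP κ μ f g 0 z = f 0 z * g 0 z := by
  simp [starCP, ext₂, wickM, contraction, dzIter, dzbarIter, coeffA, nestedSum]

theorem wickDivision_rem_mul_apply_one_sub (hμ : μ < 0) (x y : (wickStar n κ).Series) :
    (wickDivision κ hμ).rem (x * y) 1 - (wickDivision κ hμ).rem (y * x) 1 =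
      prolA hμ (Complex.I • poissonA κ (x 0) (y 0)) := by
  have h0 : (x * y) 0 = (y * x) 0 := by simp [Series.mul_apply, op_zero, mul_comm]
  have h1 : (x * y) 1 - (y * x) 1 =
      (wickStar n κ).op 1 (x 0) (y 0) - (wickStar n κ).op 1 (y 0) (x 0) := by
    simp only [Series.mul_apply, Nat.sum_antidiagonal_succ, Nat.antidiagonal_zero, sum_singleton,
      op_zero, zero_add]
    ring
  have hgeom (u : (wickStar n κ).Series) :
      DivisionBy.geometricSeries (opKA κ hμ) u 1 = u 1 + opKA κ hμ (u 0) :=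
    (DivisionBy.geometricSeries_apply_succ _ _ 0).trans
      (congrArg (u 1 + opKA κ hμ ·) (DivisionBy.geometricSeries_apply_zero _ _))
  rw [wickDivision_rem_apply, wickDivision_rem_apply, ← map_sub, hgeom, hgeom, h0,
    add_sub_add_right_eq_sub, h1, wickStar_op_one_sub_swap]

theorem starCP_apply_one_sub (κ : ℝ) (hμ : μ < 0) (hf : f ∈ homog n) (hg : g ∈ homog n)
    {z : Coord n} (hz : z ∈ phase n) : starCP κ μ f g 1 z - starCP κ μ g f 1 z =
      Complex.I * prol μ (poisson κ (f 0) (g 0)) z := by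
  obtain ⟨x, hx, hx'⟩ := exists_representsSeries_of_mem_homog κ hf
  obtain ⟨y, hy, hy'⟩ := exists_representsSeries_of_mem_homog κ hg
  have hl := (hx.starCP hμ hy hx' hy' 1).sub (hy.starCP hμ hx hy' hx' 1)
  have hr := (((hx 0).poisson (hy 0) κ).prol hμ).const_mul Complex.I
  rw [wickDivision_rem_mul_apply_one_sub, map_smul] at hl
  exact (hl.eqOn_iff hr).2 rfl hz

theorem starCP_eqOn_zero_of_wickM {U : Set (Coord n)}
    (h : ∀ r i j, Set.EqOn (wickM κ r (f i) (g j)) 0 U) (m : ℕ) :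
    Set.EqOn (starCP κ μ f g m) 0 U := by
  intro z hz
  unfold starCP ext₂
  refine sum_eq_zero fun p _ => sum_eq_zero fun q _ => sum_eq_zero fun k _ => ?_
  rw [h k.1 q.1 q.2 hz, Pi.zero_apply, mul_zero]

theorem wickM_eqOn_zero_of_left (κ : ℝ) {U : Set (Coord n)} (hU : IsOpen U) (hUP : U ⊆ phase n)
    {f g : Fn n} (hf : Set.EqOn f 0 U) (hg : SmoothFn g) (r : ℕ) :
    Set.EqOn (wickM κ r f g) 0 U := by
  have h := Represents.zero.wickM hg.represents κ r
  rw [map_zero, LinearMap.zero_apply] at h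
  exact (wickM_eqOn κ hU hf (fun _ _ => rfl) r).trans (((h.eqOn_iff .zero).2 rfl).mono hUP)

theorem wickM_eqOn_zero_of_right (κ : ℝ) {U : Set (Coord n)} (hU : IsOpen U) (hUP : U ⊆ phase n)
    {f g : Fn n} (hf : SmoothFn f) (hg : Set.EqOn g 0 U) (r : ℕ) :
    Set.EqOn (wickM κ r f g) 0 U := by
  have h := hf.represents.wickM Represents.zero κ r
  rw [map_zero] at h
  exact (wickM_eqOn κ hU (fun _ _ => rfl) hg r).trans (((h.eqOn_iff .zero).2 rfl).mono hUP)

theorem isStarProductCP_starCP (κ : ℝ) (hμ : μ < 0) :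
    IsStarProductCP κ μ (starCP (n := n) κ μ) where
  mem _ hf _ hg := starCP_mem_homog κ hμ hf hg
  assoc _ hf _ hg _ hh := starCP_assoc κ hμ hf hg hh
  mul_one _ hf := starCP_mul_one κ hμ hf
  one_mul _ hf := starCP_one_mul κ hμ hf
  order_zero f _ g _ z _ := starCP_apply_zero κ μ f g z
  order_one _ hf _ hg _ hz := starCP_apply_one_sub κ hμ hf hg hz
  localL _ _ _ hg _ hU hUP h := starCP_eqOn_zero_of_wickM fun r i j =>
    wickM_eqOn_zero_of_left κ hU hUP (h i) (hg.1 j) r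
  localR _ hf _ _ _ hU hUP h := starCP_eqOn_zero_of_wickM fun r i j =>
    wickM_eqOn_zero_of_right κ hU hUP (hf.1 i) (h j) r

end StarProductCP

end WickCPn

end

theorem mainTheorem4_general (n : ℕ) (κ μ : ℝ) (hκ : κ ≠ 0) (hμ : μ < 0) :
    (∀ f : Fn n, SmoothFn f →
      SmoothFn (compJ μ f) ∧
      (∀ z ∈ phase n, f z = prol μ f z + compJ μ f z * J μ z) ∧
      ∀ h : Fn n, SmoothFn h → (∀ z ∈ phase n, f z = prol μ f z + h z * J μ z) →
        Set.EqOn h (compJ μ f) (phase n)) ∧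
    (∀ f : Fn n, SmoothFn f → ∀ z ∈ phase n, flow κ 0 z = z ∧ ∀ t : ℝ,
      HasDerivAt (fun s => f (flow κ s z)) (poisson κ f (J μ) (flow κ t z)) t) ∧
    (∀ f : Fn n, SmoothFn f → ∀ r : ℕ,
      Set.EqOn (opT κ μ r f) ((opK κ μ)^[r] f) (phase n)) ∧
    (∀ f ∈ smoothSeries n, SEq (oneSubLambdaK κ μ (ext (opT κ μ) f)) f ∧
      SEq (ext (opT κ μ) (oneSubLambdaK κ μ f)) f) ∧
    algB n κ μ ∩ spaceF n μ = homog n ∧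
    starB n κ μ ∩ spaceF n μ = homog n ∧
    (∃ S : ℕ → Fn n → Fn n, IsOpS κ μ S) ∧
    (∀ S : ℕ → Fn n → Fn n, IsOpS κ μ S → ∀ f ∈ algB n κ μ ∩ spaceF n μ, SEq (ext S f) f) ∧
    (∀ S : ℕ → Fn n → Fn n, IsOpS κ μ S →
      ∀ f ∈ algB n κ μ ∩ spaceF n μ, ∀ g ∈ algB n κ μ ∩ spaceF n μ,
        IsReducedProduct κ μ S f g (starCP κ μ f g) ∧
        ∀ h : Series n, IsReducedProduct κ μ S f g h → SEq h (starCP κ μ f g)) ∧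
    (∀ f ∈ homog n, ∀ g ∈ homog n,
      SEq (starCP κ μ f g) (prolS μ (ext (fun r => (opK κ μ)^[r]) (wick κ f g)))) ∧
    IsStarProductCP κ μ (starCP (n := n) κ μ) ∧
    (∀ k l : ℕ, 1 ≤ k → (coeffA k l : ℚ) = 1 / ((k - 1).factorial : ℚ) *
      ∑ j ∈ Finset.Icc 1 k,
        ((k - 1).choose (j - 1) : ℚ) * (-1) ^ (k + l - j) * (j : ℚ) ^ (k + l - 1)) ∧
    (∀ f ∈ homog n, ∀ g ∈ homog n, SEq (starCP κ μ f g) (starBBEW κ μ f g)) ∧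
    (∀ f ∈ homog n, ∀ g ∈ homog n,
      IsMarsdenWeinsteinProduct κ μ f g (starCP κ μ f g) ∧
      ∀ h : Series n, IsMarsdenWeinsteinProduct κ μ f g h → SEq h (starCP κ μ f g)) := by
  have hBF := algB_inter_spaceF (n := n) hκ hμ
  refine ⟨fun f hf => ⟨hf.compJ hμ, fun z hz => hf.eq_prol_add_compJ_mul_J hμ hz,
      fun h hh heq => hf.eqOn_compJ hμ hh heq⟩,
    fun f hf z hz => ⟨flow_zero κ z, hasDerivAt_comp_flow κ μ hf hz⟩,
    fun f hf r => opT_eqOn_opK_iterate κ hμ hf r,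
    fun f hf => ⟨oneSubLambdaK_ext_opT κ hμ hf, ext_opT_oneSubLambdaK κ hμ hf⟩,
    hBF, starB_inter_spaceF hκ hμ, ⟨_, isOpS_constS hκ hμ⟩,
    fun S hS f hf => hS.ext_sEq hκ hμ (hBF ▸ hf),
    fun S hS f hf g hg => ?_,
    fun f hf g hg => starCP_sEq_prolS κ hμ hf hg,
    isStarProductCP_starCP κ hμ, coeffA_eq,
    fun f _ g _ m z _ => congrFun (congrFun (starCP_eq_starBBEW κ μ f g) m) z,
    fun f hf g hg => ⟨(isMarsdenWeinsteinProduct_iff hμ hf hg).2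
      ⟨starCP_mem_homog κ hμ hf hg, fun _ _ _ => rfl⟩,
      fun h hh => ((isMarsdenWeinsteinProduct_iff hμ hf hg).1 hh).2⟩⟩
  rw [hBF] at hf hg
  exact ⟨(isReducedProduct_iff hκ hμ hS hf hg).2
    ⟨starCP_mem_homog κ hμ hf hg, fun _ _ _ => rfl⟩,
    fun h hh => ((isReducedProduct_iff hκ hμ hS hf hg).1 hh).2⟩

theorem mainTheorem4 (n : ℕ) (κ μ : ℝ) (hκ : 0 < κ) (hμ : μ < 0) :
    -- `compJ` is the unique smooth solution of `f = prol f + h J`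
    (∀ f : Fn n, SmoothFn f →
      SmoothFn (compJ μ f) ∧
      (∀ z ∈ phase n, f z = prol μ f z + compJ μ f z * J μ z) ∧
      ∀ h : Fn n, SmoothFn h → (∀ z ∈ phase n, f z = prol μ f z + h z * J μ z) →
        Set.EqOn h (compJ μ f) (phase n)) ∧
    -- `flow` is the Hamiltonian flow of `J`
    (∀ f : Fn n, SmoothFn f → ∀ z ∈ phase n, flow κ 0 z = z ∧ ∀ t : ℝ,
      HasDerivAt (fun s => f (flow κ s z)) (poisson κ f (J μ) (flow κ t z)) t) ∧
    -- `T = ∑ λʳ Kʳ = 1 / (1 - λ K)`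
    (∀ f : Fn n, SmoothFn f → ∀ r : ℕ,
      Set.EqOn (opT κ μ r f) ((opK κ μ)^[r] f) (phase n)) ∧
    (∀ f ∈ smoothSeries n, SEq (oneSubLambdaK κ μ (ext (opT κ μ) f)) f ∧
      SEq (ext (opT κ μ) (oneSubLambdaK κ μ f)) f) ∧
    -- `B ∩ F` and `B* ∩ F` are both the space of homogeneous series
    algB n κ μ ∩ spaceF n μ = homog n ∧
    starB n κ μ ∩ spaceF n μ = homog n ∧
    -- the operator `S` exists, and is the identity on `B ∩ F`
    (∃ S : ℕ → Fn n → Fn n, IsOpS κ μ S) ∧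
    (∀ S : ℕ → Fn n → Fn n, IsOpS κ μ S → ∀ f ∈ algB n κ μ ∩ spaceF n μ, SEq (ext S f) f) ∧
    -- the reduced product is given by the explicit formula
    (∀ S : ℕ → Fn n → Fn n, IsOpS κ μ S →
      ∀ f ∈ algB n κ μ ∩ spaceF n μ, ∀ g ∈ algB n κ μ ∩ spaceF n μ,
        IsReducedProduct κ μ S f g (starCP κ μ f g) ∧
        ∀ h : Series n, IsReducedProduct κ μ S f g h → SEq h (starCP κ μ f g)) ∧
    (∀ f ∈ homog n, ∀ g ∈ homog n,
      SEq (starCP κ μ f g) (prolS μ (ext (fun r => (opK κ μ)^[r]) (wick κ f g)))) ∧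
    -- it is a star product on the complex projective space
    IsStarProductCP κ μ (starCP (n := n) κ μ) ∧
    -- the explicit coefficients
    (∀ k l : ℕ, 1 ≤ k → (coeffA k l : ℚ) = 1 / ((k - 1).factorial : ℚ) *
      ∑ j ∈ Finset.Icc 1 k,
        ((k - 1).choose (j - 1) : ℚ) * (-1) ^ (k + l - j) * (j : ℚ) ^ (k + l - 1)) ∧
    -- coincidence with the star product of Bordemann, Brischle, Emmrich and Waldmann
    (∀ f ∈ homog n, ∀ g ∈ homog n, SEq (starCP κ μ f g) (starBBEW κ μ f g)) ∧
    (∀ f ∈ homog n, ∀ g ∈ homog n,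
      IsMarsdenWeinsteinProduct κ μ f g (starCP κ μ f g) ∧
      ∀ h : Series n, IsMarsdenWeinsteinProduct κ μ f g h → SEq h (starCP κ μ f g)) :=
  mainTheorem4_general n κ μ hκ.ne' hμ
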